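/- Let $k$ be an algebraically closed field. A variety over $k$ is a separated scheme of finite type over $k$ (not assumed connected), and it is normal if all its local rings are integrally closed domains. A Cartier divisor $D$ on a normal (not necessarily proper) variety $U/k$ is called big if for all sufficiently large integers $m$ the rational map $x \mapsto [s_i(x)]_i$ associated to the complete linear system $|mD|$, where $(s_i)_i$ is a $k$-basis of the (possibly infinite-dimensional) space $\mathrm{H}^0(U,\mathcal{O}_U(mD))$, is defined on a dense open subset of $U$ and is generically finite, i.e., quasi-finite on some dense open subset of $U$. A normal variety is locally $\mathbb{Q}$-factorial everywhere if for every point $x \in U$ each Weil divisor on $\operatorname{Spec}\mathcal{O}_{U,x}$ has a positive multiple that is principal. Let $U/k$ be a normal variety such that one of the following holds: (a) $U$ is quasi-projective, i.e., it admits an immersion over $k$ into some $\mathbb{P}^n_k$; (b) $U$ is isomorphic to a product over $k$ of finitely many normal varieties over $k$, each of which has a big Cartier divisor; (c) $U$ is locally $\mathbb{Q}$-factorial everywhere. Then $U$ has a big Cartier divisor. -/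

import Mathlib

open CategoryTheory AlgebraicGeometry

universe u

noncomputable section

namespace BigDivisors

/-- Schemes over the field `k`. -/
abbrev SchemeOver (k : Type u) [Field k] : Type (u + 1) :=
  Over (Spec (CommRingCat.of k))

variable {k : Type u} [Field k]

/-- A variety over `k` is a separated scheme of finite type over `k`. In particular it may be
reducible, disconnected or empty. -/
structure IsVariety (U : SchemeOver k) : Prop where
  separated : IsSeparated U.hom
  locallyOfFiniteType : LocallyOfFiniteType U.hom
  quasiCompact : QuasiCompact U.hom

/-- A scheme is normal if all its local rings are integrally closed domains. -/
def IsNormal (X : Scheme.{u}) : Prop :=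
  ∀ x : X, IsDomain (X.presheaf.stalk x) ∧ IsIntegrallyClosed (X.presheaf.stalk x)

/-! ### Rational functions -/

/-- The ring of rational functions on a reduced Noetherian scheme `U`: the product of the local
rings at the generic points of the irreducible components (which are fields). -/
def RatFun (U : SchemeOver k) : Type u :=
  ∀ η : genericPoints U.left, U.left.presheaf.stalk (η : U.left)

instance (U : SchemeOver k) : CommRing (RatFun U) :=
  inferInstanceAs (CommRing (∀ η : genericPoints U.left, U.left.presheaf.stalk (η : U.left)))

/-- The structure of a `k`-algebra on the local rings of a `k`-scheme. -/
def constStalk (U : SchemeOver k) (x : U.left) : k →+* U.left.presheaf.stalk x :=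
  (U.left.presheaf.germ ⊤ x trivial).hom.comp
    ((U.hom.appTop).hom.comp (Scheme.ΓSpecIso (CommRingCat.of k)).inv.hom)

instance (U : SchemeOver k) : Algebra k (RatFun U) :=
  RingHom.toAlgebra (R := k) (S := RatFun U)
    (RingHom.pi fun η : genericPoints U.left => constStalk U (η : U.left))

/-- The stalk at `x` of the sheaf of rational functions: the product of the local rings at the
generic points of the irreducible components through `x`. -/
def RatFunAt (U : SchemeOver k) (x : U.left) : Type u :=
  ∀ η : {η : genericPoints U.left // (η : U.left) ⤳ x}, U.left.presheaf.stalk (η.1 : U.left)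

instance (U : SchemeOver k) (x : U.left) : CommRing (RatFunAt U x) :=
  inferInstanceAs (CommRing (∀ η : {η : genericPoints U.left // (η : U.left) ⤳ x},
    U.left.presheaf.stalk (η.1 : U.left)))

/-- The map `K(U) → K_x` from rational functions to the stalk at `x` of the sheaf of rational
functions. -/
def ratGerm (U : SchemeOver k) (x : U.left) : RatFun U →+* RatFunAt U x where
  toFun φ := fun η => φ η.1
  map_one' := rfl
  map_mul' _ _ := rfl
  map_zero' := rfl
  map_add' _ _ := rfl

/-- The map `𝒪_x → K_x` from the local ring at `x` to the stalk at `x` of the sheaf of rational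
functions. -/
def toRatFunAt (U : SchemeOver k) (x : U.left) : U.left.presheaf.stalk x →+* RatFunAt U x :=
  RingHom.pi fun η : {η : genericPoints U.left // (η : U.left) ⤳ x} =>
    (U.left.presheaf.stalkSpecializes η.2).hom

/-! ### Cartier divisors -/

/-- The stalk `K_xˣ / 𝒪_xˣ` of the sheaf of Cartier divisors. -/
abbrev CartierStalk (U : SchemeOver k) (x : U.left) : Type u :=
  (RatFunAt U x)ˣ ⧸ (Units.map (toRatFunAt U x : U.left.presheaf.stalk x →* RatFunAt U x)).range

/-- The germ at `x` of the principal divisor of an invertible rational function. -/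
def principalGerm (U : SchemeOver k) (x : U.left) : (RatFun U)ˣ →* CartierStalk U x :=
  (QuotientGroup.mk' _).comp (Units.map (ratGerm U x : RatFun U →* RatFunAt U x))

/-- The global sections of the sheaf `Kˣ / 𝒪ˣ`, as families of germs which are locally given by
a single invertible rational function, a local equation. -/
def cartierSubgroup (U : SchemeOver k) : Subgroup (∀ x : U.left, CartierStalk U x) where
  carrier := {D | ∀ x : U.left, ∃ V : U.left.Opens, x ∈ V ∧
    ∃ f : (RatFun U)ˣ, ∀ y ∈ V, D y = principalGerm U y f}
  one_mem' x := ⟨⊤, trivial, 1, fun y _ => by simp⟩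
  mul_mem' {D E} hD hE x := by
    obtain ⟨V, hV, f, hf⟩ := hD x
    obtain ⟨W, hW, g, hg⟩ := hE x
    exact ⟨V ⊓ W, ⟨hV, hW⟩, f * g, fun y hy => by simp [hf y hy.1, hg y hy.2]⟩
  inv_mem' {D} hD x := by
    obtain ⟨V, hV, f, hf⟩ := hD x
    exact ⟨V, hV, f⁻¹, fun y hy => by simp [hf y hy]⟩

/-- The group of Cartier divisors on `U`, written additively. -/
abbrev CartierDivisor (U : SchemeOver k) : Type u := Additive (cartierSubgroup U)

/-- `f` is a local equation of the Cartier divisor `D` at `x`. -/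
def IsLocalEquation {U : SchemeOver k} (D : CartierDivisor U) (x : U.left)
    (f : (RatFunAt U x)ˣ) : Prop :=
  (QuotientGroup.mk f : CartierStalk U x) = (Additive.toMul D).1 x

/-- The space `H⁰(U, 𝒪(D))` of rational functions `s` such that `s f` is regular at `x` for all
points `x` and all local equations `f` of `D` at `x`. -/
def globalSections {U : SchemeOver k} (D : CartierDivisor U) : Submodule k (RatFun U) where
  carrier := {s | ∀ (x : U.left) (f : (RatFunAt U x)ˣ), IsLocalEquation D x f →
    ratGerm U x s * f ∈ (toRatFunAt U x).range}
  zero_mem' x f _ := by simp [zero_mem]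
  add_mem' {s t} hs ht x f hf := by
    rw [map_add, add_mul]
    exact add_mem (hs x f hf) (ht x f hf)
  smul_mem' c s hs x f hf := by
    have hc : ratGerm U x (algebraMap k (RatFun U) c) ∈ (toRatFunAt U x).range := by
      refine ⟨constStalk U x c, ?_⟩
      funext η
      exact U.left.presheaf.germ_stalkSpecializes_apply (U := ⊤) trivial η.2 _
    rw [Algebra.smul_def, map_mul, mul_assoc]
    exact mul_mem hc (hs x f hf)

/-- The rational function `s` generates the sheaf `𝒪(D)` at the point `x`. -/
def GeneratesAt {U : SchemeOver k} (D : CartierDivisor U) (s : RatFun U) (x : U.left) : Prop :=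
  ∀ f : (RatFunAt U x)ˣ, IsLocalEquation D x f →
    ∃ g : U.left.presheaf.stalk x, IsUnit g ∧ toRatFunAt U x g = ratGerm U x s * f

/-! ### Projective space -/

variable (k) in
/-- The grading of the polynomial ring by degree. -/
abbrev grading (ι : Type u) : ℕ → Submodule k (MvPolynomial ι k) :=
  MvPolynomial.homogeneousSubmodule ι k

instance (ι : Type u) : GradedAlgebra (grading k ι) := MvPolynomial.gradedAlgebra

variable (k) in
/-- The projective space `Proj k[xᵢ : i ∈ ι]` over `k`, whose homogeneous coordinates are indexed
by a possibly infinite set `ι`. -/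
def projectiveSpace (ι : Type u) : SchemeOver k :=
  Over.mk (Proj.toSpecZero (grading k ι) ≫
    Spec.map (CommRingCat.ofHom (algebraMap k (grading k ι 0))))

variable (k) in
/-- The standard open set `D₊(xᵢ)` of projective space. -/
def stdOpen {ι : Type u} (i : ι) : (projectiveSpace k ι).left.Opens :=
  Proj.basicOpen (grading k ι) (MvPolynomial.X i)

variable (k) in
/-- The regular function `xⱼ / xᵢ` on `D₊(xᵢ)`. -/
def coordQuot {ι : Type u} (i j : ι) : Γ((projectiveSpace k ι).left, stdOpen k i) :=
  (Proj.awayToSection (grading k ι) (MvPolynomial.X i)).hom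
    (HomogeneousLocalization.Away.mk (grading k ι) (MvPolynomial.isHomogeneous_X k i) 1
      (MvPolynomial.X j) (by simpa using MvPolynomial.isHomogeneous_X k j))

/-- `U` is quasi-projective: it admits an immersion over `k` into some `ℙⁿ`. -/
def IsQuasiProjective (U : SchemeOver k) : Prop :=
  ∃ (n : ℕ) (i : U ⟶ projectiveSpace k (ULift.{u} (Fin (n + 1)))), IsImmersion i.left

/-! ### Linear systems and big divisors -/

/-- The partial map `φ` from `U` to projective space represents the rational map
`x ↦ [sᵢ(x)]ᵢ` defined by sections `sᵢ` of `𝒪(D)`: it is a morphism over `k`, on its domain the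
preimage of `D₊(xᵢ)` is the set where `sᵢ` generates `𝒪(D)`, and there `xⱼ / xᵢ` pulls back to
the rational function `sⱼ / sᵢ`. -/
structure RepresentsSections {U : SchemeOver k} (D : CartierDivisor U) {ι : Type u}
    (s : ι → globalSections D)
    (φ : U.left.PartialMap (projectiveSpace k ι).left) : Prop where
  isOver : φ.hom ≫ (projectiveSpace k ι).hom = φ.domain.ι ≫ U.hom
  mem_stdOpen_iff : ∀ (i : ι) (x : φ.domain),
    φ.hom x ∈ stdOpen k i ↔ GeneratesAt D (s i : RatFun U) x.1
  pullback_coordQuot : ∀ (i j : ι) (η : genericPoints U.left) (h : (η : U.left) ∈ φ.domain)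
    (h' : (⟨η, h⟩ : φ.domain) ∈ φ.hom ⁻¹ᵁ stdOpen k i),
    (φ.domain.stalkIso ⟨η, h⟩).hom.hom
      ((φ.domain.toScheme.presheaf.germ (φ.hom ⁻¹ᵁ stdOpen k i) ⟨η, h⟩ h').hom
        ((φ.hom.app (stdOpen k i)).hom (coordQuot k i j))) * (s i : RatFun U) η =
      (s j : RatFun U) η

/-- The rational map associated to the complete linear system `|D|`, given by the sections in a
`k`-basis of `H⁰(U, 𝒪(D))`, exists and is generically finite, i.e. it is quasi-finite on some
dense open subset of `U`. The space `H⁰(U, 𝒪(D))` may have infinite dimension, since `U` need not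
be proper; the condition does not depend on the choice of the basis. -/
def IsGenericallyFiniteSystem {U : SchemeOver k} (D : CartierDivisor U) : Prop :=
  ∃ (ι : Type u) (s : Module.Basis ι k (globalSections D))
    (φ : U.left.PartialMap (projectiveSpace k ι).left),
    RepresentsSections D s φ ∧ LocallyQuasiFinite φ.hom

/-- A Cartier divisor `D` is big if the rational map associated to the linear system `|mD|` is
generically finite for all sufficiently large `m`. -/
def IsBig {U : SchemeOver k} (D : CartierDivisor U) : Prop :=
  ∀ᶠ m : ℕ in Filter.atTop, IsGenericallyFiniteSystem (m • D)

/-- `U` has a big Cartier divisor. -/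
def HasBigDivisor (U : SchemeOver k) : Prop :=
  ∃ D : CartierDivisor U, IsBig D

/-! ### Products -/

/-- `U` is a (fibre) product over `k` of finitely many normal varieties with big divisors. -/
def IsProductOfVarietiesWithBigDivisors (U : SchemeOver k) : Prop :=
  ∃ (n : ℕ) (X : Fin n → SchemeOver k) (p : ∀ i, U ⟶ X i),
    Nonempty (Limits.IsLimit (Limits.Fan.mk U p)) ∧
    ∀ i, IsVariety (X i) ∧ IsNormal (X i).left ∧ HasBigDivisor (X i)

/-! ### Local `ℚ`-factoriality -/

/-- The prime divisors of `Spec R`: the prime ideals of height one. -/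
abbrev PrimeDivisor (R : Type u) [CommRing R] : Type u :=
  {p : PrimeSpectrum R // p.asIdeal.height = 1}

/-- The order of vanishing of `a` along a prime divisor `p`, i.e. the length of `R_p / (a)`; it is
finite if `R` is a Noetherian domain and `a ≠ 0`. -/
def ordAt {R : Type u} [CommRing R] (p : PrimeDivisor R) (a : R) : ℤ :=
  ((Ring.ord (Localization.AtPrime p.1.asIdeal)
    (algebraMap R (Localization.AtPrime p.1.asIdeal) a)).toNat : ℤ)

/-- A Weil divisor `D` on the spectrum of a Noetherian normal domain `R` is principal: it is the
divisor of a nonzero element `a / b` of the field of fractions. -/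
def IsPrincipalWeil {R : Type u} [CommRing R] (D : PrimeDivisor R →₀ ℤ) : Prop :=
  ∃ a b : R, a ≠ 0 ∧ b ≠ 0 ∧ ∀ p, D p = ordAt p a - ordAt p b

/-- A Noetherian normal domain is `ℚ`-factorial if every Weil divisor on its spectrum has a
positive multiple that is principal. For local rings this is to say that every Weil divisor has a
positive multiple that is Cartier. -/
def IsQFactorialRing (R : Type u) [CommRing R] : Prop :=
  ∀ D : PrimeDivisor R →₀ ℤ, ∃ n : ℕ, 0 < n ∧ IsPrincipalWeil (n • D)

/-- A normal scheme is locally `ℚ`-factorial everywhere if all its local rings are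
`ℚ`-factorial. -/
def IsLocallyQFactorial (X : Scheme.{u}) : Prop :=
  ∀ x : X, IsQFactorialRing (X.presheaf.stalk x)

end BigDivisors

end

/-!
The bridge between the three cases is the notion `AlgAmple` of an algebraically ample divisor `D`:
the constant `1` is a section of `𝒪(D)`, and at each generic point the function field is algebraic
over the ring generated by the values of the sections of all `𝒪(mD)`.

An algebraically ample divisor is big (`AlgAmple.isBig`). Function fields of varieties are finitely
generated, and the spaces of sections of `𝒪(mD)` increase with `m`, since `1` is a section; so for
large `m` the function fields are already algebraic over the values of the sections of `𝒪(mD)`. The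
sections define a morphism to projective space on the open set where `D` is trivial, which contains
all generic points. Its local rings there contain the values of the sections, divided by the section
`1`, so by finite generation it is quasi-finite at the generic points. As the quasi-finite locus is
open, the morphism is quasi-finite on a dense open set.

Conversely, if there is a big divisor, then there is an algebraically ample one
(`IsBig.exists_algAmple`): after adding the divisor of a rational function the quotients of sections
by a fixed nonzero section are sections of an effective divisor, and quasi-finiteness at the generic
point says that they generate the function field up to algebraic extension.

It remains to construct algebraically ample divisors.

* An immersion is quasi-finite. Given a quasi-finite map to projective space, the pullback of the
  divisor of zeros of a coordinate, chosen separately for each component, is algebraically ample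
  (`exists_algAmple_of_locallyQuasiFinite`).
* On a product, the sum of the pullbacks of algebraically ample divisors of the factors is
  algebraically ample (`exists_algAmple_of_product`). The projections are flat, hence map generic
  points to generic points, so that divisors can be pulled back; and the function field of a product
  is generated by the local rings of the factors (`isFieldGenerated_product`).
* On a locally `ℚ`-factorial variety let `φ` be a nonzero rational function. At each point some
  positive multiple of the polar divisor of `φ` has an equation, which remains one nearby
  (`IsPolarEqn.eventually`). By compactness some multiple of the polar divisor is Cartier, and it
  is an effective divisor with `φ` as a section (`exists_cartierDivisor_of_isQFactorialRing`). The
  sum of these divisors, for `φ` in a finite set of generators of the function fields, is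
  algebraically ample. Divisors are compared by means of the fact that Noetherian normal domains are
  determined by their localizations at primes of height one (`dvd_of_forall_height_eq_one`).
-/

noncomputable section

namespace BigDivisors

/-! ### Local rings and generic points -/

section

section Points

variable {X : Scheme.{u}}

theorem germ_injective_of_isAffineOpen {W : X.Opens} (hW : IsAffineOpen W) [IsDomain Γ(X, W)]
    (y : X) (hy : y ∈ W) : Function.Injective (X.presheaf.germ W y hy) := by
  have := hW.isLocalization_stalk ⟨y, hy⟩
  exact @IsLocalization.injective _ _ _ _ _ (show _ from _) this
    (Ideal.primeCompl_le_nonZeroDivisors _)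

/-- Germs at a point of an affine open set are fractions of sections. -/
theorem exists_germ_mul_eq {W : X.Opens} (hW : IsAffineOpen W) (y : X) (hy : y ∈ W)
    (z : X.presheaf.stalk y) :
    ∃ a b : Γ(X, W), IsUnit (X.presheaf.germ W y hy b) ∧
      z * X.presheaf.germ W y hy b = X.presheaf.germ W y hy a := by
  let := TopCat.Presheaf.algebra_section_stalk X.presheaf (⟨y, hy⟩ : W)
  have := hW.isLocalization_stalk ⟨y, hy⟩
  change X.presheaf.stalk ((⟨y, hy⟩ : W) : X) at z
  obtain ⟨⟨a, b⟩, h⟩ := IsLocalization.surj (hW.primeIdealOf ⟨y, hy⟩).asIdeal.primeCompl z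
  exact ⟨a, b, IsLocalization.map_units (X.presheaf.stalk ((⟨y, hy⟩ : W) : X)) b, h⟩

/-- An affine open set with a domain as its ring of functions has a generic point. -/
theorem exists_mem_forall_specializes {W : X.Opens} (hW : IsAffineOpen W) [IsDomain Γ(X, W)] :
    ∃ w ∈ W, ∀ y ∈ W, w ⤳ y := by
  refine ⟨hW.fromSpec ⟨⊥, Ideal.isPrime_bot⟩, ?_, fun y hy => ?_⟩
  · rw [← SetLike.mem_coe, ← hW.range_fromSpec]
    exact ⟨_, rfl⟩
  · rw [show y = hW.fromSpec (hW.primeIdealOf ⟨y, hy⟩) from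
      (hW.fromSpec_primeIdealOf ⟨y, hy⟩).symm]
    refine Specializes.map ?_ hW.fromSpec.continuous
    exact (PrimeSpectrum.le_iff_specializes _ _).1 (bot_le (α := Ideal Γ(X, W)))

theorem exists_genericPoints_specializes (x : X) : ∃ η : genericPoints X, (η : X) ⤳ x := by
  refine ⟨genericPoints.ofComponent
    ⟨irreducibleComponent x, irreducibleComponent_mem_irreducibleComponents x⟩, ?_⟩
  rw [specializes_iff_mem_closure, (genericPoints.isGenericPoint_ofComponent _).def]
  exact mem_irreducibleComponent

theorem eq_of_specializes_genericPoints (η : genericPoints X) {y : X} (h : y ⤳ (η : X)) :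
    y = η := by
  have h1 : closure {(η : X)} ⊆ closure {y} := by
    rw [← specializes_iff_closure_subset]; exact h
  have h2 := η.2.2 isIrreducible_singleton.closure h1
  exact (Specializes.antisymm h (specializes_iff_closure_subset.2 h2)).eq

theorem isReduced_of_isDomain_stalk (X : Scheme.{u}) [∀ x : X, IsDomain (X.presheaf.stalk x)] :
    IsReduced X :=
  have (x : X) : _root_.IsReduced (X.presheaf.stalk x) := inferInstance
  isReduced_of_isReduced_stalk X

theorem isField_stalk_genericPoints [∀ x : X, IsDomain (X.presheaf.stalk x)]
    (η : genericPoints X) : IsField (X.presheaf.stalk (η : X)) :=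
  have := isReduced_of_isDomain_stalk X
  isField_stalk_of_closure_mem_irreducibleComponents X _ η.2

variable [IsLocallyNoetherian X] [∀ x : X, IsDomain (X.presheaf.stalk x)]

theorem exists_isAffineOpen_isDomain {V : X.Opens} {x : X} (hx : x ∈ V) :
    ∃ W : X.Opens, x ∈ W ∧ W ≤ V ∧ IsAffineOpen W ∧ IsDomain Γ(X, W) := by
  obtain ⟨W, hxW, hW, hWV, hinj⟩ := X.exists_le_and_germ_injective x V hx
  exact ⟨W, hxW, hWV, hW, Function.Injective.isDomain (X.presheaf.germ W x hxW).hom hinj⟩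

/-- As the local ring at `x` is a domain, only one irreducible component passes through `x`; hence
`RatFunAt U x` is a field and not just a product of fields. -/
theorem genericPoints_unique {x : X} {η η' : genericPoints X} (h : (η : X) ⤳ x)
    (h' : (η' : X) ⤳ x) : η = η' := by
  obtain ⟨W, hxW, -, hW, hdom⟩ := exists_isAffineOpen_isDomain (X := X) (V := ⊤) (x := x) trivial
  obtain ⟨w, -, hw⟩ := exists_mem_forall_specializes hW
  rw [Subtype.ext_iff, ← eq_of_specializes_genericPoints η (hw _ (h.mem_open W.2 hxW)),
    ← eq_of_specializes_genericPoints η' (hw _ (h'.mem_open W.2 hxW))]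

/-- The local ring at `x` embeds into the local rings at the generizations of `x`. -/
theorem stalkSpecializes_injective {x y : X} (h : y ⤳ x) :
    Function.Injective (X.presheaf.stalkSpecializes h) := by
  obtain ⟨W, hxW, -, hW, hdom⟩ := exists_isAffineOpen_isDomain (X := X) (V := ⊤) (x := x) trivial
  have key := (injective_iff_map_eq_zero (X.presheaf.stalkSpecializes h).hom).2
  refine key fun z hz => ?_
  obtain ⟨a, b, hb, hab⟩ := exists_germ_mul_eq hW x hxW z
  have h2 := congrArg (X.presheaf.stalkSpecializes h).hom hab
  rw [map_mul, hz, zero_mul] at h2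
  have h3 : X.presheaf.germ W y (h.mem_open W.2 hxW) a = 0 := by
    rw [h2]; exact (X.presheaf.germ_stalkSpecializes_apply hxW h a).symm
  have h4 : a = 0 := germ_injective_of_isAffineOpen hW y _ (h3.trans (map_zero _).symm)
  rw [h4, map_zero] at hab
  exact (hb.mul_left_eq_zero).1 hab

/-- The local ring at a generization `y` of `x` consists of fractions of elements of the local ring
at `x`. -/
theorem exists_mul_stalkSpecializes_eq_of_specializes {x y : X} (h : y ⤳ x)
    (z : X.presheaf.stalk y) : ∃ a b : X.presheaf.stalk x,
      IsUnit (X.presheaf.stalkSpecializes h b) ∧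
      z * X.presheaf.stalkSpecializes h b = X.presheaf.stalkSpecializes h a := by
  obtain ⟨W, hxW, -, hW, hdom⟩ := exists_isAffineOpen_isDomain (X := X) (V := ⊤) (x := x) trivial
  obtain ⟨a, b, hb, hab⟩ := exists_germ_mul_eq hW y (h.mem_open W.2 hxW) z
  refine ⟨X.presheaf.germ W x hxW a, X.presheaf.germ W x hxW b, ?_⟩
  erw [X.presheaf.germ_stalkSpecializes_apply hxW h, X.presheaf.germ_stalkSpecializes_apply hxW h]
  exact ⟨hb, hab⟩

theorem exists_mul_stalkSpecializes_eq {x : X} {η : genericPoints X} (h : (η : X) ⤳ x)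
    (z : X.presheaf.stalk (η : X)) :
    ∃ a b : X.presheaf.stalk x, b ≠ 0 ∧
      z * X.presheaf.stalkSpecializes h b = X.presheaf.stalkSpecializes h a := by
  obtain ⟨a, b, hb, hab⟩ := exists_mul_stalkSpecializes_eq_of_specializes h z
  refine ⟨a, b, fun h0 => hb.ne_zero ?_, hab⟩
  rw [h0]
  exact map_zero (X.presheaf.stalkSpecializes h).hom

end Points

end

/-! ### Regular functions and equations of Cartier divisors -/

section

variable {k : Type u} [Field k] {U : SchemeOver k}

/-- The rational function `φ` is regular at `x`. -/
def RegAt (U : SchemeOver k) (x : U.left) (φ : RatFun U) : Prop :=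
  ratGerm U x φ ∈ (toRatFunAt U x).range

/-- The rational function `φ` is regular and invertible at `x`. -/
def UnitAt (U : SchemeOver k) (x : U.left) (φ : RatFun U) : Prop :=
  ∃ a : U.left.presheaf.stalk x, IsUnit a ∧ toRatFunAt U x a = ratGerm U x φ

section RegAt

variable {x : U.left} {φ ψ : RatFun U}

theorem UnitAt.regAt (h : UnitAt U x φ) : RegAt U x φ :=
  let ⟨a, _, ha⟩ := h; ⟨a, ha⟩

theorem RegAt.mul (h : RegAt U x φ) (h' : RegAt U x ψ) : RegAt U x (φ * ψ) := by
  rw [RegAt, map_mul]; exact mul_mem h h'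

theorem unitAt_one : UnitAt U x 1 := ⟨1, isUnit_one, by simp⟩

theorem regAt_one : RegAt U x 1 := unitAt_one.regAt

theorem RegAt.pow (h : RegAt U x φ) (n : ℕ) : RegAt U x (φ ^ n) := by
  rw [RegAt, map_pow]; exact pow_mem h n

theorem UnitAt.mul (h : UnitAt U x φ) (h' : UnitAt U x ψ) : UnitAt U x (φ * ψ) := by
  obtain ⟨a, ha, e⟩ := h
  obtain ⟨b, hb, e'⟩ := h'
  exact ⟨a * b, ha.mul hb, by rw [map_mul, map_mul, e, e']⟩

theorem UnitAt.pow (h : UnitAt U x φ) (n : ℕ) : UnitAt U x (φ ^ n) := by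
  obtain ⟨a, ha, e⟩ := h
  exact ⟨a ^ n, ha.pow n, by rw [map_pow, map_pow, e]⟩

theorem UnitAt.of_mul_eq_one (h : UnitAt U x φ) (h' : φ * ψ = 1) : UnitAt U x ψ := by
  obtain ⟨a, ha, e⟩ := h
  obtain ⟨b, hb⟩ := ha.exists_right_inv
  refine ⟨b, IsUnit.of_mul_eq_one a (by rw [mul_comm]; exact hb), ?_⟩
  have h1 : ratGerm U x φ * ratGerm U x ψ = 1 := by rw [← map_mul, h', map_one]
  have h2 : toRatFunAt U x b * ratGerm U x φ = 1 := by rw [← e, ← map_mul, mul_comm, hb, map_one]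
  calc toRatFunAt U x b = toRatFunAt U x b * (ratGerm U x φ * ratGerm U x ψ) := by rw [h1, mul_one]
    _ = ratGerm U x ψ := by rw [← mul_assoc, h2, one_mul]

/-- The injectivity of `𝒪_x → K_x` is a hypothesis since no assumption on `U` is made here; see
`toRatFunAt_injective`. -/
theorem RegAt.unitAt_of_mul_eq_one (h : RegAt U x φ) (h' : RegAt U x ψ) (e : φ * ψ = 1)
    (hinj : Function.Injective (toRatFunAt U x)) : UnitAt U x φ := by
  obtain ⟨a, ha⟩ := h
  obtain ⟨b, hb⟩ := h'
  refine ⟨a, IsUnit.of_mul_eq_one b (hinj ?_), ha⟩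
  rw [map_mul, ha, hb, ← map_mul, e, map_one, map_one]

theorem UnitAt.inv {f : (RatFun U)ˣ} (h : UnitAt U x (f : RatFun U)) :
    UnitAt U x ((f⁻¹ : (RatFun U)ˣ) : RatFun U) :=
  h.of_mul_eq_one (by simp)

theorem principalGerm_eq_iff {f g : (RatFun U)ˣ} :
    principalGerm U x f = principalGerm U x g ↔
      UnitAt U x ((f⁻¹ * g : (RatFun U)ˣ) : RatFun U) := by
  refine Iff.trans QuotientGroup.eq ⟨?_, ?_⟩
  · rintro ⟨u, hu⟩
    refine ⟨u, u.isUnit, ?_⟩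
    have := congrArg Units.val hu
    simpa using this
  · rintro ⟨a, ha, e⟩
    refine ⟨ha.unit, Units.ext ?_⟩
    simpa using e

end RegAt

section Cartier

variable {x : U.left} {D E : CartierDivisor U}

/-- `f` is an equation of the Cartier divisor `D` at `x`. -/
def IsEqn (D : CartierDivisor U) (x : U.left) (f : (RatFun U)ˣ) : Prop :=
  (Additive.toMul D).1 x = principalGerm U x f

theorem exists_isEqn (D : CartierDivisor U) (x : U.left) :
    ∃ V : U.left.Opens, x ∈ V ∧ ∃ f : (RatFun U)ˣ, ∀ y ∈ V, IsEqn D y f :=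
  (Additive.toMul D).2 x

theorem IsEqn.add {f g : (RatFun U)ˣ} (hf : IsEqn D x f) (hg : IsEqn E x g) :
    IsEqn (D + E) x (f * g) := by
  rw [IsEqn] at *
  rw [map_mul, ← hf, ← hg]; rfl

theorem isEqn_zero : IsEqn (0 : CartierDivisor U) x 1 := by
  rw [IsEqn, map_one]; rfl

theorem IsEqn.nsmul {f : (RatFun U)ˣ} (hf : IsEqn D x f) (m : ℕ) :
    IsEqn (m • D) x (f ^ m) := by
  induction m with
  | zero => rw [zero_smul, pow_zero]; exact isEqn_zero
  | succ m ih => rw [succ_nsmul, pow_succ]; exact ih.add hf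

/-- The Cartier divisor with the equations `F x`. -/
def ofEquations (F : U.left → (RatFun U)ˣ)
    (hF : ∀ x, ∃ V : U.left.Opens, x ∈ V ∧ ∀ y ∈ V,
      UnitAt U y (((F y)⁻¹ * F x : (RatFun U)ˣ) : RatFun U)) : CartierDivisor U :=
  Additive.ofMul ⟨fun x => principalGerm U x (F x), fun x =>
    let ⟨V, hV, h⟩ := hF x
    ⟨V, hV, F x, fun y hy => principalGerm_eq_iff.2 (h y hy)⟩⟩

theorem isEqn_ofEquations (F : U.left → (RatFun U)ˣ) (hF) (x : U.left) :
    IsEqn (ofEquations F hF) x (F x) := rfl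

theorem IsEqn.exists_eq_mul {f : (RatFun U)ˣ} (hf : IsEqn D x f) {g : (RatFunAt U x)ˣ}
    (hg : IsLocalEquation D x g) : ∃ a : U.left.presheaf.stalk x, IsUnit a ∧
      (g : RatFunAt U x) = ratGerm U x f * toRatFunAt U x a := by
  have h : (QuotientGroup.mk (Units.map (ratGerm U x : RatFun U →* RatFunAt U x) f) :
      CartierStalk U x) = QuotientGroup.mk g := Eq.trans (Eq.symm hf) (Eq.symm hg)
  obtain ⟨u, hu⟩ := QuotientGroup.eq.1 h
  refine ⟨u, u.isUnit, ?_⟩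
  have h2 : g = Units.map (ratGerm U x : RatFun U →* RatFunAt U x) f *
      Units.map (toRatFunAt U x : U.left.presheaf.stalk x →* RatFunAt U x) u := by
    rw [hu, mul_inv_cancel_left]
  rw [h2]; rfl

theorem IsEqn.isLocalEquation {f : (RatFun U)ˣ} (hf : IsEqn D x f) :
    IsLocalEquation D x (Units.map (ratGerm U x : RatFun U →* RatFunAt U x) f) := Eq.symm hf

theorem IsEqn.unitAt {f g : (RatFun U)ˣ} (hf : IsEqn D x f) (hg : IsEqn D x g) :
    UnitAt U x ((f⁻¹ * g : (RatFun U)ˣ) : RatFun U) :=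
  principalGerm_eq_iff.1 (hf.symm.trans hg)

theorem regAt_of_mem_globalSections {s : RatFun U} (hs : s ∈ globalSections D) {f : (RatFun U)ˣ}
    (hf : IsEqn D x f) : RegAt U x (s * f) := by
  rw [RegAt, map_mul]
  exact hs x _ hf.isLocalEquation

theorem mem_globalSections_of_regAt {s : RatFun U}
    (h : ∀ x, ∃ f : (RatFun U)ˣ, IsEqn D x f ∧ RegAt U x (s * f)) : s ∈ globalSections D := by
  intro x g hg
  obtain ⟨f, hf, hr⟩ := h x
  obtain ⟨a, -, e⟩ := hf.exists_eq_mul hg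
  rw [e, ← mul_assoc, ← map_mul]
  exact mul_mem hr ⟨a, rfl⟩

theorem generatesAt_iff {s : RatFun U} {f : (RatFun U)ˣ} (hf : IsEqn D x f) :
    GeneratesAt D s x ↔ UnitAt U x (s * f) := by
  constructor
  · intro h
    obtain ⟨g, hg, e⟩ := h _ hf.isLocalEquation
    exact ⟨g, hg, by rw [e, map_mul]; rfl⟩
  · rintro ⟨g, hg, e⟩ g' hg'
    obtain ⟨a, ha, e'⟩ := hf.exists_eq_mul hg'
    exact ⟨g * a, hg.mul ha, by rw [map_mul, e, e', map_mul, mul_assoc]⟩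

theorem mul_mem_globalSections {s t : RatFun U} (hs : s ∈ globalSections D)
    (ht : t ∈ globalSections E) : s * t ∈ globalSections (D + E) := by
  refine mem_globalSections_of_regAt fun x => ?_
  obtain ⟨V, hV, f, hf⟩ := exists_isEqn D x
  obtain ⟨W, hW, g, hg⟩ := exists_isEqn E x
  refine ⟨f * g, (hf x hV).add (hg x hW), ?_⟩
  have := (regAt_of_mem_globalSections hs (hf x hV)).mul
    (regAt_of_mem_globalSections ht (hg x hW))
  rwa [mul_mul_mul_comm, ← Units.val_mul] at this

theorem one_mem_globalSections_zero : (1 : RatFun U) ∈ globalSections (0 : CartierDivisor U) :=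
  mem_globalSections_of_regAt fun x => ⟨1, isEqn_zero, by simpa using regAt_one⟩

theorem one_mem_globalSections_nsmul (h : (1 : RatFun U) ∈ globalSections D) (m : ℕ) :
    (1 : RatFun U) ∈ globalSections (m • D) := by
  induction m with
  | zero => rw [zero_smul]; exact one_mem_globalSections_zero
  | succ m ih => rw [succ_nsmul, ← mul_one 1]; exact mul_mem_globalSections ih h

theorem globalSections_le_of_one_mem (h : (1 : RatFun U) ∈ globalSections E) :
    globalSections D ≤ globalSections (D + E) := fun s hs => by
  rw [← mul_one s]; exact mul_mem_globalSections hs h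

/-- If `D` is effective, then multiplication by the section `1` embeds the sections of `m D` into
those of `(m + 1) D`. -/
theorem globalSections_nsmul_mono (h : (1 : RatFun U) ∈ globalSections D) :
    Monotone fun m : ℕ => globalSections (m • D) := by
  intro m n hmn
  obtain ⟨l, rfl⟩ := Nat.exists_eq_add_of_le hmn
  simp only [add_nsmul]
  exact globalSections_le_of_one_mem (one_mem_globalSections_nsmul h l)

theorem one_mem_globalSections_sum {ι : Type*} (s : Finset ι) {D : ι → CartierDivisor U}
    (h : ∀ i ∈ s, (1 : RatFun U) ∈ globalSections (D i)) :
    (1 : RatFun U) ∈ globalSections (∑ i ∈ s, D i) := by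
  classical
  induction s using Finset.induction_on with
  | empty => simpa using one_mem_globalSections_zero
  | insert a s ha ih =>
    rw [Finset.sum_insert ha, ← mul_one 1]
    exact mul_mem_globalSections (h a (by simp)) (ih fun i hi => h i (by simp [hi]))

theorem globalSections_nsmul_le_sum {ι : Type*} (s : Finset ι) {D : ι → CartierDivisor U}
    (h : ∀ i ∈ s, (1 : RatFun U) ∈ globalSections (D i)) {i : ι} (hi : i ∈ s) (m : ℕ) :
    globalSections (m • D i) ≤ globalSections (m • ∑ j ∈ s, D j) := by
  classical
  rw [← Finset.add_sum_erase s D hi, nsmul_add]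
  exact globalSections_le_of_one_mem (one_mem_globalSections_nsmul
    (one_mem_globalSections_sum _ fun j hj => h j (Finset.mem_of_mem_erase hj)) m)

end Cartier

section Domain

variable [IsLocallyNoetherian U.left] [∀ x : U.left, IsDomain (U.left.presheaf.stalk x)]
variable {x : U.left} {φ ψ : RatFun U}

/-- Equalities in `K_x` can be tested at the unique generic point specializing to `x`. -/
theorem toRatFunAt_eq_iff {η : genericPoints U.left} (h : (η : U.left) ⤳ x)
    {a : U.left.presheaf.stalk x} : toRatFunAt U x a = ratGerm U x φ ↔
      U.left.presheaf.stalkSpecializes h a = φ η := by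
  constructor
  · intro e
    exact congrFun e ⟨η, h⟩
  · intro e
    funext ⟨η', h'⟩
    obtain rfl := genericPoints_unique h h'
    exact e

theorem ratGerm_eq_iff {η : genericPoints U.left} (h : (η : U.left) ⤳ x) :
    ratGerm U x φ = ratGerm U x ψ ↔ φ η = ψ η := by
  constructor
  · intro e
    exact congrFun e ⟨η, h⟩
  · intro e
    funext ⟨η', h'⟩
    obtain rfl := genericPoints_unique h h'
    exact e

theorem regAt_congr {η : genericPoints U.left} (h : (η : U.left) ⤳ x) (e : φ η = ψ η) :
    RegAt U x φ ↔ RegAt U x ψ := by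
  rw [RegAt, RegAt, (ratGerm_eq_iff h).2 e]

theorem toRatFunAt_injective (x : U.left) : Function.Injective (toRatFunAt U x) := by
  obtain ⟨η, h⟩ := exists_genericPoints_specializes x
  intro a b e
  exact stalkSpecializes_injective h (congrFun e ⟨η, h⟩)

/-- Rational functions are regular at the generic points, as the local ring is the field itself. -/
theorem regAt_generic (η : genericPoints U.left) (φ : RatFun U) : RegAt U η φ := by
  refine ⟨φ η, (toRatFunAt_eq_iff (specializes_rfl)).2 ?_⟩
  simp [TopCat.Presheaf.stalkSpecializes_refl]

omit [IsLocallyNoetherian U.left] in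
theorem isUnit_ratFun_iff : IsUnit φ ↔ ∀ η, φ η ≠ 0 := by
  refine Pi.isUnit_iff.trans (forall_congr' fun η => ?_)
  have hK := isField_stalk_genericPoints η
  refine ⟨fun h h0 => not_isUnit_zero (M₀ := U.left.presheaf.stalk (η : U.left)) (h0 ▸ h),
    fun h => ?_⟩
  obtain ⟨b, hb⟩ := hK.mul_inv_cancel h
  exact IsUnit.of_mul_eq_one b hb

/-- A rational function which is regular at `x` is given by a section near `x`. -/
theorem RegAt.exists_section (h : RegAt U x φ) {V₀ : U.left.Opens} (hx : x ∈ V₀) :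
    ∃ V : U.left.Opens, x ∈ V ∧ V ≤ V₀ ∧ ∃ f : Γ(U.left, V), ∀ y, ∀ hy : y ∈ V,
      toRatFunAt U y (U.left.presheaf.germ V y hy f) = ratGerm U y φ := by
  obtain ⟨a, ha⟩ := h
  obtain ⟨V₁, hV₁, hxV₁, f, rfl⟩ := U.left.presheaf.exists_le_germ_eq a hx
  obtain ⟨V, hxV, hVV₁, hV, hdom⟩ := exists_isAffineOpen_isDomain hxV₁
  refine ⟨V, hxV, hVV₁.trans hV₁, U.left.presheaf.map (homOfLE hVV₁).op f, fun y hy => ?_⟩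
  obtain ⟨w, -, hw⟩ := exists_mem_forall_specializes hV
  obtain ⟨η, hη⟩ := exists_genericPoints_specializes x
  have e := eq_of_specializes_genericPoints η (hw _ (hη.mem_open V.2 hxV))
  have hηy : (η : U.left) ⤳ y := e ▸ hw y hy
  rw [toRatFunAt_eq_iff hηy, TopCat.Presheaf.germ_res_apply]
  rw [toRatFunAt_eq_iff hη] at ha
  rw [← ha]
  erw [TopCat.Presheaf.germ_stalkSpecializes_apply, TopCat.Presheaf.germ_stalkSpecializes_apply]

theorem UnitAt.eventually (h : UnitAt U x φ) :
    ∃ V : U.left.Opens, x ∈ V ∧ ∀ y ∈ V, UnitAt U y φ := by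
  obtain ⟨a, ha, e⟩ := h
  obtain ⟨V, hx, -, f, hf⟩ := RegAt.exists_section ⟨a, e⟩ (V₀ := ⊤) trivial
  have : U.left.presheaf.germ V x hx f = a := toRatFunAt_injective x ((hf x hx).trans e.symm)
  refine ⟨U.left.basicOpen f, (Scheme.mem_basicOpen _ _ _ hx).2 (this ▸ ha), fun y hy => ?_⟩
  have hyV := U.left.basicOpen_le f hy
  exact ⟨_, (Scheme.mem_basicOpen _ _ _ hyV).1 hy, hf y hyV⟩

theorem section_ext_of_toRatFunAt {V : U.left.Opens} {f g : Γ(U.left, V)}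
    (h : ∀ η : genericPoints U.left, ∀ hη : (η : U.left) ∈ V,
      U.left.presheaf.germ V η hη f = U.left.presheaf.germ V η hη g) : f = g := by
  refine TopCat.Presheaf.section_ext U.left.sheaf V f g fun y hy => ?_
  obtain ⟨η, hη⟩ := exists_genericPoints_specializes y
  refine stalkSpecializes_injective hη ?_
  have := h η (hη.mem_open V.2 hy)
  erw [TopCat.Presheaf.germ_stalkSpecializes_apply, TopCat.Presheaf.germ_stalkSpecializes_apply]
  exact this

/-- Rational functions which are regular at all points of `V` are sections over `V`. -/
theorem exists_section_of_regAt {V : U.left.Opens} (h : ∀ x ∈ V, RegAt U x φ) :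
    ∃ f : Γ(U.left, V), ∀ y, ∀ hy : y ∈ V,
      toRatFunAt U y (U.left.presheaf.germ V y hy f) = ratGerm U y φ := by
  choose W hxW hWV f hf using fun x : V => (h x x.2).exists_section x.2
  have hcomp : TopCat.Presheaf.IsCompatible U.left.presheaf W f := by
    intro i j
    refine TopCat.Presheaf.section_ext U.left.sheaf _ _ _ fun y hy => ?_
    refine toRatFunAt_injective y ?_
    erw [TopCat.Presheaf.germ_res_apply, TopCat.Presheaf.germ_res_apply]
    exact (hf i y hy.1).trans (hf j y hy.2).symm
  obtain ⟨s, hs, -⟩ := TopCat.Sheaf.existsUnique_gluing' U.left.sheaf W V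
    (fun i => homOfLE (hWV i)) (fun x hx => by
      rw [TopologicalSpace.Opens.mem_iSup]; exact ⟨⟨x, hx⟩, hxW _⟩) f hcomp
  refine ⟨s, fun y hy => ?_⟩
  rw [← hf ⟨y, hy⟩ y (hxW _), ← hs ⟨y, hy⟩]
  congr 1
  exact (TopCat.Presheaf.germ_res_apply U.left.presheaf (homOfLE (hWV ⟨y, hy⟩)) y (hxW _) s).symm

end Domain

end

/-! ### Fields algebraic over a subring -/

section

section Algebra

open Polynomial

/-- Algebraicity over a subring in terms of polynomials over the ambient ring, which makes it easy
to enlarge the subring and to map it. -/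
theorem isAlgebraic_subring_iff {K : Type*} [CommRing K] {S : Subring K} {z : K} :
    IsAlgebraic S z ↔ ∃ p : K[X], p ≠ 0 ∧ (∀ n, p.coeff n ∈ S) ∧ p.eval z = 0 := by
  constructor
  · rintro ⟨p, hp, h⟩
    refine ⟨p.map S.subtype, ?_, fun n => ?_, ?_⟩
    · exact (Polynomial.map_ne_zero_iff Subtype.val_injective).2 hp
    · rw [coeff_map]; exact (p.coeff n).2
    · rw [Polynomial.eval_map]; exact h
  · rintro ⟨p, hp, hc, h⟩
    have hp' : p.map (RingHom.id K) = p := Polynomial.map_id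
    refine ⟨p.toSubring S fun a ha => ?_, ?_, ?_⟩
    · obtain ⟨n, -, rfl⟩ := Polynomial.mem_coeffs_iff.1 ha
      exact hc n
    · intro h0; apply hp
      rw [← Polynomial.map_toSubring p S fun a ha => by
        obtain ⟨n, -, rfl⟩ := Polynomial.mem_coeffs_iff.1 ha
        exact hc n, h0, Polynomial.map_zero]
    · rw [aeval_def, ← Polynomial.eval_map]
      exact (congrArg (Polynomial.eval z) (Polynomial.map_toSubring p S _)).trans h

theorem isAlgebraic_subring_mono {K : Type*} [CommRing K] {S T : Subring K} (h : S ≤ T) {z : K}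
    (hz : IsAlgebraic S z) : IsAlgebraic T z := by
  rw [isAlgebraic_subring_iff] at *
  obtain ⟨p, hp, hc, e⟩ := hz
  exact ⟨p, hp, fun n => h (hc n), e⟩

theorem isAlgebraic_map {K L : Type*} [CommRing K] [CommRing L] (f : K →+* L)
    (hf : Function.Injective f) {S : Set K} {z : K} (hz : IsAlgebraic (Subring.closure S) z) :
    IsAlgebraic (Subring.closure (f '' S)) (f z) := by
  obtain ⟨P, hP, hc, e⟩ := isAlgebraic_subring_iff.1 hz
  refine isAlgebraic_subring_iff.2 ⟨P.map f, (Polynomial.map_ne_zero_iff hf).2 hP, fun n => ?_, ?_⟩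
  · rw [Polynomial.coeff_map, ← RingHom.map_closure]
    exact ⟨_, hc n, rfl⟩
  · rw [Polynomial.eval_map, Polynomial.eval₂_hom, e, map_zero]

/-- The elements of the set `T` generate a subring over which `K` is algebraic. No base field is
mentioned: in the applications the constants lie in `T`. -/
def AlgGenerates {K : Type*} [CommRing K] (T : Set K) : Prop :=
  ∀ z : K, IsAlgebraic (Subring.closure T) z

theorem AlgGenerates.mono {K : Type*} [CommRing K] {S T : Set K} (h : S ⊆ T)
    (hS : AlgGenerates S) : AlgGenerates T :=
  fun z => isAlgebraic_subring_mono (Subring.closure_mono h) (hS z)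

variable {K : Type*} [Field K]

theorem isAlgebraic_of_mul_eq {R : Subring K} {z p q : K} (hp : IsAlgebraic R p)
    (hq : IsAlgebraic R q) (hq0 : q ≠ 0) (h : z * q = p) : IsAlgebraic R z := by
  rw [eq_div_of_mul_eq hq0 h, div_eq_mul_inv]
  exact hp.mul hq.inv

theorem AlgGenerates.trans {S T : Set K} (hT : AlgGenerates T)
    (h : ∀ t ∈ T, IsAlgebraic (Subring.closure S) t) : AlgGenerates S := by
  let A := Subalgebra.algebraicClosure (Subring.closure S) K
  have hA : Subring.closure T ≤ A.toSubring := (Subring.closure_le).2 h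
  have : Algebra.IsAlgebraic A K := ⟨fun z => by
    have := isAlgebraic_subring_mono hA (hT z)
    exact this⟩
  have h2 : Algebra.IsAlgebraic (Subring.closure S) K := Algebra.IsAlgebraic.trans _ A K
  exact fun z => h2.isAlgebraic z

theorem algGenerates_of_fractions {S : Set K}
    (h : ∀ z, ∃ p q, p ∈ Subring.closure S ∧ q ∈ Subring.closure S ∧ q ≠ 0 ∧ z * q = p) :
    AlgGenerates S := by
  intro z
  obtain ⟨p, q, hp, hq, h0, e⟩ := h z
  exact isAlgebraic_of_mul_eq (isAlgebraic_algebraMap (⟨p, hp⟩ : Subring.closure S))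
    (isAlgebraic_algebraMap (⟨q, hq⟩ : Subring.closure S)) h0 e

theorem isAlgebraic_closure_of_mem {K : Type*} [CommRing K] [Nontrivial K] {S : Set K} {z : K}
    (h : z ∈ S) : IsAlgebraic (Subring.closure S) z :=
  isAlgebraic_algebraMap (⟨z, Subring.subset_closure h⟩ : Subring.closure S)

/-- An algebraic equation has finitely many coefficients, so it is defined over a member of the
increasing union. -/
theorem isAlgebraic_iUnion {K : Type*} [CommRing K] {T : ℕ → Set K} (hT : Monotone T) {z : K}
    (h : IsAlgebraic (Subring.closure (⋃ m, T m)) z) :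
    ∃ m, IsAlgebraic (Subring.closure (T m)) z := by
  obtain ⟨p, hp, hc, e⟩ := isAlgebraic_subring_iff.1 h
  have hmono : Monotone fun m => Subring.closure (T m) :=
    fun m n hmn => Subring.closure_mono (hT hmn)
  have hc' : ∀ n, ∃ m, p.coeff n ∈ Subring.closure (T m) := fun n => by
    have := hc n
    rw [Subring.closure_iUnion, Subring.mem_iSup_of_directed hmono.directed_le] at this
    exact this
  choose m hm using hc'
  refine ⟨p.support.sup m, isAlgebraic_subring_iff.2 ⟨p, hp, fun n => ?_, e⟩⟩
  by_cases hn : n ∈ p.support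
  · exact hmono (Finset.le_sup hn) (hm n)
  · rw [Polynomial.notMem_support_iff.1 hn]; exact zero_mem _

/-- The field `K` is generated by the set `A` and the image of `c`, in the form that its elements
are fractions of elements of the subring generated by them. -/
def IsFieldGenerated {k K : Type*} [CommRing k] [CommRing K] (c : k →+* K) (A : Set K) : Prop :=
  ∀ z, ∃ p q, p ∈ Subring.closure (Set.range c ∪ A) ∧ q ∈ Subring.closure (Set.range c ∪ A) ∧
    q ≠ 0 ∧ z * q = p

/-- If the image of a local homomorphism `R → K` generates `K` up to algebraic extension and `K` is
finitely generated as a field, then `K` is finite over the residue field of `R`. -/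
theorem quasiFinite_of_algGenerates {k R : Type*} [CommRing k] [CommRing R] [IsLocalRing R]
    (f : R →+* K) [IsLocalHom f] {c : k →+* K} {A : Set K} (hA : A.Finite)
    (hgen : IsFieldGenerated c A) (hc : ∀ a, c a ∈ f.range) {T : Set K}
    (hT : ∀ t ∈ T, t ∈ f.range) (h : AlgGenerates T) : f.QuasiFinite := by
  let g : IsLocalRing.ResidueField R →+* K := IsLocalRing.ResidueField.lift f
  have hg : g.comp (IsLocalRing.residue R) = f := IsLocalRing.ResidueField.lift_comp_residue f
  let _ : Algebra (IsLocalRing.ResidueField R) K := g.toAlgebra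
  have hfg : ∀ t ∈ f.range, t ∈ (algebraMap (IsLocalRing.ResidueField R) K).range := by
    rintro _ ⟨r, rfl⟩
    exact ⟨IsLocalRing.residue R r, congrArg (fun φ => φ r) hg⟩
  have halg : ∀ z : K, IsAlgebraic (IsLocalRing.ResidueField R) z := by
    intro z
    obtain ⟨p, hp, hcf, e⟩ := isAlgebraic_subring_iff.1 (h z)
    have hcf' : ∀ n, p.coeff n ∈ (algebraMap (IsLocalRing.ResidueField R) K).range := fun n =>
      hfg _ ((Subring.closure_le).2 hT (hcf n))
    obtain ⟨q, hq⟩ := (Polynomial.lifts_iff_coeff_lifts p).2 hcf'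
    refine ⟨q, ?_, ?_⟩
    · rintro rfl; simp at hq; exact hp hq.symm
    · rw [aeval_def, ← Polynomial.eval_map]; rw [← e, ← hq]; rfl
  have hfin : Module.Finite (IsLocalRing.ResidueField R) K := by
    have := hA.to_subtype
    have hfd : FiniteDimensional (IsLocalRing.ResidueField R)
        (IntermediateField.adjoin (IsLocalRing.ResidueField R) A) :=
      IntermediateField.finiteDimensional_adjoin fun x _ => (halg x).isIntegral
    have htop : IntermediateField.adjoin (IsLocalRing.ResidueField R) A = ⊤ := by
      rw [eq_top_iff]
      rintro z -
      obtain ⟨p, q, hp, hq, h0, e⟩ := hgen z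
      have hle : Subring.closure (Set.range c ∪ A) ≤
          (IntermediateField.adjoin (IsLocalRing.ResidueField R) A).toSubring := by
        rw [Subring.closure_le]
        rintro x (⟨a, rfl⟩ | hx)
        · obtain ⟨r, hr⟩ := hfg _ (hc a)
          rw [← hr]
          exact IntermediateField.algebraMap_mem _ r
        · exact IntermediateField.subset_adjoin _ _ hx
      rw [eq_div_of_mul_eq h0 e]
      exact div_mem (hle hp) (hle hq)
    rw [htop] at hfd
    exact Module.Finite.equiv IntermediateField.topEquiv.toLinearEquiv
  rw [← hg]
  exact (RingHom.QuasiFinite.of_finite hfin).comp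
    (.of_finite (RingHom.Finite.of_surjective _ IsLocalRing.residue_surjective))

/-- If a local homomorphism `R → K` is quasi-finite, then `K` is algebraic over the image of `R`,
and hence over any subring with the same fractions. -/
theorem algGenerates_of_quasiFinite {R : Type*} [CommRing R] [IsLocalRing R]
    (f : R →+* K) [IsLocalHom f] (h : f.QuasiFinite) {T : Set K}
    (hT : ∀ r, ∃ p q, p ∈ Subring.closure T ∧ q ∈ Subring.closure T ∧ q ≠ 0 ∧ f r * q = p) :
    AlgGenerates T := by
  let g : IsLocalRing.ResidueField R →+* K := IsLocalRing.ResidueField.lift f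
  have hg : g.comp (IsLocalRing.residue R) = f := IsLocalRing.ResidueField.lift_comp_residue f
  rw [← hg] at h
  let _ : Algebra (IsLocalRing.ResidueField R) K := g.toAlgebra
  have hqf : Algebra.QuasiFinite (IsLocalRing.ResidueField R) K := h.of_comp
  have hfin : Module.Finite (IsLocalRing.ResidueField R) K := Module.Finite.of_quasiFinite
  refine AlgGenerates.trans (T := Set.range f) (fun z => ?_) ?_
  · obtain ⟨p, hp, e⟩ := Algebra.IsAlgebraic.isAlgebraic (R := IsLocalRing.ResidueField R) z
    refine isAlgebraic_subring_iff.2 ⟨p.map g,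
      (Polynomial.map_ne_zero_iff g.injective).2 hp, fun n => ?_, ?_⟩
    · obtain ⟨r, hr⟩ := IsLocalRing.residue_surjective (p.coeff n)
      rw [coeff_map, ← hr]
      exact Subring.subset_closure ⟨r, (congrArg (fun φ => φ r) hg).symm⟩
    · rw [Polynomial.eval_map]; exact e
  · rintro _ ⟨r, rfl⟩
    obtain ⟨p, q, hp, hq, h0, e⟩ := hT r
    exact isAlgebraic_of_mul_eq (isAlgebraic_algebraMap (⟨p, hp⟩ : Subring.closure T))
      (isAlgebraic_algebraMap (⟨q, hq⟩ : Subring.closure T)) h0 e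

end Algebra

end

/-! ### Morphisms to `Proj` given by global sections -/

section

section GlobalSections

open HomogeneousLocalization

variable {A : Type u} [CommRing A] {σ : Type u} [SetLike σ A] [AddSubgroupClass σ A]
  (𝒜 : ℕ → σ) [GradedRing 𝒜] {X : Scheme.{u}} (f : A →+* Γ(X, ⊤))

/-- The morphism `D(f r) ⟶ Spec A_(r)` underlying `Proj.toBasicOpenOfGlobalSections`. -/
def basicOpenToSpecAway (r : A) :
    (X.basicOpen (f r)).toScheme ⟶ Spec (.of <| Localization.Away (f r)) :=
  (X.isoOfEq (X.toSpecΓ_preimage_basicOpen (f r))).inv ≫ X.toSpecΓ ∣_ _ ≫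
    (basicOpenIsoSpecAway (f r)).hom

theorem basicOpenToSpecAway_comp (r : A) :
    basicOpenToSpecAway f r ≫ Spec.map (CommRingCat.ofHom (algebraMap Γ(X, ⊤) _)) =
      (X.basicOpen (f r)).ι ≫ X.toSpecΓ := by
  have h := basicOpenIsoSpecAway_hom_SpecMap (R := Γ(X, ⊤)) (f r)
  have h2 := morphismRestrict_ι X.toSpecΓ (PrimeSpectrum.basicOpen (f r))
  have h3 := X.isoOfEq_inv_ι (X.toSpecΓ_preimage_basicOpen (f r))
  calc _ = (X.isoOfEq (X.toSpecΓ_preimage_basicOpen (f r))).inv ≫ X.toSpecΓ ∣_ _ ≫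
        ((basicOpenIsoSpecAway (f r)).hom ≫
          Spec.map (CommRingCat.ofHom (algebraMap Γ(X, ⊤) _))) := by
        simp only [basicOpenToSpecAway, Category.assoc]
    _ = (X.isoOfEq (X.toSpecΓ_preimage_basicOpen (f r))).inv ≫
        (X.toSpecΓ ⁻¹ᵁ (PrimeSpectrum.basicOpen (f r))).ι ≫ X.toSpecΓ :=
      congrArg (fun φ => (X.isoOfEq (X.toSpecΓ_preimage_basicOpen (f r))).inv ≫ φ)
        ((congrArg (fun φ => X.toSpecΓ ∣_ (PrimeSpectrum.basicOpen (f r)) ≫ φ) h).trans h2)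
    _ = _ := by rw [← Category.assoc, h3]

theorem basicOpenToSpecAway_appTop (r : A) (g : Γ(X, ⊤)) :
    (basicOpenToSpecAway f r).appTop ((Scheme.ΓSpecIso _).inv
      (algebraMap Γ(X, ⊤) (Localization.Away (f r)) g)) =
      (X.basicOpen (f r)).ι.appTop g := by
  have h := congrArg (fun φ => Scheme.Hom.appTop φ) (basicOpenToSpecAway_comp f r)
  have h2 := congrArg (fun φ => φ ((Scheme.ΓSpecIso Γ(X, ⊤)).inv g)) h
  simp only [Scheme.Hom.comp_appTop, CommRingCat.comp_apply] at h2
  have h3 := Scheme.ΓSpecIso_inv_naturality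
    (CommRingCat.ofHom (algebraMap Γ(X, ⊤) (Localization.Away (f r))))
  have h4 := congrArg (fun φ => φ g) h3
  simp only [CommRingCat.comp_apply] at h4
  erw [← h4] at h2
  refine h2.trans ?_
  erw [Scheme.toSpecΓ_appTop]
  congr 1
  exact congrArg (fun φ => φ g) (Scheme.ΓSpecIso Γ(X, ⊤)).inv_hom_id

theorem basicOpenToSpec_appTop_apply (r : A) (e : Away 𝒜 r) :
    (Proj.basicOpenToSpec 𝒜 r).appTop ((Scheme.ΓSpecIso _).inv e) =
      (Proj.basicOpen 𝒜 r).topIso.inv (Proj.awayToSection 𝒜 r e) := by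
  have h := congrArg (fun φ => φ ((Scheme.ΓSpecIso (.of (Away 𝒜 r))).inv e))
    (Proj.basicOpenToSpec_app_top 𝒜 r)
  exact h.trans (congrArg (fun z => (Proj.basicOpen 𝒜 r).topIso.inv (Proj.awayToSection 𝒜 r z))
    (congrArg (fun φ => φ e) (Scheme.ΓSpecIso (.of (Away 𝒜 r))).inv_hom_id))

theorem appTop_resLE_apply {X Y : Scheme.{u}} (F : X ⟶ Y) (V : Y.Opens) (W : X.Opens)
    (hV : W ≤ F ⁻¹ᵁ V) (z : Γ(Y, V)) :
    (F.resLE _ _ hV).appTop (V.topIso.inv z) = W.topIso.inv (F.appLE _ _ hV z) := by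
  have h := congrArg (fun φ => φ (V.topIso.inv z)) (F.resLE_app_top hV)
  exact h.trans (congrArg (fun z => W.topIso.inv (F.appLE V W hV z))
    (congrArg (fun φ => φ z) V.topIso.inv_hom_id))

theorem SpecMap_appTop_apply {R S : CommRingCat.{u}} (φ : R ⟶ S) (e : R) :
    (Spec.map φ).appTop ((Scheme.ΓSpecIso R).inv e) = (Scheme.ΓSpecIso S).inv (φ e) :=
  (congrArg (fun φ => φ e) (Scheme.ΓSpecIso_inv_naturality φ)).symm

/-- The homomorphism `A_(r) → Γ(X)_{f r}` induced by `f`. -/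
def awayToLocalization (r : A) : Away 𝒜 r →+* Localization.Away (f r) :=
  (IsLocalization.map (M := .powers r) (T := .powers (f r)) _ f (by
    rw [← Submonoid.map_le_iff_le_comap, Submonoid.map_powers])).comp
      (algebraMap _ (Localization.Away r))

theorem awayToLocalization_mk_mul {r : A} {n : ℕ} (hr : r ∈ 𝒜 n) (m : ℕ)
    {a : A} (ha : a ∈ 𝒜 (m • n)) :
    awayToLocalization 𝒜 f r (Away.mk 𝒜 hr m a ha) *
      (algebraMap Γ(X, ⊤) (Localization.Away (f r)) (f r)) ^ m =
      algebraMap Γ(X, ⊤) (Localization.Away (f r)) (f a) := by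
  rw [awayToLocalization, RingHom.comp_apply, HomogeneousLocalization.algebraMap_apply,
    Away.val_mk, Localization.mk_eq_mk', IsLocalization.map_mk', ← map_pow, mul_comm]
  refine (congrArg (fun z => z * _) ?_).trans (IsLocalization.mk'_spec' _ _ _)
  simp

variable (hf : (HomogeneousIdeal.irrelevant 𝒜).toIdeal.map f = ⊤)

/-- Over `D₊(r)` the morphism to `Proj` is the morphism of affine schemes given by `A_(r) → Γ(X)_{f
r}`. -/
theorem resLE_comp_basicOpenToSpec {r : A} {n : ℕ} (hn : 0 < n) (hr : r ∈ 𝒜 n) :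
    (Proj.fromOfGlobalSections 𝒜 f hf).resLE _ _
      (Proj.fromOfGlobalSections_preimage_basicOpen 𝒜 f hf hn hr).ge ≫ Proj.basicOpenToSpec 𝒜 r =
      basicOpenToSpecAway f r ≫ Spec.map (CommRingCat.ofHom (awayToLocalization 𝒜 f r)) := by
  rw [Proj.fromOfGlobalSections_resLE 𝒜 f hf hn hr, Proj.toBasicOpenOfGlobalSections,
    ← Proj.basicOpenIsoSpec_hom 𝒜 r hr hn]
  simp only [Category.assoc, Iso.inv_hom_id, Category.comp_id]
  rfl

/-- The homomorphism `Γ(X)_g → Γ(D(g))`, for `g = f r`. -/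
def localizationToSection (r : A) : Localization.Away (f r) →+* Γ(X, X.basicOpen (f r)) :=
  (X.basicOpen (f r)).topIso.hom.hom.comp ((basicOpenToSpecAway f r).appTop.hom.comp
    (Scheme.ΓSpecIso (.of (Localization.Away (f r)))).inv.hom)

theorem localizationToSection_algebraMap (r : A) (g : Γ(X, ⊤)) :
    localizationToSection f r (algebraMap Γ(X, ⊤) (Localization.Away (f r)) g) =
      X.presheaf.map (homOfLE le_top).op g := by
  refine (congrArg (X.basicOpen (f r)).topIso.hom (basicOpenToSpecAway_appTop f r g)).trans ?_
  have : (X.basicOpen (f r)).ι.appTop ≫ (X.basicOpen (f r)).topIso.hom =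
      X.presheaf.map (homOfLE le_top).op := by
    rw [Scheme.Hom.appTop, Scheme.Opens.ι_app]
    exact (X.presheaf.map_comp _ _).symm
  exact congrArg (fun φ => φ g) this

/-- Over `D₊(r)` functions are pulled back from `Proj` by way of the localization `Γ(X)_{f r}`. -/
theorem localizationToSection_awayToLocalization {r : A} {n : ℕ} (hn : 0 < n) (hr : r ∈ 𝒜 n)
    (e : Away 𝒜 r) :
    localizationToSection f r (awayToLocalization 𝒜 f r e) =
      (Proj.fromOfGlobalSections 𝒜 f hf).appLE (Proj.basicOpen 𝒜 r) (X.basicOpen (f r))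
      (Proj.fromOfGlobalSections_preimage_basicOpen 𝒜 f hf hn hr).ge
        (Proj.awayToSection 𝒜 r e) := by
  have h1 := congrArg (fun φ => Scheme.Hom.appTop φ ((Scheme.ΓSpecIso (.of (Away 𝒜 r))).inv e))
    (resLE_comp_basicOpenToSpec 𝒜 f hf hn hr)
  have h2 := congrArg (basicOpenToSpecAway f r).appTop
    (SpecMap_appTop_apply (CommRingCat.ofHom (awayToLocalization 𝒜 f r)) e)
  have h3 := appTop_resLE_apply (Proj.fromOfGlobalSections 𝒜 f hf) (Proj.basicOpen 𝒜 r)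
    (X.basicOpen (f r)) (Proj.fromOfGlobalSections_preimage_basicOpen 𝒜 f hf hn hr).ge
    (Proj.awayToSection 𝒜 r e)
  rw [← basicOpenToSpec_appTop_apply] at h3
  have h4 := h3.symm.trans (h1.trans h2)
  have h5 := congrArg (X.basicOpen (f r)).topIso.hom h4
  refine h5.symm.trans ?_
  exact congrArg (fun φ => φ ((Proj.fromOfGlobalSections 𝒜 f hf).appLE (Proj.basicOpen 𝒜 r)
    (X.basicOpen (f r)) (Proj.fromOfGlobalSections_preimage_basicOpen 𝒜 f hf hn hr).ge
      (Proj.awayToSection 𝒜 r e))) (X.basicOpen (f r)).topIso.inv_hom_id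

/-- The pullback of the fraction `a / r ^ m` along the morphism to `Proj` given by `f`. -/
theorem fromOfGlobalSections_appLE_mul {r : A} {n : ℕ} (hn : 0 < n) (hr : r ∈ 𝒜 n) (m : ℕ)
    {a : A} (ha : a ∈ 𝒜 (m • n)) :
    (Proj.fromOfGlobalSections 𝒜 f hf).appLE (Proj.basicOpen 𝒜 r) (X.basicOpen (f r))
      (Proj.fromOfGlobalSections_preimage_basicOpen 𝒜 f hf hn hr).ge
        (Proj.awayToSection 𝒜 r (Away.mk 𝒜 hr m a ha)) *
      (X.presheaf.map (homOfLE le_top).op (f r)) ^ m =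
        X.presheaf.map (homOfLE le_top).op (f a) := by
  have h := congrArg (localizationToSection f r) (awayToLocalization_mk_mul 𝒜 f hr m ha)
  rw [map_mul, map_pow, localizationToSection_algebraMap, localizationToSection_algebraMap,
    localizationToSection_awayToLocalization 𝒜 f hf hn hr] at h
  exact h

end GlobalSections

end

/-! ### Germs of pulled back sections -/

section

section PullGerm

variable {X Y : Scheme.{u}} {T : X.Opens}

/-- The germ at `x`, as an element of the local ring of the ambient scheme `X`, of the pullback of
a section `z` along a morphism defined on an open subscheme. -/
def pullGerm (φ : T.toScheme ⟶ Y) (x : T) {V : Y.Opens} (h : x ∈ φ ⁻¹ᵁ V) :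
    Γ(Y, V) →+* X.presheaf.stalk (x : X) :=
  (T.stalkIso x).hom.hom.comp ((T.toScheme.presheaf.germ (φ ⁻¹ᵁ V) x h).hom.comp (φ.app V).hom)

theorem pullGerm_eq_stalkMap (φ : T.toScheme ⟶ Y) (x : T) {V : Y.Opens} (h : x ∈ φ ⁻¹ᵁ V)
    (z : Γ(Y, V)) :
    pullGerm φ x h z = (T.stalkIso x).hom.hom ((φ.stalkMap x).hom (Y.presheaf.germ V (φ x) h z)) :=
  congrArg (T.stalkIso x).hom.hom (φ.germ_stalkMap_apply V x h z).symm

theorem pullGerm_homOfLE (φ : T.toScheme ⟶ Y) {T' : X.Opens} (e : T' ≤ T) (x : T') {V : Y.Opens}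
    (h : x ∈ (X.homOfLE e ≫ φ) ⁻¹ᵁ V) (h' : (⟨x, e x.2⟩ : T) ∈ φ ⁻¹ᵁ V) (z : Γ(Y, V)) :
    pullGerm (X.homOfLE e ≫ φ) x h z = pullGerm φ ⟨x, e x.2⟩ h' z := by
  have h1 := congrArg (fun ψ => ψ ((X.homOfLE e ≫ φ).app V z))
    (T'.germ_stalkIso_hom x h)
  have h2 := congrArg (fun ψ => ψ (φ.app V z)) (T.germ_stalkIso_hom ⟨x, e x.2⟩ h')
  refine Eq.trans h1 (Eq.trans ?_ h2.symm)
  have h3 : (X.homOfLE e ≫ φ).app V z = (X.homOfLE e).app (φ ⁻¹ᵁ V) (φ.app V z) := by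
    rw [Scheme.Hom.comp_app]; rfl
  rw [h3, X.homOfLE_app]
  exact TopCat.Presheaf.germ_res_apply X.presheaf _ _ _ _

theorem pullGerm_appLE (φ : T.toScheme ⟶ Y) (x : T) {V : Y.Opens} (h : x ∈ φ ⁻¹ᵁ V)
    {W : T.toScheme.Opens} (hW : W ≤ φ ⁻¹ᵁ V) (hx : x ∈ W) (z : Γ(Y, V)) :
    pullGerm φ x h z =
      (T.stalkIso x).hom.hom (T.toScheme.presheaf.germ W x hx (φ.appLE V W hW z)) := by
  refine congrArg (T.stalkIso x).hom.hom ?_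
  rw [Scheme.Hom.appLE]
  exact (TopCat.Presheaf.germ_res_apply T.toScheme.presheaf (homOfLE hW) x hx _).symm

end PullGerm

variable {k : Type u} [Field k] {U : SchemeOver k}

/-- The condition to represent the rational map of a linear system is stable under shrinking the
domain. -/
theorem RepresentsSections.restrict {D : CartierDivisor U} {ι : Type u}
    {s : ι → globalSections D} {φ : U.left.PartialMap (projectiveSpace k ι).left}
    (h : RepresentsSections D s φ) (V : U.left.Opens) (hV : Dense (V : Set U.left))
    (hVφ : V ≤ φ.domain) : RepresentsSections D s (φ.restrict V hV hVφ) where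
  isOver := (Category.assoc _ _ _).trans <|
    (congrArg (fun ψ => U.left.homOfLE hVφ ≫ ψ) h.isOver).trans <|
    (Category.assoc _ _ _).symm.trans <|
    congrArg (fun ψ => ψ ≫ U.hom) (U.left.homOfLE_ι hVφ)
  mem_stdOpen_iff i x := by
    rw [← h.mem_stdOpen_iff i ⟨x.1, hVφ x.2⟩]
    have : U.left.homOfLE hVφ x = ⟨x.1, hVφ x.2⟩ := U.left.homOfLE_apply' hVφ x.1 x.2
    change φ.hom (U.left.homOfLE hVφ x) ∈ stdOpen k i ↔ _
    rw [this]
  pullback_coordQuot i j η hη h' := by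
    have hx : (⟨η, hVφ hη⟩ : φ.domain) ∈ φ.hom ⁻¹ᵁ stdOpen k i := by
      have h₁ : φ.hom (U.left.homOfLE hVφ ⟨η, hη⟩) ∈ stdOpen k i := h'
      rwa [show U.left.homOfLE hVφ ⟨η, hη⟩ = ⟨η, hVφ hη⟩ from
        U.left.homOfLE_apply' hVφ η hη] at h₁
    refine Eq.trans (congrArg (fun z => z * (s i : RatFun U) η) ?_)
      (h.pullback_coordQuot i j η (hVφ hη) hx)
    exact pullGerm_homOfLE φ.hom hVφ ⟨η, hη⟩ h' hx (coordQuot k i j)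

section Construct

variable {X : Scheme.{u}} {T : X.Opens} {ι : Type u}
  (f : MvPolynomial ι k →+* Γ(T.toScheme, ⊤))

/-- The germ at `x` of the section `f P`, as an element of the local ring of the ambient scheme. -/
def evalGerm (x : T) : MvPolynomial ι k →+* X.presheaf.stalk (x : X) :=
  (T.stalkIso x).hom.hom.comp ((T.toScheme.presheaf.germ ⊤ x trivial).hom.comp f)

variable (hf : (HomogeneousIdeal.irrelevant (grading k ι)).toIdeal.map f = ⊤)

theorem pullGerm_fromOfGlobalSections_mul {r : MvPolynomial ι k} {n : ℕ} (hn : 0 < n)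
    (hr : r ∈ grading k ι n) (m : ℕ) {a : MvPolynomial ι k} (ha : a ∈ grading k ι (m • n)) (x : T)
    (hx : x ∈ Proj.fromOfGlobalSections (grading k ι) f hf ⁻¹ᵁ Proj.basicOpen (grading k ι) r) :
    pullGerm (Proj.fromOfGlobalSections (grading k ι) f hf) x hx
      (Proj.awayToSection (grading k ι) r (HomogeneousLocalization.Away.mk _ hr m a ha)) *
      evalGerm f x r ^ m = evalGerm f x a := by
  have hV := (Proj.fromOfGlobalSections_preimage_basicOpen (grading k ι) f hf hn hr).ge
  have hx' : x ∈ T.toScheme.basicOpen (f r) := by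
    rwa [← Proj.fromOfGlobalSections_preimage_basicOpen (grading k ι) f hf hn hr]
  have key (z : Γ(T.toScheme, ⊤)) : T.toScheme.presheaf.germ (T.toScheme.basicOpen (f r)) x hx'
      (T.toScheme.presheaf.map (homOfLE le_top).op z) = T.toScheme.presheaf.germ ⊤ x trivial z :=
    TopCat.Presheaf.germ_res_apply T.toScheme.presheaf _ x hx' z
  have h := congrArg (fun z => (T.stalkIso x).hom.hom
    (T.toScheme.presheaf.germ (T.toScheme.basicOpen (f r)) x hx' z))
    (fromOfGlobalSections_appLE_mul (grading k ι) f hf hn hr m ha)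
  rw [pullGerm_appLE _ x hx hV hx']
  simp only [map_mul, map_pow, key] at h
  exact h

theorem mem_preimage_basicOpen_iff {r : MvPolynomial ι k} {n : ℕ} (hn : 0 < n)
    (hr : r ∈ grading k ι n) (x : T) :
    x ∈ Proj.fromOfGlobalSections (grading k ι) f hf ⁻¹ᵁ Proj.basicOpen (grading k ι) r ↔
      IsUnit (evalGerm f x r) := by
  rw [Proj.fromOfGlobalSections_preimage_basicOpen (grading k ι) f hf hn hr]
  exact (T.toScheme.mem_basicOpen (f r) x trivial).trans
    (MulEquiv.isUnit_map (T.stalkIso x).commRingCatIsoToRingEquiv).symm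

end Construct

end

/-! ### The rational map of an effective divisor -/

section

variable {k : Type u} [Field k] {U : SchemeOver k}

theorem IsEqn.congr {E : CartierDivisor U} {x : U.left} {f g : (RatFun U)ˣ} (hf : IsEqn E x f)
    (h : UnitAt U x ((f⁻¹ * g : (RatFun U)ˣ) : RatFun U)) : IsEqn E x g :=
  Eq.trans hf (principalGerm_eq_iff.2 h)

variable [IsLocallyNoetherian U.left] [∀ x : U.left, IsDomain (U.left.presheaf.stalk x)]

theorem UnitAt.of_regAt_inv {x : U.left} {f : (RatFun U)ˣ} (h : RegAt U x (f : RatFun U))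
    (h' : RegAt U x ((f⁻¹ : (RatFun U)ˣ) : RatFun U)) : UnitAt U x (f : RatFun U) :=
  h.unitAt_of_mul_eq_one h' (by rw [← Units.val_mul, mul_inv_cancel, Units.val_one])
    (toRatFunAt_injective _)

theorem unitAt_generic (η : genericPoints U.left) (f : (RatFun U)ˣ) :
    UnitAt U η (f : RatFun U) :=
  UnitAt.of_regAt_inv (regAt_generic η _) (regAt_generic η _)

/-- The open set of the points at which the Cartier divisor `E` is trivial. -/
def trivialOpen (E : CartierDivisor U) : U.left.Opens where
  carrier := {x | IsEqn E x 1}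
  is_open' := isOpen_iff_forall_mem_open.2 fun x hx => by
    obtain ⟨V, hxV, f, hf⟩ := exists_isEqn E x
    obtain ⟨V', hxV', h⟩ := ((hf x hxV).unitAt hx).eventually
    exact ⟨V ⊓ V', fun y hy => (hf y hy.1).congr (h y hy.2), (V ⊓ V').2, hxV, hxV'⟩

theorem mem_trivialOpen {E : CartierDivisor U} {x : U.left} : x ∈ trivialOpen E ↔ IsEqn E x 1 :=
  Iff.rfl

theorem generic_mem_trivialOpen (E : CartierDivisor U) (η : genericPoints U.left) :
    (η : U.left) ∈ trivialOpen E := by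
  obtain ⟨V, hV, f, hf⟩ := exists_isEqn E (η : U.left)
  exact (hf _ hV).congr (unitAt_generic η _)

/-- Where `E` is trivial, its sections are functions. -/
theorem exists_section_of_mem_globalSections {E : CartierDivisor U} {s : RatFun U}
    (hs : s ∈ globalSections E) : ∃ f : Γ(U.left, trivialOpen E), ∀ y, ∀ hy : y ∈ trivialOpen E,
      toRatFunAt U y (U.left.presheaf.germ (trivialOpen E) y hy f) = ratGerm U y s :=
  exists_section_of_regAt fun x hx => by
    have := regAt_of_mem_globalSections hs (mem_trivialOpen.1 hx)
    rwa [Units.val_one, mul_one] at this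

section System

variable (E : CartierDivisor U) {ι : Type u} (s : ι → globalSections E)

/-- The ring homomorphism from the polynomial ring to the functions on the open set where `E` is
trivial which sends the variable `xⱼ` to the section `sⱼ`. -/
def systemEval : MvPolynomial ι k →+* Γ((trivialOpen E).toScheme, ⊤) :=
  MvPolynomial.eval₂Hom (((trivialOpen E).ι ≫ U.hom).appTop.hom.comp
      (Scheme.ΓSpecIso (CommRingCat.of k)).inv.hom)
    fun j => (trivialOpen E).topIso.inv
      (exists_section_of_mem_globalSections (s j).2).choose

omit [IsLocallyNoetherian U.left] [∀ x : U.left, IsDomain (U.left.presheaf.stalk x)] in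
theorem toRatFunAt_constStalk (x : U.left) (a : k) :
    toRatFunAt U x (constStalk U x a) = ratGerm U x (algebraMap k (RatFun U) a) := by
  funext η
  exact U.left.presheaf.germ_stalkSpecializes_apply (U := ⊤) trivial η.2 _

theorem stalkIso_germ_topIso_inv {X : Scheme.{u}} {T : X.Opens} (x : T) (z : Γ(X, T)) :
    (T.stalkIso x).hom.hom (T.toScheme.presheaf.germ ⊤ x trivial (T.topIso.inv z)) =
      X.presheaf.germ T x x.2 z := by
  refine (congrArg (fun ψ => ψ (T.topIso.inv z)) (T.germ_stalkIso_hom x (V := ⊤) trivial)).trans ?_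
  exact TopCat.Presheaf.germ_res_apply X.presheaf _ x.1 _ z

theorem stalkIso_germ_ι_appTop {X : Scheme.{u}} {T : X.Opens} (x : T) (z : Γ(X, ⊤)) :
    (T.stalkIso x).hom.hom (T.toScheme.presheaf.germ ⊤ x trivial (T.ι.appTop z)) =
      X.presheaf.germ ⊤ x trivial z := by
  refine (congrArg (fun ψ => ψ (T.ι.appTop z)) (T.germ_stalkIso_hom x (V := ⊤) trivial)).trans ?_
  exact TopCat.Presheaf.germ_res_apply X.presheaf _ x.1 _ z

theorem toRatFunAt_evalGerm (x : trivialOpen E) (P : MvPolynomial ι k) :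
    toRatFunAt U x (evalGerm (systemEval E s) x P) =
      ratGerm U x (MvPolynomial.aeval (fun j => (s j : RatFun U)) P) := by
  suffices h : (toRatFunAt U x).comp (evalGerm (systemEval E s) x) =
      (ratGerm U x).comp (MvPolynomial.aeval (R := k) (fun j => (s j : RatFun U))).toRingHom from
    congrArg (fun ψ => ψ P) h
  refine MvPolynomial.ringHom_ext (fun a => ?_) fun j => ?_
  · refine Eq.trans ?_ ((toRatFunAt_constStalk (x : U.left) a).trans ?_)
    · refine congrArg (toRatFunAt U x) ?_
      refine (congrArg (fun z => ((trivialOpen E).stalkIso x).hom.hom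
        ((trivialOpen E).toScheme.presheaf.germ ⊤ x trivial z))
        (MvPolynomial.eval₂Hom_C _ _ a)).trans ?_
      refine Eq.trans ?_ (stalkIso_germ_ι_appTop x _)
      rw [Scheme.Hom.comp_appTop]
      rfl
    · exact congrArg (ratGerm U x) (MvPolynomial.aeval_C _ a).symm
  · refine Eq.trans ?_ (((exists_section_of_mem_globalSections (s j).2).choose_spec x x.2).trans
      (congrArg (ratGerm U x) (MvPolynomial.aeval_X (fun j => (s j : RatFun U)) j).symm))
    refine congrArg (toRatFunAt U x) (Eq.trans ?_ (stalkIso_germ_topIso_inv x _))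
    exact congrArg (fun z => ((trivialOpen E).stalkIso x).hom.hom
        ((trivialOpen E).toScheme.presheaf.germ ⊤ x trivial z)) (MvPolynomial.eval₂Hom_X' _ _ j)

/-- At a generic point the germ of a polynomial in the sections is the value of this polynomial as a
rational function. -/
theorem evalGerm_generic (η : genericPoints U.left) (P : MvPolynomial ι k) :
    evalGerm (systemEval E s) ⟨η, generic_mem_trivialOpen E η⟩ P =
      (MvPolynomial.aeval (R := k) (fun j => (s j : RatFun U)) P : RatFun U) η := by
  have h := (toRatFunAt_eq_iff (specializes_refl (η : U.left))).1
    (toRatFunAt_evalGerm E s ⟨η, generic_mem_trivialOpen E η⟩ P)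
  rwa [TopCat.Presheaf.stalkSpecializes_refl] at h

theorem isUnit_evalGerm_X (i : ι) (x : trivialOpen E) :
    IsUnit (evalGerm (systemEval E s) x (MvPolynomial.X i)) ↔
      GeneratesAt E (s i : RatFun U) x := by
  have h := toRatFunAt_evalGerm E s x (MvPolynomial.X i)
  rw [MvPolynomial.aeval_X] at h
  rw [generatesAt_iff (mem_trivialOpen.1 x.2), Units.val_one, mul_one]
  refine ⟨fun hu => ⟨_, hu, h⟩, fun ⟨g, hg, e⟩ => ?_⟩
  rwa [toRatFunAt_injective _ (h.trans e.symm)]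

end System

section LinearForm

variable {E : CartierDivisor U} {ι : Type u} (b : Module.Basis ι k (globalSections E))

/-- The linear form in the variables `xⱼ` which takes the value `t` at the vectors of a basis. -/
def linearForm (t : globalSections E) : MvPolynomial ι k :=
  (b.repr t).sum fun j c => MvPolynomial.C c * MvPolynomial.X j

omit [IsLocallyNoetherian U.left] [∀ x : U.left, IsDomain (U.left.presheaf.stalk x)] in
theorem linearForm_mem (t : globalSections E) : linearForm b t ∈ grading k ι 1 :=
  sum_mem fun j _ => (zero_add 1 ▸
    (MvPolynomial.isHomogeneous_C ι _).mul (MvPolynomial.isHomogeneous_X k j) :)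

omit [IsLocallyNoetherian U.left] [∀ x : U.left, IsDomain (U.left.presheaf.stalk x)] in
theorem aeval_linearForm (t : globalSections E) :
    MvPolynomial.aeval (fun j => (b j : RatFun U)) (linearForm b t) = (t : RatFun U) := by
  conv_rhs => rw [← b.linearCombination_repr t, Finsupp.linearCombination_apply]
  rw [linearForm, Finsupp.sum, Finsupp.sum, map_sum, AddSubmonoidClass.coe_finsetSum]
  refine Finset.sum_congr rfl fun j _ => ?_
  rw [map_mul, MvPolynomial.aeval_C, MvPolynomial.aeval_X, SetLike.val_smul, Algebra.smul_def]

/-- The linear form of the section `1` is mapped to the function `1`; this is what makes the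
morphism to projective space defined on all of `trivialOpen E`. -/
theorem systemEval_linearForm_one (h1 : (1 : RatFun U) ∈ globalSections E) :
    systemEval E (fun j => b j) (linearForm b ⟨1, h1⟩) = 1 := by
  set T := trivialOpen E
  have hT : T.topIso.hom (systemEval E (fun j => b j) (linearForm b ⟨1, h1⟩)) = 1 := by
    refine section_ext_of_toRatFunAt fun η hη => ?_
    rw [map_one]
    have h := evalGerm_generic E (fun j => b j) η (linearForm b ⟨1, h1⟩)
    rw [aeval_linearForm] at h
    rw [← stalkIso_germ_topIso_inv (⟨η, hη⟩ : T)]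
    refine Eq.trans ?_ h
    refine congrArg (fun z => (T.stalkIso ⟨η, hη⟩).hom.hom
      (T.toScheme.presheaf.germ ⊤ (⟨η, hη⟩ : T) trivial z)) ?_
    exact CategoryTheory.Iso.hom_inv_id_apply _ _
  have := congrArg T.topIso.inv hT
  rwa [map_one, CategoryTheory.Iso.hom_inv_id_apply] at this

theorem map_irrelevant_systemEval (h1 : (1 : RatFun U) ∈ globalSections E) :
    (HomogeneousIdeal.irrelevant (grading k ι)).toIdeal.map (systemEval E fun j => b j) = ⊤ := by
  refine Ideal.eq_top_of_isUnit_mem _ (Ideal.mem_map_of_mem _ ?_)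
    ((systemEval_linearForm_one b h1).symm ▸ isUnit_one)
  refine (HomogeneousIdeal.mem_irrelevant_iff _ _).2 ?_
  exact GradedRing.proj_apply (grading k ι) 0 _ ▸
    DirectSum.decompose_of_mem_ne (grading k ι) (linearForm_mem b _) one_ne_zero

/-- The morphism to projective space defined by a basis of the global sections of an effective
divisor `E` on the open set where `E` is trivial. -/
def systemHom (h1 : (1 : RatFun U) ∈ globalSections E) :
    (trivialOpen E).toScheme ⟶ (projectiveSpace k ι).left :=
  Proj.fromOfGlobalSections (grading k ι) (systemEval E fun j => b j)
    (map_irrelevant_systemEval b h1)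

theorem systemHom_comp (h1 : (1 : RatFun U) ∈ globalSections E) :
    systemHom b h1 ≫ (projectiveSpace k ι).hom = (trivialOpen E).ι ≫ U.hom := by
  refine (Category.assoc _ _ _).symm.trans ?_
  refine (congrArg (fun ψ => ψ ≫ Spec.map (CommRingCat.ofHom (algebraMap k (grading k ι 0))))
    (Proj.fromOfGlobalSections_toSpecZero (grading k ι) _ _)).trans ?_
  rw [Category.assoc, ← Spec.map_comp]
  have : CommRingCat.ofHom (algebraMap k (grading k ι 0)) ≫ CommRingCat.ofHom
      ((systemEval E fun j => b j).comp (algebraMap (grading k ι 0) (MvPolynomial ι k))) =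
      (Scheme.ΓSpecIso (CommRingCat.of k)).inv ≫ ((trivialOpen E).ι ≫ U.hom).appTop := by
    ext a
    exact MvPolynomial.eval₂Hom_C _ _ a
  rw [this, Spec.map_comp, ← Scheme.toSpecΓ_naturality_assoc, ← SpecMap_ΓSpecIso_hom,
    ← Spec.map_comp, Iso.inv_hom_id, Spec.map_id, Category.comp_id]

theorem representsSections_systemHom (h1 : (1 : RatFun U) ∈ globalSections E)
    (hd : Dense (trivialOpen E : Set U.left)) :
    RepresentsSections E (fun j => b j) ⟨trivialOpen E, hd, systemHom b h1⟩ where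
  isOver := systemHom_comp b h1
  mem_stdOpen_iff i x := (mem_preimage_basicOpen_iff (systemEval E fun j => b j)
    (map_irrelevant_systemEval b h1) one_pos (MvPolynomial.isHomogeneous_X k i) x).trans
    (isUnit_evalGerm_X E (fun j => b j) i x)
  pullback_coordQuot i j η h h' := by
    have key := pullGerm_fromOfGlobalSections_mul (systemEval E fun j => b j)
      (map_irrelevant_systemEval b h1) one_pos (MvPolynomial.isHomogeneous_X k i) 1
      (a := MvPolynomial.X j) (by simpa using MvPolynomial.isHomogeneous_X k j) ⟨η, h⟩ h'
    rw [pow_one, evalGerm_generic, evalGerm_generic, MvPolynomial.aeval_X,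
      MvPolynomial.aeval_X] at key
    exact key

end LinearForm

end

/-! ### Generic finiteness of a linear system -/

section

-- The local rings at generic points carry their own ring structure and are only known to satisfy
-- `IsField`. The following lemmas restate results on fields for this situation.
section IsField

variable {K : Type*} [CommRing K] (hK : IsField K)
include hK

theorem quasiFinite_of_algGenerates_of_isField {k R : Type*} [CommRing k] [CommRing R]
    [IsLocalRing R]
    (f : R →+* K) [IsLocalHom f] {c : k →+* K} {A : Set K} (hA : A.Finite)
    (hgen : IsFieldGenerated c A) (hc : ∀ a, c a ∈ f.range) {T : Set K}
    (hT : ∀ t ∈ T, t ∈ f.range) (h : AlgGenerates T) : f.QuasiFinite := by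
  let := hK.toField
  exact quasiFinite_of_algGenerates f hA hgen hc hT h

theorem algGenerates_of_quasiFinite_of_isField {R : Type*} [CommRing R] [IsLocalRing R]
    (f : R →+* K) [IsLocalHom f] (h : f.QuasiFinite) {T : Set K}
    (hT : ∀ r, ∃ p q, p ∈ Subring.closure T ∧ q ∈ Subring.closure T ∧ q ≠ 0 ∧ f r * q = p) :
    AlgGenerates T := by
  let := hK.toField
  exact algGenerates_of_quasiFinite f h hT

theorem AlgGenerates.trans_of_isField {S T : Set K} (hT : AlgGenerates T)
    (h : ∀ t ∈ T, IsAlgebraic (Subring.closure S) t) : AlgGenerates S := by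
  let := hK.toField
  exact AlgGenerates.trans hT h

theorem algGenerates_of_fractions_of_isField {S : Set K}
    (h : ∀ z, ∃ p q, p ∈ Subring.closure S ∧ q ∈ Subring.closure S ∧ q ≠ 0 ∧ z * q = p) :
    AlgGenerates S := by
  let := hK.toField
  exact algGenerates_of_fractions h

end IsField

variable {k : Type u} [Field k] {U : SchemeOver k}
variable [IsLocallyNoetherian U.left] [∀ x : U.left, IsDomain (U.left.presheaf.stalk x)]

/-- The values at the generic point `η` of the global sections of a divisor. -/
def valuesAt (E : CartierDivisor U) (η : genericPoints U.left) :
    Set (U.left.presheaf.stalk (η : U.left)) :=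
  (fun s : RatFun U => s η) '' (globalSections E : Set (RatFun U))

omit [IsLocallyNoetherian U.left] [∀ x : U.left, IsDomain (U.left.presheaf.stalk x)] in
theorem constStalk_mem_valuesAt {E : CartierDivisor U} (h1 : (1 : RatFun U) ∈ globalSections E)
    (η : genericPoints U.left) (a : k) : constStalk U (η : U.left) a ∈ valuesAt E η := by
  refine ⟨algebraMap k (RatFun U) a, ?_, rfl⟩
  have := (globalSections E).smul_mem a h1
  rwa [Algebra.smul_def, mul_one] at this

/-- The local ring at the image of `η` contains the quotients of sections of `E` by the section `1`,
and hence all values at `η` of the sections. -/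
theorem quasiFiniteAt_systemHom {E : CartierDivisor U} {ι : Type u}
    (b : Module.Basis ι k (globalSections E)) (h1 : (1 : RatFun U) ∈ globalSections E)
    (η : genericPoints U.left) {A : Set (U.left.presheaf.stalk (η : U.left))} (hA : A.Finite)
    (hgen : IsFieldGenerated (constStalk U η) A) (h : AlgGenerates (valuesAt E η)) :
    (systemHom b h1).QuasiFiniteAt ⟨η, generic_mem_trivialOpen E η⟩ := by
  set y : trivialOpen E := ⟨η, generic_mem_trivialOpen E η⟩ with hy
  let e := (trivialOpen E).stalkIso y
  let g := e.hom.hom.comp ((systemHom b h1).stalkMap y).hom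
  have : IsLocalHom g :=
    let := isLocalHom_of_isIso e.hom
    let : IsLocalHom ((systemHom b h1).stalkMap y).hom := (systemHom b h1).prop y
    RingHom.isLocalHom_comp e.hom.hom ((systemHom b h1).stalkMap y).hom
  have hg : g.QuasiFinite := by
    have hvals : ∀ t ∈ valuesAt E η, t ∈ g.range := by
      rintro _ ⟨s, hs, rfl⟩
      have hl := evalGerm_generic E (fun j => b j) η (linearForm b ⟨1, h1⟩)
      have hs' := evalGerm_generic E (fun j => b j) η (linearForm b ⟨s, hs⟩)
      rw [aeval_linearForm] at hl hs'
      have hx : y ∈ systemHom b h1 ⁻¹ᵁ Proj.basicOpen (grading k ι) (linearForm b ⟨1, h1⟩) := by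
        refine (mem_preimage_basicOpen_iff (systemEval E fun j => b j)
          (map_irrelevant_systemEval b h1) one_pos (linearForm_mem b ⟨1, h1⟩) y).2 ?_
        rw [hl]; exact isUnit_one
      have key := pullGerm_fromOfGlobalSections_mul (systemEval E fun j => b j)
        (map_irrelevant_systemEval b h1) one_pos (linearForm_mem b ⟨1, h1⟩) 1
        (a := linearForm b ⟨s, hs⟩) (by simpa using linearForm_mem b ⟨s, hs⟩) y hx
      rw [hl, hs', show ((⟨1, h1⟩ : globalSections E) : RatFun U) η = 1 from rfl, one_pow,
        mul_one] at key
      exact ⟨_, (pullGerm_eq_stalkMap (systemHom b h1) y hx _).symm.trans key⟩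
    exact quasiFinite_of_algGenerates_of_isField (isField_stalk_genericPoints η) g hA hgen
      (fun a => hvals _ (constStalk_mem_valuesAt h1 η a)) hvals h
  have : ((systemHom b h1).stalkMap y).hom = e.inv.hom.comp g := by
    ext z; exact (e.hom_inv_id_apply _).symm
  refine (congrArg RingHom.QuasiFinite this).mpr ?_
  exact (RingHom.QuasiFinite.of_finite (RingHom.Finite.of_surjective _
    (ConcreteCategory.bijective_of_isIso e.inv).2)).comp hg

/-- The quasi-finite locus of the morphism given by the sections is open and contains all generic
points, so the restriction to it represents the rational map and is quasi-finite. -/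
theorem isGenericallyFiniteSystem_of_algGenerates [LocallyOfFiniteType U.hom]
    {E : CartierDivisor U} (h1 : (1 : RatFun U) ∈ globalSections E)
    (hgen : ∀ η : genericPoints U.left, ∃ A, A.Finite ∧ IsFieldGenerated (constStalk U η) A)
    (h : ∀ η : genericPoints U.left, AlgGenerates (valuesAt E η)) :
    IsGenericallyFiniteSystem E := by
  let b := Module.Basis.ofVectorSpace k (globalSections E)
  have hdense {V : U.left.Opens} (hV : ∀ η : genericPoints U.left, (η : U.left) ∈ V) :
      Dense (V : Set U.left) := by
    refine Dense.mono (s₁ := genericPoints U.left) (fun x hx => hV ⟨x, hx⟩) ?_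
    exact dense_iff_closure_eq.2 genericPoints.closure
  have : LocallyOfFiniteType (systemHom b h1) := by
    have h' : LocallyOfFiniteType (systemHom b h1 ≫ (projectiveSpace k _).hom) := by
      rw [systemHom_comp]; infer_instance
    exact locallyOfFiniteType_of_comp _ (projectiveSpace k _).hom
  let Q := (systemHom b h1).quasiFiniteLocus
  have hle : (trivialOpen E).ι ''ᵁ Q ≤ trivialOpen E := by
    rintro _ ⟨x, -, rfl⟩; exact x.2
  have hV (η : genericPoints U.left) : (η : U.left) ∈ (trivialOpen E).ι ''ᵁ Q := by
    obtain ⟨A, hA, hA'⟩ := hgen η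
    exact ⟨⟨η, generic_mem_trivialOpen E η⟩, quasiFiniteAt_systemHom b h1 η hA hA' (h η), rfl⟩
  refine ⟨_, b, _, (representsSections_systemHom b h1 (hdense (generic_mem_trivialOpen E))).restrict
    ((trivialOpen E).ι ''ᵁ Q) (hdense hV) hle, ?_⟩
  change LocallyQuasiFinite (U.left.homOfLE hle ≫ systemHom b h1)
  rw [← Scheme.Hom.quasiFiniteLocus_eq_top_iff, Scheme.Hom.quasiFiniteLocus_comp]
  refine top_le_iff.1 fun x _ => ?_
  obtain ⟨x', hx', e⟩ := x.2
  have : U.left.homOfLE hle x = x' := Subtype.ext ((U.left.homOfLE_apply hle x).trans e.symm)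
  exact (this ▸ hx' : U.left.homOfLE hle x ∈ Q)

end

/-! ### Algebraically ample divisors -/

section

variable {k : Type u} [Field k] {U : SchemeOver k}

theorem germ_appLE_eq_constStalk {x : U.left} {W : U.left.Opens} (hx : x ∈ W)
    (a : Γ(Spec (CommRingCat.of k), ⊤)) :
    U.left.presheaf.germ W x hx (U.hom.appLE ⊤ W le_top a) =
      constStalk U x ((Scheme.ΓSpecIso (CommRingCat.of k)).hom a) := by
  have : (Scheme.ΓSpecIso (CommRingCat.of k)).inv
      ((Scheme.ΓSpecIso (CommRingCat.of k)).hom a) = a :=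
    CategoryTheory.Iso.hom_inv_id_apply _ _
  refine Eq.trans ?_
    (congrArg (fun z => U.left.presheaf.germ ⊤ x trivial (U.hom.appTop z)) this.symm)
  exact TopCat.Presheaf.germ_res_apply U.left.presheaf _ x _ _

/-- The function field at a point of a scheme locally of finite type over `k` is finitely generated:
take the coordinates of an affine neighbourhood. -/
theorem exists_finite_isFieldGenerated [∀ x : U.left, IsDomain (U.left.presheaf.stalk x)]
    [LocallyOfFiniteType U.hom] (η : U.left) :
    ∃ A : Set (U.left.presheaf.stalk η), A.Finite ∧ IsFieldGenerated (constStalk U η) A := by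
  obtain ⟨W, hW, hη, -⟩ := exists_isAffineOpen_mem_and_subset (X := U.left) (x := η)
    (U := ⊤) trivial
  have hft := U.hom.finiteType_appLE (isAffineOpen_top (Spec (CommRingCat.of k))) hW le_top
  let := (U.hom.appLE ⊤ W le_top).hom.toAlgebra
  obtain ⟨s, hs⟩ : (⊤ : Subalgebra Γ(Spec (CommRingCat.of k), ⊤) Γ(U.left, W)).FG := hft.1
  refine ⟨U.left.presheaf.germ W η hη '' s, s.finite_toSet.image _, fun z => ?_⟩
  have key (w : Γ(U.left, W)) : U.left.presheaf.germ W η hη w ∈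
      Subring.closure (Set.range (constStalk U η) ∪ U.left.presheaf.germ W η hη '' s) := by
    have hw : w ∈ Algebra.adjoin Γ(Spec (CommRingCat.of k), ⊤) (s : Set Γ(U.left, W)) := by
      rw [hs]; trivial
    induction hw using Algebra.adjoin_induction with
    | mem x hx => exact Subring.subset_closure (Or.inr ⟨x, hx, rfl⟩)
    | algebraMap r =>
      exact Subring.subset_closure (Or.inl ⟨_, (germ_appLE_eq_constStalk hη r).symm⟩)
    | add x y _ _ hx hy => rw [map_add]; exact add_mem hx hy
    | mul x y _ _ hx hy => rw [map_mul]; exact mul_mem hx hy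
  obtain ⟨a, b, hb, h⟩ := exists_germ_mul_eq hW η hη z
  exact ⟨_, _, key a, key b, hb.ne_zero, h⟩

/-- A divisor `D` is algebraically ample if it is effective and birationally ample up to algebraic
extensions: the constant `1` is a section of `𝒪(D)`, and the function field of each irreducible
component is algebraic over the subring generated by the global sections of the multiples of `D`. -/
structure AlgAmple (D : CartierDivisor U) : Prop where
  one_mem : (1 : RatFun U) ∈ globalSections D
  algGenerates : ∀ η : genericPoints U.left, AlgGenerates (⋃ m : ℕ, valuesAt (m • D) η)

theorem valuesAt_nsmul_mono {D : CartierDivisor U} (h : (1 : RatFun U) ∈ globalSections D)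
    (η : genericPoints U.left) : Monotone fun m : ℕ => valuesAt (m • D) η :=
  fun _ _ hmn => Set.image_mono (globalSections_nsmul_mono h hmn)

variable [∀ x : U.left, IsDomain (U.left.presheaf.stalk x)]

/-- Each of the finitely many generators of the function field is algebraic over the values of the
sections of one multiple `N D`, and the spaces of sections increase with the multiple. -/
theorem AlgAmple.eventually_algGenerates [LocallyOfFiniteType U.hom] {D : CartierDivisor U}
    (h : AlgAmple D) (η : genericPoints U.left) :
    ∃ m₀ : ℕ, ∀ m ≥ m₀, AlgGenerates (valuesAt (m • D) η) := by
  obtain ⟨A, hA, hgen⟩ := exists_finite_isFieldGenerated (U := U) (η : U.left)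
  have h' := fun a => isAlgebraic_iUnion (valuesAt_nsmul_mono h.one_mem η) (h.algGenerates η a)
  choose N hN using h'
  obtain ⟨m₀, hm₀⟩ := (hA.image N).bddAbove
  refine ⟨m₀, fun m hm => ?_⟩
  have hK := isField_stalk_genericPoints η
  have : IsDomain (U.left.presheaf.stalk (η : U.left)) := inferInstance
  refine AlgGenerates.trans_of_isField hK
    (algGenerates_of_fractions_of_isField hK hgen) fun t ht => ?_
  rcases ht with ⟨a, rfl⟩ | ht
  · exact isAlgebraic_closure_of_mem
      (constStalk_mem_valuesAt (one_mem_globalSections_nsmul h.one_mem m) η a)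
  · exact isAlgebraic_subring_mono (Subring.closure_mono (valuesAt_nsmul_mono h.one_mem η
      ((hm₀ ⟨t, ht, rfl⟩).trans hm))) (hN t)

/-- As there are finitely many irreducible components, one bound works for all generic points. -/
theorem AlgAmple.isBig [IsLocallyNoetherian U.left] [CompactSpace U.left]
    [LocallyOfFiniteType U.hom] {D : CartierDivisor U} (h : AlgAmple D) : IsBig D := by
  have : IsNoetherian U.left := {}
  have : Finite (genericPoints U.left) :=
    (genericPoints.finite (finite_irreducibleComponents_of_isNoetherian (X := U.left))).to_subtype
  choose N hN using h.eventually_algGenerates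
  obtain ⟨m₀, hm₀⟩ := (Set.finite_range N).bddAbove
  filter_upwards [Filter.eventually_ge_atTop m₀] with m hm
  exact isGenericallyFiniteSystem_of_algGenerates (one_mem_globalSections_nsmul h.one_mem m)
    (fun η => exists_finite_isFieldGenerated (U := U) (η : U.left))
    fun η => hN η m ((hm₀ ⟨η, rfl⟩).trans hm)

end

/-! ### Constants and coordinate quotients on projective space -/

section

section ProjectiveSpace

variable {k : Type u} [Field k] {ι : Type u}

open HomogeneousLocalization

/-- The structure morphism of `Proj` to the spectrum of the elements of degree zero, on functions.
-/
theorem toSpecZero_appTop_res (r : MvPolynomial ι k) {n : ℕ} (hn : 0 < n) (hr : r ∈ grading k ι n)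
    (a : grading k ι 0) :
    (Proj (grading k ι)).presheaf.map (homOfLE (le_top (a := Proj.basicOpen (grading k ι) r))).op
      ((Proj.toSpecZero (grading k ι)).appTop ((Scheme.ΓSpecIso (.of (grading k ι 0))).inv a)) =
      Proj.awayToSection (grading k ι) r (fromZeroRingHom (grading k ι) (.powers r) a) := by
  have h₁ : (Proj.basicOpen (grading k ι) r).ι ≫ Proj.toSpecZero (grading k ι) =
      Proj.basicOpenToSpec (grading k ι) r ≫
        Spec.map (CommRingCat.ofHom (fromZeroRingHom (grading k ι) (.powers r))) := by
    rw [← Proj.awayι_toSpecZero (grading k ι) r hr hn, Proj.awayι, Category.assoc,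
      ← Proj.basicOpenIsoSpec_hom (grading k ι) r hr hn, Iso.hom_inv_id_assoc]
  have h₂ := congrArg (fun ψ => ψ.appTop ((Scheme.ΓSpecIso (.of (grading k ι 0))).inv a)) h₁
  simp only [Scheme.Hom.comp_appTop] at h₂
  have h₃ := congrArg (Proj.basicOpenToSpec (grading k ι) r).appTop
    (SpecMap_appTop_apply (CommRingCat.ofHom (fromZeroRingHom (grading k ι) (.powers r))) a)
  have h₄ := h₂.trans (h₃.trans (basicOpenToSpec_appTop_apply (grading k ι) r _))
  have h₅ := congrArg (Proj.basicOpen (grading k ι) r).topIso.hom h₄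
  refine Eq.trans (Eq.trans ?_ h₅) (CategoryTheory.Iso.inv_hom_id_apply _ _)
  rw [Scheme.Opens.ι_appTop]
  exact congrArg (fun ψ => ψ.hom ((Proj.toSpecZero (grading k ι)).appTop
    ((Scheme.ΓSpecIso (.of (grading k ι 0))).inv a))) (((Proj (grading k ι)).presheaf.map_comp
      (homOfLE le_top).op (eqToHom (Scheme.Opens.opensRange_ι _).symm).op))

theorem X_mem_grading (i : ι) : MvPolynomial.X i ∈ grading k ι 1 :=
  MvPolynomial.isHomogeneous_X k i

variable (k) in
/-- The fraction `xⱼ / xᵢ`, as an element of the homogeneous localization at `xᵢ`. -/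
def coordFrac (i j : ι) : Away (grading k ι) (MvPolynomial.X i) :=
  Away.mk (grading k ι) (X_mem_grading i) 1 (MvPolynomial.X j) (X_mem_grading j)

variable (k) in
/-- The constants in the homogeneous localization at `xᵢ`. -/
def constFrac (i : ι) : k →+* Away (grading k ι) (MvPolynomial.X i) :=
  (fromZeroRingHom (grading k ι) (.powers (MvPolynomial.X i))).comp (algebraMap k (grading k ι 0))

/-- The ring `k[x]_(xᵢ)` is generated by the constants and the fractions `xⱼ / xᵢ`. -/
theorem mk_mem_closure {i : ι} {n : ℕ} {a : MvPolynomial ι k} (ha : a ∈ grading k ι (n • 1)) :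
    Away.mk (grading k ι) (X_mem_grading i) n a ha ∈
      Subring.closure (Set.range (constFrac k i) ∪ Set.range (coordFrac k i)) := by
  let L := Localization.Away (MvPolynomial.X i : MvPolynomial ι k)
  let u : L := Localization.mk 1 ⟨MvPolynomial.X i, Submonoid.mem_powers _⟩
  have hmk (P : MvPolynomial ι k) (m : ℕ) (h : MvPolynomial.X i ^ m ∈
      Submonoid.powers (MvPolynomial.X i : MvPolynomial ι k)) :
      (Localization.mk P ⟨MvPolynomial.X i ^ m, h⟩ : L) = algebraMap _ L P * u ^ m := by
    rw [Localization.mk_pow, ← Localization.mk_one_eq_algebraMap, Localization.mk_mul, one_pow,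
      mul_one, one_mul]
    rfl
  have key : Away.mk (grading k ι) (X_mem_grading i) n a ha =
      ∑ d ∈ a.support, constFrac k i (a.coeff d) * d.prod fun j e => coordFrac k i j ^ e := by
    refine HomogeneousLocalization.val_injective _ ?_
    rw [Away.val_mk, hmk]
    change _ = algebraMap (Away (grading k ι) (MvPolynomial.X i)) L _
    conv_lhs => rw [a.as_sum, map_sum, Finset.sum_mul]
    rw [map_sum]
    refine Finset.sum_congr rfl fun d hd => ?_
    have hdeg : d.sum (fun _ e => e) = n := by
      have := (MvPolynomial.mem_homogeneousSubmodule _ _).1 ha (MvPolynomial.mem_support_iff.1 hd)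
      rwa [Finsupp.weight_apply, smul_eq_mul, mul_one,
        Finsupp.sum_congr (g2 := fun _ e => e) (by simp)] at this
    rw [MvPolynomial.monomial_eq, map_mul, map_mul, mul_assoc, ← hdeg, Finsupp.prod, Finsupp.prod,
      Finsupp.sum, map_prod, map_prod, ← Finset.prod_pow_eq_pow_sum, ← Finset.prod_mul_distrib]
    congr 1
    refine Finset.prod_congr rfl fun j _ => ?_
    rw [map_pow, map_pow, ← mul_pow]
    congr 1
    refine Eq.trans ?_ (Away.val_mk (grading k ι) 1 (X_mem_grading i) (MvPolynomial.X j)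
      (X_mem_grading j)).symm
    rw [hmk, pow_one]
  rw [key]
  refine Subring.sum_mem _ fun d _ => Subring.mul_mem _ (Subring.subset_closure ?_)
    (Subring.prod_mem _ fun j _ => Subring.pow_mem _ (Subring.subset_closure ?_) _)
  · exact Or.inl ⟨_, rfl⟩
  · exact Or.inr ⟨j, rfl⟩

end ProjectiveSpace

section PullGermConst

variable {k : Type u} [Field k] {U : SchemeOver k} {ι : Type u}

theorem pullGerm_res {X Y : Scheme.{u}} {T : X.Opens} (φ : T.toScheme ⟶ Y) (x : T)
    {V W : Y.Opens} (e : W ≤ V) (h : x ∈ φ ⁻¹ᵁ W) (z : Γ(Y, V)) :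
    pullGerm φ x h (Y.presheaf.map (homOfLE e).op z) = pullGerm φ x (e h) z := by
  refine (pullGerm_eq_stalkMap φ x h _).trans
    (Eq.trans ?_ (pullGerm_eq_stalkMap φ x (e h) z).symm)
  exact congrArg (fun z => (T.stalkIso x).hom.hom ((φ.stalkMap x).hom z))
    (TopCat.Presheaf.germ_res_apply Y.presheaf _ _ _ _)

/-- A morphism over `k` pulls constants back to constants. -/
theorem pullGerm_const {T : U.left.Opens} (φ : T.toScheme ⟶ (projectiveSpace k ι).left)
    (hφ : φ ≫ (projectiveSpace k ι).hom = T.ι ≫ U.hom) (x : T) {i : ι}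
    (h : x ∈ φ ⁻¹ᵁ stdOpen k i) (c : k) :
    pullGerm φ x h (Proj.awayToSection (grading k ι) (MvPolynomial.X i)
      (constFrac k i c)) = constStalk U x c := by
  refine (congrArg (pullGerm φ x h) (toSpecZero_appTop_res (MvPolynomial.X i) one_pos
    (X_mem_grading i) (algebraMap k (grading k ι 0) c)).symm).trans ?_
  refine (pullGerm_res φ x le_top h _).trans ?_
  have h₁ := congrArg (fun ψ => ψ.appTop ((Scheme.ΓSpecIso (CommRingCat.of k)).inv c)) hφ
  simp only [Scheme.Hom.comp_appTop] at h₁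
  refine Eq.trans (congrArg (fun z => (T.stalkIso x).hom.hom
    (T.toScheme.presheaf.germ ⊤ x trivial z)) (Eq.trans ?_ h₁)) (stalkIso_germ_ι_appTop x _)
  refine congrArg (fun z => φ.appTop ((Proj.toSpecZero (grading k ι)).appTop z)) ?_
  exact (SpecMap_appTop_apply (CommRingCat.ofHom (algebraMap k (grading k ι 0))) c).symm

end PullGermConst

end

/-! ### Function fields and quasi-finite maps to projective space -/

section

variable {k : Type u} [Field k] {U : SchemeOver k} {ι : Type u}

open HomogeneousLocalization

theorem isAffineOpen_stdOpen (i : ι) : IsAffineOpen (stdOpen k i) :=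
  Proj.isAffineOpen_basicOpen (grading k ι) (MvPolynomial.X i) (X_mem_grading i) one_pos

theorem exists_awayToSection_eq (i : ι) (z : Γ((projectiveSpace k ι).left, stdOpen k i)) :
    ∃ a : Away (grading k ι) (MvPolynomial.X i),
      Proj.awayToSection (grading k ι) (MvPolynomial.X i) a = z :=
  ⟨(Proj.basicOpenIsoAway (grading k ι) (MvPolynomial.X i) (X_mem_grading i) one_pos).inv z,
    CategoryTheory.Iso.inv_hom_id_apply
      (Proj.basicOpenIsoAway (grading k ι) (MvPolynomial.X i) (X_mem_grading i) one_pos) z⟩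

theorem exists_mem_stdOpen (x : (projectiveSpace k ι).left) : ∃ i, x ∈ stdOpen k i := by
  have hadj : Algebra.adjoin (grading k ι 0)
      (Set.range (MvPolynomial.X (R := k) (σ := ι))) = ⊤ := by
    refine top_le_iff.1 fun P _ => ?_
    induction P using MvPolynomial.induction_on with
    | C a => exact Subalgebra.algebraMap_mem _ (⟨MvPolynomial.C a,
        MvPolynomial.isHomogeneous_C ι a⟩ : grading k ι 0)
    | add P Q hP hQ => exact add_mem (hP trivial) (hQ trivial)
    | mul_X P i hP => exact mul_mem (hP trivial) (Algebra.subset_adjoin ⟨i, rfl⟩)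
  have := Proj.iSup_basicOpen_eq_top' (grading k ι) (MvPolynomial.X (R := k) (σ := ι))
    (fun i => ⟨1, X_mem_grading i⟩) hadj
  exact TopologicalSpace.Opens.mem_iSup.1 (this.ge trivial : x ∈ _)

variable {T : U.left.Opens} (φ : T.toScheme ⟶ (projectiveSpace k ι).left)
    (hφ : φ ≫ (projectiveSpace k ι).hom = T.ι ≫ U.hom)
include hφ

/-- Functions on `D₊(xᵢ)` are polynomials in the quotients `xⱼ / xᵢ`, and so are their pullbacks. -/
theorem pullGerm_mem_closure (x : T) {i : ι} (h : x ∈ φ ⁻¹ᵁ stdOpen k i)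
    (z : Γ((projectiveSpace k ι).left, stdOpen k i)) :
    pullGerm φ x h z ∈ Subring.closure (Set.range (constStalk U (x : U.left)) ∪
      Set.range fun j => pullGerm φ x h (coordQuot k i j)) := by
  obtain ⟨a, rfl⟩ := exists_awayToSection_eq i z
  obtain ⟨n, P, hP, rfl⟩ := Away.mk_surjective (grading k ι) (X_mem_grading i) a
  have h₁ := (Subring.mem_map (f := (pullGerm φ x h).comp
    (Proj.awayToSection (grading k ι) (MvPolynomial.X i)).hom)).2 ⟨_, mk_mem_closure hP, rfl⟩
  rw [RingHom.map_closure, Set.image_union, ← Set.range_comp, ← Set.range_comp] at h₁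
  have h₂ : ((pullGerm φ x h).comp (Proj.awayToSection (grading k ι) (MvPolynomial.X i)).hom) ∘
      constFrac k i = constStalk U (x : U.left) := funext fun c => pullGerm_const φ hφ x h c
  rwa [h₂] at h₁

/-- If a map to projective space is quasi-finite at `η`, then the function field is algebraic over
the field generated by the pullbacks of the coordinate quotients. -/
theorem algGenerates_of_quasiFiniteAt [∀ x : U.left, IsDomain (U.left.presheaf.stalk x)]
    (η : genericPoints U.left) (hη : (η : U.left) ∈ T)
    (hq : φ.QuasiFiniteAt ⟨η, hη⟩) {i : ι} (h : (⟨η, hη⟩ : T) ∈ φ ⁻¹ᵁ stdOpen k i) :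
    AlgGenerates (Set.range (constStalk U (η : U.left)) ∪
      Set.range fun j => pullGerm φ ⟨η, hη⟩ h (coordQuot k i j)) := by
  set y : T := ⟨η, hη⟩ with hy
  let e := T.stalkIso y
  let g := e.hom.hom.comp (φ.stalkMap y).hom
  have : IsLocalHom g :=
    let := isLocalHom_of_isIso e.hom
    let : IsLocalHom (φ.stalkMap y).hom := φ.prop y
    RingHom.isLocalHom_comp e.hom.hom (φ.stalkMap y).hom
  have hg : g.QuasiFinite :=
    (RingHom.QuasiFinite.of_finite (RingHom.Finite.of_surjective _
      (ConcreteCategory.bijective_of_isIso e.hom).2)).comp hq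
  refine algGenerates_of_quasiFinite_of_isField (isField_stalk_genericPoints η) g hg fun r => ?_
  obtain ⟨a, b, hb, e⟩ := exists_germ_mul_eq (isAffineOpen_stdOpen i) (φ y) h r
  have hmap (z) : g ((projectiveSpace k ι).left.presheaf.germ (stdOpen k i) (φ y) h z) =
      pullGerm φ y h z := (pullGerm_eq_stalkMap φ y h z).symm
  refine ⟨_, _, pullGerm_mem_closure φ hφ y h a, pullGerm_mem_closure φ hφ y h b, ?_, ?_⟩
  · rw [← hmap]
    have := hb.map g
    have : Nontrivial (U.left.presheaf.stalk (y : U.left)) := inferInstance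
    exact (hb.map g).ne_zero
  · rw [← hmap, ← hmap, ← map_mul, e]

end

/-! ### From big divisors to algebraically ample divisors -/

section

section PullGerm

variable {X Y : Scheme.{u}} {T : X.Opens} (φ : T.toScheme ⟶ Y)

theorem stalkSpecializes_pullGerm {x y : T} (hxy : (x : X) ⤳ (y : X)) {V : Y.Opens}
    (hx : x ∈ φ ⁻¹ᵁ V) (hy : y ∈ φ ⁻¹ᵁ V) (z : Γ(Y, V)) :
    X.presheaf.stalkSpecializes hxy (pullGerm φ y hy z) = pullGerm φ x hx z := by
  have h1 := congrArg (fun ψ => ψ (φ.app V z)) (T.germ_stalkIso_hom x hx)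
  have h2 := congrArg (fun ψ => ψ (φ.app V z)) (T.germ_stalkIso_hom y hy)
  exact (congrArg (X.presheaf.stalkSpecializes hxy) h2).trans <|
    (X.presheaf.germ_stalkSpecializes_apply _ hxy _).trans h1.symm

end PullGerm

variable {k : Type u} [Field k] {U : SchemeOver k} {ι : Type u}

section Cocycle

open HomogeneousLocalization

/-- The cocycle relation `(xᵢ / xⱼ) (xₗ / xᵢ) = xₗ / xⱼ` at a point of `D₊(xᵢ) ∩ D₊(xⱼ)`. -/
theorem germ_coordQuot_mul {p : (projectiveSpace k ι).left} {i j l : ι} (hi : p ∈ stdOpen k i)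
    (hj : p ∈ stdOpen k j) :
    (projectiveSpace k ι).left.presheaf.germ (stdOpen k j) p hj (coordQuot k j i) *
      (projectiveSpace k ι).left.presheaf.germ (stdOpen k i) p hi (coordQuot k i l) =
      (projectiveSpace k ι).left.presheaf.germ (stdOpen k j) p hj (coordQuot k j l) := by
  have key (i j : ι) (hi : p ∈ stdOpen k i) :
      (projectiveSpace k ι).left.presheaf.germ (stdOpen k i) p hi (coordQuot k i j) =
      (Proj.stalkIso' (grading k ι) p).symm (HomogeneousLocalization.mapId (grading k ι)
        (Submonoid.powers_le.mpr hi) (coordFrac k i j)) :=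
    congrArg (fun ψ => ψ (coordFrac k i j))
      (ProjectiveSpectrum.Proj.awayToSection_germ (grading k ι) (MvPolynomial.X i) p hi)
  rw [key j i hj, key i l hi, key j l hj]
  refine (map_mul (Proj.stalkIso' (grading k ι) p).symm _ _).symm.trans ?_
  refine congrArg (Proj.stalkIso' (grading k ι) p).symm
    (HomogeneousLocalization.val_injective _ ?_)
  rw [HomogeneousLocalization.val_mul]
  change Localization.mk (MvPolynomial.X i) ⟨MvPolynomial.X j ^ 1, _⟩ *
    Localization.mk (MvPolynomial.X l) ⟨MvPolynomial.X i ^ 1, _⟩ =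
    Localization.mk (MvPolynomial.X l) ⟨MvPolynomial.X j ^ 1, _⟩
  rw [Localization.mk_mul, Localization.mk_eq_mk_iff, Localization.r_iff_exists]
  refine ⟨1, ?_⟩
  simp only [Submonoid.coe_one, Submonoid.coe_mul]
  ring

theorem germ_coordQuot_self {p : (projectiveSpace k ι).left} {i : ι} (hi : p ∈ stdOpen k i) :
    (projectiveSpace k ι).left.presheaf.germ (stdOpen k i) p hi (coordQuot k i i) = 1 := by
  have h : coordQuot k i i = 1 := by
    have : coordFrac k i i = 1 := by
      refine HomogeneousLocalization.val_injective _ ?_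
      rw [HomogeneousLocalization.val_one, coordFrac, Away.val_mk]
      simp only [pow_one]
      exact Localization.mk_self ⟨MvPolynomial.X i, Submonoid.mem_powers _⟩
    exact (congrArg (Proj.awayToSection (grading k ι) (MvPolynomial.X i)) this).trans (map_one _)
  rw [h, map_one]

end Cocycle

/-- The generic points of the components lie in all dense open sets, as each has a neighbourhood in
which it specializes to all points. -/
theorem mem_of_dense [IsLocallyNoetherian U.left]
    [∀ x : U.left, IsDomain (U.left.presheaf.stalk x)] {V : U.left.Opens}
    (hV : Dense (V : Set U.left)) (η : genericPoints U.left) : (η : U.left) ∈ V := by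
  obtain ⟨W, hη, -, hW, _⟩ := exists_isAffineOpen_isDomain (X := U.left) (V := ⊤) (x := η) trivial
  obtain ⟨w, hw, h⟩ := exists_mem_forall_specializes hW
  obtain ⟨y, hyW, hyV⟩ := hV.inter_open_nonempty _ W.2 ⟨η, hη⟩
  rw [← eq_of_specializes_genericPoints η (h η hη)]
  exact (h y hyW).mem_open V.2 hyV

/-- For a divisor to be algebraically ample, it suffices to look at constants and at some of the
sections of the divisor itself. -/
theorem algAmple_of_algGenerates {D : CartierDivisor U} (h1 : (1 : RatFun U) ∈ globalSections D)
    (s : ι → globalSections D) (h : ∀ η : genericPoints U.left,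
      AlgGenerates (Set.range (constStalk U (η : U.left)) ∪
        Set.range fun j => (s j : RatFun U) η)) : AlgAmple D where
  one_mem := h1
  algGenerates η := by
    refine (h η).mono fun z hz => Set.mem_iUnion.2 ⟨1, ?_⟩
    rw [one_nsmul]
    rcases hz with ⟨a, rfl⟩ | ⟨j, rfl⟩
    · exact constStalk_mem_valuesAt h1 η a
    · exact ⟨s j, (s j).2, rfl⟩

/-- The divisor of an invertible rational function. -/
def principalDivisor (τ : (RatFun U)ˣ) : CartierDivisor U :=
  ofEquations (fun _ => τ) fun _ => ⟨⊤, trivial, fun y _ => by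
    rw [inv_mul_cancel]; exact unitAt_one⟩

theorem isEqn_principalDivisor (τ : (RatFun U)ˣ) (x : U.left) : IsEqn (principalDivisor τ) x τ :=
  isEqn_ofEquations _ _ x

variable [IsLocallyNoetherian U.left] [∀ x : U.left, IsDomain (U.left.presheaf.stalk x)]

/-- If the rational map of `|E|` is generically finite, then the function fields are algebraic over
the quotients of sections of `E`. Dividing by a suitable section `τ`, that is, adding the divisor of
`τ` to `E`, turns these quotients into sections of an effective divisor. -/
theorem IsBig.exists_algAmple {D : CartierDivisor U} (hD : IsBig D) :
    ∃ D' : CartierDivisor U, AlgAmple D' := by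
  obtain ⟨m, hE⟩ := hD.exists
  generalize m • D = E at hE
  obtain ⟨ι, s, φ, hφ, hqf⟩ := hE
  have hdom (η : genericPoints U.left) : (η : U.left) ∈ φ.domain := mem_of_dense φ.dense_domain η
  choose i hi using fun η : genericPoints U.left => exists_mem_stdOpen (φ.hom ⟨η, hdom η⟩)
  have hne (η : genericPoints U.left) : (s (i η) : RatFun U) η ≠ 0 := by
    obtain ⟨V, hV, f, hf⟩ := exists_isEqn E (η : U.left)
    obtain ⟨a, ha, e⟩ := (generatesAt_iff (hf _ hV)).1
      ((hφ.mem_stdOpen_iff (i η) ⟨η, hdom η⟩).1 (hi η))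
    rw [toRatFunAt_eq_iff (specializes_refl _)] at e
    intro h0
    refine (ha.map (U.left.presheaf.stalkSpecializes (specializes_refl (η : U.left))).hom).ne_zero
      (e.trans ?_)
    change (s (i η) : RatFun U) η * (f : RatFun U) η = 0
    rw [h0, zero_mul]
  obtain ⟨τ, hτ⟩ := (isUnit_ratFun_iff (φ := fun η => (s (i η) : RatFun U) η)).2 hne
  have hmem (t : globalSections E) : (t : RatFun U) * ((τ⁻¹ : (RatFun U)ˣ) : RatFun U) ∈
      globalSections (E + principalDivisor τ) := by
    refine mem_globalSections_of_regAt fun x => ?_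
    obtain ⟨V, hV, f, hf⟩ := exists_isEqn E x
    refine ⟨f * τ, (hf x hV).add (isEqn_principalDivisor τ x), ?_⟩
    have e : (t : RatFun U) * ((τ⁻¹ : (RatFun U)ˣ) : RatFun U) *
        ((f * τ : (RatFun U)ˣ) : RatFun U) = t * f := by
      rw [Units.val_mul, mul_assoc, mul_comm (f : RatFun U), Units.inv_mul_cancel_left]
    rw [e]
    exact regAt_of_mem_globalSections t.2 (hf x hV)
  have h1 : (1 : RatFun U) ∈ globalSections (E + principalDivisor τ) := by
    refine mem_globalSections_of_regAt fun x => ?_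
    obtain ⟨V, hV, f, hf⟩ := exists_isEqn E x
    refine ⟨f * τ, (hf x hV).add (isEqn_principalDivisor τ x), ?_⟩
    obtain ⟨η, hη⟩ := exists_genericPoints_specializes x
    refine (regAt_congr hη ?_).1 (regAt_of_mem_globalSections (s (i η)).2 (hf x hV))
    rw [one_mul, Units.val_mul, hτ, mul_comm]
    rfl
  refine ⟨_, algAmple_of_algGenerates h1 (fun j => ⟨_, hmem (s j)⟩) fun η => ?_⟩
  refine (algGenerates_of_quasiFiniteAt φ.hom hφ.isOver η (hdom η)
    (φ.hom.quasiFiniteAt _) (hi η)).mono (Set.union_subset_union_right _ ?_)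
  rintro _ ⟨j, rfl⟩
  refine ⟨j, ?_⟩
  have h₁ := hφ.pullback_coordQuot (i η) j η (hdom η) (hi η)
  have h₂ : (s (i η) : RatFun U) η * ((τ⁻¹ : (RatFun U)ˣ) : RatFun U) η = 1 := by
    have := congrFun (τ.mul_inv) η
    rw [hτ] at this
    exact this
  change (s j : RatFun U) η * ((τ⁻¹ : (RatFun U)ˣ) : RatFun U) η = _
  rw [← h₁, mul_assoc, h₂, mul_one]
  rfl

end

/-! ### Schemes quasi-finite over projective space -/

section

variable {k : Type u} [Field k] {U : SchemeOver k} {ι : Type u}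

section

variable {T : U.left.Opens} (φ : T.toScheme ⟶ (projectiveSpace k ι).left)

theorem pullGerm_coordQuot_mul (x : T) {i j l : ι} (hi : x ∈ φ ⁻¹ᵁ stdOpen k i)
    (hj : x ∈ φ ⁻¹ᵁ stdOpen k j) :
    pullGerm φ x hj (coordQuot k j i) * pullGerm φ x hi (coordQuot k i l) =
      pullGerm φ x hj (coordQuot k j l) := by
  rw [pullGerm_eq_stalkMap, pullGerm_eq_stalkMap, pullGerm_eq_stalkMap,
    ← germ_coordQuot_mul (p := φ x) (l := l) hi hj, map_mul, map_mul]

theorem pullGerm_coordQuot_self (x : T) {i : ι} (hi : x ∈ φ ⁻¹ᵁ stdOpen k i) :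
    pullGerm φ x hi (coordQuot k i i) = 1 := by
  rw [pullGerm_eq_stalkMap]
  refine (congrArg (fun z => (T.stalkIso x).hom.hom ((φ.stalkMap x).hom z))
    (germ_coordQuot_self (p := φ x) hi)).trans ?_
  rw [map_one, map_one]

theorem isUnit_pullGerm_coordQuot (x : T) {i j : ι} (hi : x ∈ φ ⁻¹ᵁ stdOpen k i)
    (hj : x ∈ φ ⁻¹ᵁ stdOpen k j) : IsUnit (pullGerm φ x hj (coordQuot k j i)) :=
  IsUnit.of_mul_eq_one _ ((pullGerm_coordQuot_mul φ x hi hj).trans (pullGerm_coordQuot_self φ x hj))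

end

variable [IsLocallyNoetherian U.left] [∀ x : U.left, IsDomain (U.left.presheaf.stalk x)]

/-- For each generic point `η` choose a coordinate `x_{i(η)}` which does not vanish at `η`. The
divisor of zeros of these coordinates, each on its own component, is a Cartier divisor, and the
quotients `xⱼ / x_{i(η)}` are sections of it. -/
theorem exists_algAmple_of_locallyQuasiFinite (f : U ⟶ projectiveSpace k ι)
    [LocallyQuasiFinite f.left] : ∃ D : CartierDivisor U, AlgAmple D := by
  let T : U.left.Opens := ⊤
  let φ : T.toScheme ⟶ (projectiveSpace k ι).left := T.ι ≫ f.left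
  have hφ : φ ≫ (projectiveSpace k ι).hom = T.ι ≫ U.hom := by
    rw [Category.assoc, Over.w]
  let pt (x : U.left) : T := ⟨x, trivial⟩
  choose i hi' using fun x : U.left => exists_mem_stdOpen (φ (pt x))
  have hi (x : U.left) : pt x ∈ φ ⁻¹ᵁ stdOpen k (i x) := hi' x
  have hgen {x y : U.left} (h : y ⤳ x) {j : ι} (hx : pt x ∈ φ ⁻¹ᵁ stdOpen k j) :
      pt y ∈ φ ⁻¹ᵁ stdOpen k j := by
    have : pt y ⤳ pt x := Topology.IsInducing.subtypeVal.specializes_iff.1 h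
    exact this.mem_open (φ ⁻¹ᵁ stdOpen k j).2 hx
  -- the quotient `x_{i(η)} / x_j` on the components which meet `D₊(x_j)`
  classical
  let Q (j : ι) : RatFun U := fun η =>
    if h : pt η ∈ φ ⁻¹ᵁ stdOpen k j then pullGerm φ (pt η) h (coordQuot k j (i η)) else 1
  have hQ {j : ι} {η : genericPoints U.left} (h : pt η ∈ φ ⁻¹ᵁ stdOpen k j) :
      Q j η = pullGerm φ (pt η) h (coordQuot k j (i η)) := dif_pos h
  have hunit (j : ι) : IsUnit (Q j) := by
    refine isUnit_ratFun_iff.2 fun η => ?_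
    have : Nontrivial (U.left.presheaf.stalk (η : U.left)) := inferInstance
    by_cases h : pt η ∈ φ ⁻¹ᵁ stdOpen k j
    · exact (hQ h).trans_ne (isUnit_pullGerm_coordQuot φ (pt η) (hi η) h).ne_zero
    · exact (dif_neg h).trans_ne one_ne_zero
  -- near `x` the coordinate `x_{i(x)}` generates `𝒪(1)`, so `x_{i(η)} / x_{i(x)}` is an equation
  let F (x : U.left) : (RatFun U)ˣ := (hunit (i x)).unit
  have hF (x : U.left) : ((F x : (RatFun U)ˣ) : RatFun U) = Q (i x) := rfl
  have hreg {ψ : RatFun U} {x : U.left} {η : genericPoints U.left} (hη : (η : U.left) ⤳ x)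
      {j l : ι} (hj : pt x ∈ φ ⁻¹ᵁ stdOpen k j)
      (h : ψ η = pullGerm φ (pt η) (hgen hη hj) (coordQuot k j l)) :
      toRatFunAt U x (pullGerm φ (pt x) hj (coordQuot k j l)) = ratGerm U x ψ :=
    (toRatFunAt_eq_iff hη).2 <|
      (stalkSpecializes_pullGerm φ (x := pt η) (y := pt x) hη _ _ _).trans h.symm
  have hcov (x : U.left) : ∃ V : U.left.Opens, x ∈ V ∧ ∀ y ∈ V,
      UnitAt U y (((F y)⁻¹ * F x : (RatFun U)ˣ) : RatFun U) := by
    refine ⟨T.ι ''ᵁ (φ ⁻¹ᵁ stdOpen k (i x)), ⟨pt x, hi x, rfl⟩, fun y hy => ?_⟩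
    replace hy : pt y ∈ φ ⁻¹ᵁ stdOpen k (i x) := by
      obtain ⟨y', hy', rfl⟩ := hy
      exact hy'
    obtain ⟨η, hη⟩ := exists_genericPoints_specializes y
    refine ⟨_, isUnit_pullGerm_coordQuot φ (pt y) (hi y) hy, hreg hη hy ?_⟩
    have h₁ := pullGerm_coordQuot_mul φ (pt η) (l := i η) (hgen hη (hi y)) (hgen hη hy)
    rw [← hQ, ← hQ] at h₁
    have h₂ : (((F y)⁻¹ : (RatFun U)ˣ) : RatFun U) η * Q (i y) η = 1 :=
      congrFun (F y).inv_mul η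
    change (((F y)⁻¹ : (RatFun U)ˣ) : RatFun U) η * Q (i x) η = _
    rw [← h₁, mul_left_comm, h₂, mul_one]
  have hD := isEqn_ofEquations F hcov
  have h1 : (1 : RatFun U) ∈ globalSections (ofEquations F hcov) := by
    refine mem_globalSections_of_regAt fun x => ⟨F x, hD x, ?_⟩
    obtain ⟨η, hη⟩ := exists_genericPoints_specializes x
    refine ⟨_, hreg (l := i η) hη (hi x) ?_⟩
    rw [one_mul]
    exact hQ (hgen hη (hi x))
  let s (l : ι) : RatFun U := fun η => pullGerm φ (pt η) (hi η) (coordQuot k (i η) l)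
  have hs (l : ι) : s l ∈ globalSections (ofEquations F hcov) := by
    refine mem_globalSections_of_regAt fun x => ⟨F x, hD x, ?_⟩
    obtain ⟨η, hη⟩ := exists_genericPoints_specializes x
    refine ⟨_, hreg (l := l) hη (hi x) ?_⟩
    refine (mul_comm (s l η) (Q (i x) η)).trans ?_
    refine (congrArg (fun z => z * s l η) (hQ (hgen hη (hi x)))).trans ?_
    exact pullGerm_coordQuot_mul φ (pt η) (hi η) (hgen hη (hi x))
  have : LocallyQuasiFinite φ := inferInstance
  exact ⟨_, algAmple_of_algGenerates h1 (fun l => ⟨s l, hs l⟩) fun η =>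
    algGenerates_of_quasiFiniteAt φ hφ η trivial (φ.quasiFiniteAt _) (hi η)⟩

end

/-! ### Projections from products -/

section

section Category

open Limits

variable {C : Type*} [Category* C] {ι : Type*} [DecidableEq ι] {X : ι → C} {P : C}
  {p : ∀ i, P ⟶ X i}

/-- A product is the product of one of its factors with the product of the other factors. -/
def isLimitBinaryFanOthers (h : IsLimit (Fan.mk P p)) (i : ι)
    [HasProduct fun j : {j // j ≠ i} => X j] :
    IsLimit (BinaryFan.mk (p i) (Pi.lift fun j : {j // j ≠ i} => p j)) :=
  have hext {T : C} {f g : T ⟶ P} (hfg : ∀ j, f ≫ p j = g ≫ p j) : f = g :=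
    h.hom_ext fun ⟨j⟩ => hfg j
  let c {T : C} (a : T ⟶ X i) (b : T ⟶ ∏ᶜ fun j : {j // j ≠ i} => X j) (j : ι) : T ⟶ X j :=
    if hj : j = i then a ≫ eqToHom (congrArg X hj.symm)
    else b ≫ Pi.π (fun j : {j // j ≠ i} => X j) ⟨j, hj⟩
  have hc {T : C} (a : T ⟶ X i) (b) (j : ι) : h.lift (Fan.mk _ (c a b)) ≫ p j = c a b j :=
    h.fac _ ⟨j⟩
  BinaryFan.IsLimit.mk _ (fun {T} a b => h.lift (Fan.mk T (c a b)))
    (fun a b => (hc a b i).trans ((dif_pos rfl).trans (Category.comp_id _)))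
    (fun a b => Pi.hom_ext _ _ fun j => by
      refine (Category.assoc _ _ _).trans ((congrArg _ (Pi.lift_π _ j)).trans ((hc a b j).trans ?_))
      exact dif_neg j.2)
    (fun a b m h₁ h₂ => hext fun j => by
      rw [hc]
      by_cases hj : j = i
      · subst hj
        exact h₁.trans ((dif_pos rfl).trans (Category.comp_id _)).symm
      · refine Eq.trans ?_ (dif_neg hj).symm
        rw [← h₂]
        exact ((Category.assoc _ _ _).trans (congrArg (m ≫ ·)
          (Pi.lift_π (fun j : {j // j ≠ i} => p j) ⟨j, hj⟩))).symm)

end Category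

variable {k : Type u} [Field k]

/-- Schemes over a field are flat, hence so are the projections from a product. -/
theorem flat_projection {ι : Type*} [Finite ι] {X : ι → SchemeOver k} {U : SchemeOver k}
    {p : ∀ i, U ⟶ X i} (h : Limits.IsLimit (Limits.Fan.mk U p)) (i : ι) : Flat (p i).left := by
  classical
  have : Limits.HasFiniteProducts (SchemeOver k) :=
    Over.ConstructProducts.over_finiteProducts_of_finiteWidePullbacks
  have hpb := Over.isPullback_of_binaryFan_isLimit _ (isLimitBinaryFanOthers h i)
  have : Flat (∏ᶜ fun j : {j // j ≠ i} => X j).hom := by infer_instance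
  exact MorphismProperty.of_isPullback (P := @Flat) hpb.flip this

/-- Flat morphisms satisfy going down. -/
theorem Flat.map_mem_genericPoints {X Y : Scheme.{u}} (f : X ⟶ Y) [Flat f] (η : genericPoints X) :
    f η ∈ genericPoints Y := by
  obtain ⟨η', h⟩ := exists_genericPoints_specializes (f η)
  obtain ⟨x, hx, e⟩ := Flat.generalizingMap f h
  rw [eq_of_specializes_genericPoints η hx] at e
  rw [e]
  exact η'.2

end

/-! ### Pullback of Cartier divisors -/

section

variable {k : Type u} [Field k] {U X : SchemeOver k} (p : U ⟶ X)
  (hp : ∀ η : genericPoints U.left, p.left η ∈ genericPoints X.left)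

/-- The image of a generic point. -/
def mapGeneric (η : genericPoints U.left) : genericPoints X.left := ⟨p.left η, hp η⟩

/-- The pullback of rational functions along a morphism which maps generic points to generic
points. -/
def pullRatFun : RatFun X →+* RatFun U :=
  RingHom.pi fun η : genericPoints U.left =>
    (p.left.stalkMap η).hom.comp (Pi.evalRingHom
      (fun ξ : genericPoints X.left => X.left.presheaf.stalk (ξ : X.left)) (mapGeneric p hp η))

theorem stalkMap_constStalk (x : U.left) (a : k) :
    p.left.stalkMap x (constStalk X (p.left x) a) = constStalk U x a := by
  refine (p.left.germ_stalkMap_apply ⊤ x trivial _).trans ?_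
  refine congrArg (U.left.presheaf.germ ⊤ x trivial) ?_
  have h := congrArg (fun ψ => ψ.appTop ((Scheme.ΓSpecIso (CommRingCat.of k)).inv a)) (Over.w p)
  simp only [Scheme.Hom.comp_appTop] at h
  exact h

variable {p hp}

theorem ratGerm_pullRatFun {x : U.left} {φ : RatFun X} {a : X.left.presheaf.stalk (p.left x)}
    (h : toRatFunAt X (p.left x) a = ratGerm X (p.left x) φ) :
    toRatFunAt U x (p.left.stalkMap x a) = ratGerm U x (pullRatFun p hp φ) := by
  funext ⟨η, hη⟩
  have hη' : ((mapGeneric p hp η : genericPoints X.left) : X.left) ⤳ p.left x :=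
    hη.map p.left.continuous
  have h₁ := congrFun h ⟨mapGeneric p hp η, hη'⟩
  exact (p.left.stalkSpecializes_stalkMap_apply η x hη a).symm.trans
    (congrArg (p.left.stalkMap η) h₁)

theorem RegAt.pull {x : U.left} {φ : RatFun X} (h : RegAt X (p.left x) φ) :
    RegAt U x (pullRatFun p hp φ) := by
  obtain ⟨a, ha⟩ := h
  exact ⟨_, ratGerm_pullRatFun ha⟩

theorem UnitAt.pull {x : U.left} {φ : RatFun X} (h : UnitAt X (p.left x) φ) :
    UnitAt U x (pullRatFun p hp φ) := by
  obtain ⟨a, ha, e⟩ := h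
  exact ⟨_, ha.map (p.left.stalkMap x).hom, ratGerm_pullRatFun e⟩

/-- The pullback of a Cartier divisor, characterized by its equations. -/
theorem exists_pullDivisor (D : CartierDivisor X) : ∃ D' : CartierDivisor U,
    ∀ (x : U.left) (f : (RatFun X)ˣ), IsEqn D (p.left x) f →
      IsEqn D' x (Units.map (pullRatFun p hp : RatFun X →* RatFun U) f) := by
  choose V hV f hf using exists_isEqn D
  let F (x : U.left) : (RatFun U)ˣ :=
    Units.map (pullRatFun p hp : RatFun X →* RatFun U) (f (p.left x))
  have hunit {x : U.left} {g h : (RatFun X)ˣ} (hg : IsEqn D (p.left x) g)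
      (hh : IsEqn D (p.left x) h) :
      UnitAt U x (((Units.map (pullRatFun p hp : RatFun X →* RatFun U) g)⁻¹ *
        Units.map (pullRatFun p hp : RatFun X →* RatFun U) h : (RatFun U)ˣ) : RatFun U) := by
    rw [← map_inv, ← map_mul]
    exact (hg.unitAt hh).pull
  have hF (x : U.left) : ∃ W : U.left.Opens, x ∈ W ∧ ∀ y ∈ W,
      UnitAt U y (((F y)⁻¹ * F x : (RatFun U)ˣ) : RatFun U) :=
    ⟨p.left ⁻¹ᵁ V (p.left x), hV _, fun y hy => hunit (hf _ _ (hV _)) (hf _ _ hy)⟩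
  exact ⟨ofEquations F hF, fun x g hg => (isEqn_ofEquations F hF x).congr
    (hunit (hf _ _ (hV _)) hg)⟩

theorem pullRatFun_mem_globalSections {D : CartierDivisor X} {D' : CartierDivisor U}
    (h : ∀ (x : U.left) (f : (RatFun X)ˣ), IsEqn D (p.left x) f →
      IsEqn D' x (Units.map (pullRatFun p hp : RatFun X →* RatFun U) f)) {m : ℕ} {s : RatFun X}
    (hs : s ∈ globalSections (m • D)) : pullRatFun p hp s ∈ globalSections (m • D') := by
  refine mem_globalSections_of_regAt fun x => ?_
  obtain ⟨V, hV, f, hf⟩ := exists_isEqn D (p.left x)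
  have hf' := hf _ hV
  refine ⟨_, (h x f hf').nsmul m, ?_⟩
  have := (regAt_of_mem_globalSections hs (hf'.nsmul m)).pull (p := p) (hp := hp)
  rwa [map_mul, ← MonoidHom.coe_coe (pullRatFun p hp), ← Units.coe_map, map_pow] at this

end

/-! ### Function fields of products -/

section

variable {k : Type u} [Field k]

theorem fromSpecStalk_comp_hom (X : SchemeOver k) (x : X.left) :
    X.left.fromSpecStalk x ≫ X.hom = Spec.map (CommRingCat.ofHom (constStalk X x)) := by
  have h : CommRingCat.ofHom (constStalk X x) =
      (Scheme.ΓSpecIso (CommRingCat.of k)).inv ≫ X.hom.appTop ≫ X.left.presheaf.germ ⊤ x trivial :=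
    rfl
  rw [h, Spec.map_comp, Spec.map_comp, ← Scheme.fromSpecStalk_toSpecΓ, Category.assoc,
    Category.assoc, ← Scheme.toSpecΓ_naturality_assoc, ← SpecMap_ΓSpecIso_hom, ← Spec.map_comp,
    Iso.inv_hom_id, Spec.map_id, Category.comp_id]

open Limits in
/-- The function field at a generic point `η` of a product is generated by the images of the local
rings of the factors. Indeed, let `L` be the subfield generated by them. The maps from `Spec L` to
the factors give a map from `Spec L` to the product, through which `Spec 𝒪_η` factors, so that `L`
is all of `𝒪_η`. -/
theorem isFieldGenerated_product {ι : Type*} {X : ι → SchemeOver k} {U : SchemeOver k}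
    {p : ∀ i, U ⟶ X i} (hU : IsLimit (Fan.mk U p)) (η : U.left)
    (hη : IsField (U.left.presheaf.stalk η)) :
    IsFieldGenerated (constStalk U η) (⋃ i, Set.range ((p i).left.stalkMap η)) := by
  let := hη.toField
  set S := Set.range (constStalk U η) ∪ ⋃ i, Set.range ((p i).left.stalkMap η) with hS
  let L := Subfield.closure S
  let incl : CommRingCat.of L ⟶ U.left.presheaf.stalk η := CommRingCat.ofHom L.subtype
  let g (i : ι) : (X i).left.presheaf.stalk ((p i).left η) ⟶ CommRingCat.of L :=
    CommRingCat.ofHom (((p i).left.stalkMap η).hom.codRestrict L fun z =>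
      Subfield.subset_closure (Or.inr (Set.mem_iUnion.2 ⟨i, z, rfl⟩)))
  have hg (i : ι) : g i ≫ incl = (p i).left.stalkMap η := rfl
  let c : CommRingCat.of k ⟶ CommRingCat.of L :=
    CommRingCat.ofHom ((constStalk U η).codRestrict L fun z =>
      Subfield.subset_closure (Or.inl ⟨z, rfl⟩))
  have hc (i : ι) : CommRingCat.ofHom (constStalk (X i) ((p i).left η)) ≫ g i = c := by
    refine CommRingCat.hom_ext (RingHom.ext fun a => ?_)
    exact L.subtype_injective (stalkMap_constStalk (p i) η a :)
  let T : SchemeOver k := Over.mk (Spec.map c)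
  let q (i : ι) : T ⟶ X i := Over.homMk
    (Spec.map (g i) ≫ (X i).left.fromSpecStalk ((p i).left η)) (by
    rw [Category.assoc, fromSpecStalk_comp_hom, ← Spec.map_comp, hc]
    rfl)
  let r : T ⟶ U := hU.lift (Fan.mk T q)
  have hr (i : ι) : r ≫ p i = q i := hU.fac (Fan.mk T q) ⟨i⟩
  let T' : SchemeOver k := Over.mk (Spec.map (CommRingCat.ofHom (constStalk U η)))
  let j : T' ⟶ T := Over.homMk (Spec.map incl) (Spec.map_comp c incl).symm
  let e : T' ⟶ U := Over.homMk (U.left.fromSpecStalk η) (fromSpecStalk_comp_hom U η)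
  have hje : j ≫ r = e := hU.hom_ext fun ⟨i⟩ => by
    refine (Category.assoc _ _ _).trans ((congrArg (j ≫ ·) (hr i)).trans ?_)
    ext1
    change Spec.map incl ≫ Spec.map (g i) ≫ (X i).left.fromSpecStalk ((p i).left η) =
      U.left.fromSpecStalk η ≫ (p i).left
    rw [← Spec.map_comp_assoc, hg, Scheme.SpecMap_stalkMap_fromSpecStalk]
  have hleft : Spec.map incl ≫ r.left = U.left.fromSpecStalk η := congrArg (fun ψ => ψ.left) hje
  have hfac (y : U.left) (hy : r.left (IsLocalRing.closedPoint (CommRingCat.of L)) = y) :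
      ∃ h : U.left.presheaf.stalk y ⟶ CommRingCat.of L,
        Spec.map h ≫ U.left.fromSpecStalk y = r.left := by
    subst hy
    exact ⟨_, Scheme.Spec_stalkClosedPointTo_fromSpecStalk (R := CommRingCat.of L) r.left⟩
  -- `Spec 𝒪_η → Spec L` is surjective, so `Spec L` maps to `η`
  have hpt : r.left (IsLocalRing.closedPoint (CommRingCat.of L)) = η := by
    have h₁ : Spec.map incl (IsLocalRing.closedPoint (U.left.presheaf.stalk η)) =
        IsLocalRing.closedPoint (CommRingCat.of L) := Subsingleton.elim _ _
    have h₂ := congrArg (fun ψ => ψ (IsLocalRing.closedPoint (U.left.presheaf.stalk η))) hleft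
    rw [← h₁]
    exact h₂.trans Scheme.fromSpecStalk_closedPoint
  obtain ⟨h, hh⟩ : ∃ h : U.left.presheaf.stalk η ⟶ CommRingCat.of L,
      Spec.map h ≫ U.left.fromSpecStalk η = r.left :=
    hfac _ hpt
  -- `Spec 𝒪_η → U` is a monomorphism, so `𝒪_η → L → 𝒪_η` is the identity
  have hid : h ≫ incl = 𝟙 _ := by
    refine Spec.map_injective ?_
    rw [← cancel_mono (U.left.fromSpecStalk η), Spec.map_comp, Category.assoc, hh, hleft,
      Spec.map_id, Category.id_comp]
  intro z
  have hz : z ∈ L := by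
    have h₁ : incl (h z) = z := congrArg (fun ψ => ψ.hom z) hid
    rw [← h₁]
    exact (h z).2
  obtain ⟨a, ha, b, hb, rfl⟩ := Subfield.mem_closure_iff.1 hz
  by_cases hb0 : b = 0
  · exact ⟨0, 1, zero_mem _, one_mem _, one_ne_zero, by rw [hb0, div_zero, zero_mul]⟩
  · exact ⟨a, b, ha, hb, hb0, div_mul_cancel₀ a hb0⟩

end

/-! ### Algebraically ample divisors on products -/

section

variable {k : Type u} [Field k]

open Limits in
/-- The sum of the pullbacks of algebraically ample divisors on the factors is algebraically ample.
-/
theorem exists_algAmple_of_product {ι : Type*} [Finite ι] {X : ι → SchemeOver k} {U : SchemeOver k}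
    [IsLocallyNoetherian U.left] [∀ x : U.left, IsDomain (U.left.presheaf.stalk x)]
    [∀ i, ∀ x : (X i).left, IsDomain ((X i).left.presheaf.stalk x)]
    {p : ∀ i, U ⟶ X i} (hU : IsLimit (Fan.mk U p))
    (h : ∀ i, ∃ D : CartierDivisor (X i), AlgAmple D) :
    ∃ D : CartierDivisor U, AlgAmple D := by
  have := Fintype.ofFinite ι
  choose D hD using h
  have hgen (i : ι) (η : genericPoints U.left) : (p i).left η ∈ genericPoints (X i).left :=
    have := flat_projection hU i
    Flat.map_mem_genericPoints (p i).left η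
  choose D' hD' using fun i => exists_pullDivisor (p := p i) (hp := hgen i) (D i)
  have hmem (i : ι) {m : ℕ} {s : RatFun (X i)} (hs : s ∈ globalSections (m • D i)) :
      pullRatFun (p i) (hgen i) s ∈ globalSections (m • D' i) :=
    pullRatFun_mem_globalSections (hD' i) hs
  have hone (i : ι) : (1 : RatFun U) ∈ globalSections (D' i) := by
    have := hmem i (m := 1) (s := 1) (by rw [one_nsmul]; exact (hD i).one_mem)
    rwa [map_one, one_nsmul] at this
  have h1 : (1 : RatFun U) ∈ globalSections (∑ i, D' i) :=
    one_mem_globalSections_sum _ fun i _ => hone i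
  refine ⟨∑ i, D' i, h1, fun η => ?_⟩
  have hη := isField_stalk_genericPoints η
  have hdom : IsDomain (U.left.presheaf.stalk (η : U.left)) := inferInstance
  refine AlgGenerates.trans_of_isField hη
    (algGenerates_of_fractions_of_isField hη (isFieldGenerated_product hU (η : U.left) hη)) ?_
  rintro _ (⟨a, rfl⟩ | ht)
  · exact isAlgebraic_closure_of_mem (Set.mem_iUnion.2
      ⟨0, constStalk_mem_valuesAt (one_mem_globalSections_nsmul h1 0) η a⟩)
  · obtain ⟨i, z, rfl⟩ := Set.mem_iUnion.1 ht
    let ξ := mapGeneric (p i) (hgen i) η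
    have hξ := isField_stalk_genericPoints ξ
    have hinj : Function.Injective ((p i).left.stalkMap η).hom :=
      have : IsSimpleRing ((X i).left.presheaf.stalk ((p i).left η)) :=
        (isSimpleRing_iff_isField _).2 hξ
      RingHom.injective _
    refine isAlgebraic_subring_mono (Subring.closure_mono ?_)
      (isAlgebraic_map ((p i).left.stalkMap η).hom hinj ((hD i).algGenerates ξ z))
    rintro _ ⟨_, hy, rfl⟩
    obtain ⟨m, s, hs, rfl⟩ := Set.mem_iUnion.1 hy
    exact Set.mem_iUnion.2 ⟨m, pullRatFun (p i) (hgen i) s,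
      globalSections_nsmul_le_sum _ (fun i _ => hone i) (Finset.mem_univ i) m (hmem i hs), rfl⟩

end

/-! ### Noetherian normal domains -/

section

open IsLocalRing

section NormalDomain

variable {R : Type*} [CommRing R] [IsDomain R] [IsNoetherianRing R] [IsIntegrallyClosed R]

/-- An element `u / v` of the field of fractions is integral if it maps a nonzero ideal into
itself. -/
theorem dvd_of_forall_mem_exists_mul_eq {Q : Ideal R} (hQ : Q ≠ ⊥) {u v : R} (hv : v ≠ 0)
    (h : ∀ q ∈ Q, ∃ q' ∈ Q, q * u = q' * v) : v ∣ u := by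
  let K := FractionRing R
  have hinj := IsFractionRing.injective R K
  have hv' : algebraMap R K v ≠ 0 := fun h0 => hv (hinj (h0.trans (map_zero _).symm))
  have hint : IsIntegral R (algebraMap R K u / algebraMap R K v) := by
    refine isIntegral_of_smul_mem_submodule (R := R) (A := K) (M := K)
      (Submodule.map (Algebra.linearMap R K) Q) ?_ ?_ _ ?_
    · obtain ⟨q, hq, hq0⟩ := Submodule.exists_mem_ne_zero_of_ne_bot hQ
      intro h0
      have h1 : algebraMap R K q ∈ Submodule.map (Algebra.linearMap R K) Q := ⟨q, hq, rfl⟩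
      rw [h0, Submodule.mem_bot] at h1
      exact hq0 (hinj (h1.trans (map_zero _).symm))
    · exact (IsNoetherian.noetherian Q).map _
    · rintro _ ⟨q, hq, rfl⟩
      obtain ⟨q', hq', e⟩ := h q hq
      refine ⟨q', hq', ?_⟩
      rw [Algebra.linearMap_apply, Algebra.linearMap_apply, smul_eq_mul, div_mul_eq_mul_div,
        eq_div_iff hv', ← map_mul, ← map_mul, ← e, mul_comm]
  obtain ⟨r, hr⟩ := IsIntegrallyClosed.isIntegral_iff.1 hint
  refine ⟨r, hinj ?_⟩
  rw [map_mul, hr, mul_div_cancel₀ _ hv']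

omit [IsNoetherianRing R] [IsIntegrallyClosed R] in
theorem height_eq_one_of_forall_le {p : Ideal R} [hp : p.IsPrime] (hp0 : p ≠ ⊥)
    (h : ∀ q : Ideal R, q.IsPrime → q ≤ p → q = ⊥ ∨ q = p) : p.height = 1 := by
  refine le_antisymm ?_ (Order.one_le_iff_ne_zero.2 fun h0 => hp0 ?_)
  · refine (Ideal.height_le_iff (n := 1)).2 fun q hq hqp => ?_
    rcases h q hq hqp.le with rfl | rfl
    · rw [Ideal.height_bot]; exact zero_lt_one
    · exact absurd hqp (lt_irrefl _)
  · exact Ideal.height_eq_zero_iff_eq_bot.1 h0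

omit [IsIntegrallyClosed R] in
theorem eq_bot_or_eq_of_height_eq_one {p q : Ideal R} [p.IsPrime] [q.IsPrime] (hp : p.height = 1)
    (h : q ≤ p) : q = ⊥ ∨ q = p := by
  by_contra! hc
  have := Ideal.height_strict_mono_of_isPrime (lt_of_le_of_ne h hc.2)
  rw [hp, Order.lt_one_iff] at this
  exact hc.1 (Ideal.height_eq_zero_iff_eq_bot.1 this)

omit [IsNoetherianRing R] [IsDomain R] [IsIntegrallyClosed R] in
theorem mem_colon_bot_mk {b c r : R} :
    r ∈ (⊥ : Submodule R (R ⧸ Ideal.span {b})).colon {Ideal.Quotient.mk (Ideal.span {b}) c} ↔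
      b ∣ r * c := by
  rw [Submodule.mem_colon_singleton, Submodule.mem_bot, ← Ideal.mem_span_singleton,
    ← Ideal.Quotient.eq_zero_iff_mem, map_mul]
  rfl

/-- A Noetherian normal domain is the intersection of its localizations at the primes of height one,
in a form without fractions: a fraction `a / b` which lies in all these localizations lies in the
ring. -/
theorem dvd_of_forall_height_eq_one {a b : R} (hb : b ≠ 0)
    (h : ∀ p : Ideal R, p.IsPrime → p.height = 1 → ∃ s ∉ p, b ∣ s * a) : b ∣ a := by
  by_contra hba
  have hne : (Ideal.Quotient.mk (Ideal.span {b}) a) ≠ 0 := fun h0 =>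
    hba (Ideal.mem_span_singleton.1 (Ideal.Quotient.eq_zero_iff_mem.1 h0))
  obtain ⟨P, hPa, hle⟩ := exists_le_isAssociatedPrime_of_isNoetherianRing R _ hne
  obtain ⟨hP, c, hc⟩ := isAssociatedPrime_iff.1 hPa
  obtain ⟨c, rfl⟩ := Ideal.Quotient.mk_surjective c
  have hmem : ∀ r, r ∈ P ↔ b ∣ r * c := fun r => by rw [hc]; exact mem_colon_bot_mk
  have hbP : b ∈ P := (hmem b).2 (dvd_mul_right b c)
  have hP0 : P ≠ ⊥ := fun h0 => hb (by rwa [h0, Ideal.mem_bot] at hbP)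
  have hbc : ¬ b ∣ c := fun hd => hP.ne_top ((Ideal.eq_top_iff_one _).2
    ((hmem 1).2 (by rwa [one_mul])))
  suffices hht : P.height = 1 by
    obtain ⟨s, hs, hd⟩ := h P hP hht
    exact hs (hle (mem_colon_bot_mk.2 hd))
  -- either `c / b` maps `P` to itself, so that it is integral, or it maps `P` out of `P`
  by_cases hstab : ∀ q ∈ P, ∃ q' ∈ P, q * c = q' * b
  · exact absurd (dvd_of_forall_mem_exists_mul_eq hP0 hb hstab) hbc
  push Not at hstab
  obtain ⟨r, hr, hr'⟩ := hstab
  -- in the second case `r c = b t` with `t ∉ P`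
  obtain ⟨t, ht⟩ := (hmem r).1 hr
  have htP : t ∉ P := fun htP => hr' t htP (by rw [ht, mul_comm])
  have hc0 : c ≠ 0 := fun h0 => hbc (h0 ▸ dvd_zero b)
  refine height_eq_one_of_forall_le hP0 fun Q hQ hQP => ?_
  by_contra! hcon
  -- as `t` is invertible at `P`, the ideal `P` is generated by `r` locally at `P`
  have hPr : ∀ s ∈ P, ∃ w, s * t = w * r := fun s hs => by
    obtain ⟨w, hw⟩ := (hmem s).1 hs
    refine ⟨w, mul_left_cancel₀ hb ?_⟩
    rw [mul_left_comm, ← ht, mul_left_comm, hw]; ring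
  have hrQ : r ∉ Q := fun hrQ => hcon.2 (le_antisymm hQP fun s hs => by
    obtain ⟨w, hw⟩ := hPr s hs
    refine (hQ.mem_or_mem (hw ▸ Q.mul_mem_left w hrQ)).resolve_right fun h => htP (hQP h))
  have hr0 : r ≠ 0 := fun h0 => hrQ (h0 ▸ Q.zero_mem)
  -- now `t / r` maps `P` into the ring and the prime `Q` into itself, so that `r` divides `t`
  obtain ⟨w, hw⟩ := dvd_of_forall_mem_exists_mul_eq hcon.1 (u := t) hr0 fun q hq => by
    obtain ⟨w, hw⟩ := hPr q (hQP hq)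
    exact ⟨w, (hQ.mem_or_mem (hw ▸ Q.mul_mem_right t hq : w * r ∈ Q)).resolve_right hrQ, hw⟩
  exact htP (hw ▸ P.mul_mem_right w hr)

section OrdAt

variable {p : PrimeDivisor R}

/-- The localization of a Noetherian normal domain at a prime of height one is a discrete valuation
ring, as its only nonzero prime is the maximal ideal. -/
instance : IsDiscreteValuationRing (Localization.AtPrime p.1.asIdeal) := by
  have hp0 : p.1.asIdeal ≠ ⊥ := fun h0 => by
    have := p.2
    rw [h0, Ideal.height_bot] at this
    exact zero_ne_one this
  have hle := p.1.asIdeal.primeCompl_le_nonZeroDivisors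
  have : IsDomain (Localization.AtPrime p.1.asIdeal) := IsLocalization.isDomain_localization hle
  have : IsNoetherianRing (Localization.AtPrime p.1.asIdeal) :=
    IsLocalization.isNoetherianRing p.1.asIdeal.primeCompl _ inferInstance
  have hinj := IsLocalization.injective (Localization.AtPrime p.1.asIdeal) hle
  have hmax : maximalIdeal (Localization.AtPrime p.1.asIdeal) ≠ ⊥ := fun h0 => hp0 <| by
    rw [← Localization.AtPrime.under_maximalIdeal (I := p.1.asIdeal), h0]
    exact (RingHom.injective_iff_ker_eq_bot _).1 hinj
  have hiff := (IsDiscreteValuationRing.TFAE (Localization.AtPrime p.1.asIdeal)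
    (isField_iff_maximalIdeal_eq.not.2 hmax)).out 0 3
  refine hiff.2
    ⟨isIntegrallyClosed_of_isLocalization _ p.1.asIdeal.primeCompl hle,
      maximalIdeal _, ⟨hmax, inferInstance⟩, fun Q ⟨hQ0, hQ⟩ => ?_⟩
  have hQle : Q.under R ≤ p.1.asIdeal :=
    (Ideal.comap_mono (le_maximalIdeal hQ.ne_top)).trans_eq
      (Localization.AtPrime.under_maximalIdeal (I := p.1.asIdeal))
  have hmap := IsLocalization.map_under p.1.asIdeal.primeCompl
    (Localization.AtPrime p.1.asIdeal)
  rcases eq_bot_or_eq_of_height_eq_one p.2 hQle with h0 | h1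
  · refine absurd ?_ hQ0
    rw [← hmap Q, h0, Ideal.map_bot]
  · rw [← hmap Q, h1, Localization.AtPrime.map_eq_maximalIdeal]

omit [IsNoetherianRing R] [IsIntegrallyClosed R] in
theorem algebraMap_atPrime_ne_zero {a : R} (ha : a ≠ 0) :
    algebraMap R (Localization.AtPrime p.1.asIdeal) a ≠ 0 := fun h0 =>
  ha (IsLocalization.injective (Localization.AtPrime p.1.asIdeal)
    p.1.asIdeal.primeCompl_le_nonZeroDivisors (h0.trans (map_zero _).symm))

theorem ord_atPrime_ne_top {a : R} (ha : a ≠ 0) : Ring.ord (Localization.AtPrime p.1.asIdeal)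
    (algebraMap R (Localization.AtPrime p.1.asIdeal) a) ≠ ⊤ := by
  rw [Ring.ord_eq_addVal, Ne, IsDiscreteValuationRing.addVal_eq_top_iff]
  exact algebraMap_atPrime_ne_zero ha

/-- For nonzero `a` the length in the definition of `ordAt` is finite and agrees with the valuation
of the discrete valuation ring at `p`. -/
theorem coe_ordAt {a : R} (ha : a ≠ 0) : ∃ n : ℕ, ordAt p a = n ∧
    IsDiscreteValuationRing.addVal _ (algebraMap R (Localization.AtPrime p.1.asIdeal) a) = n :=
  ⟨_, rfl, by rw [ENat.natCast_toNat (ord_atPrime_ne_top ha), Ring.ord_eq_addVal]⟩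

theorem exists_dvd_of_ordAt_le {a b : R} (ha : a ≠ 0) (hb : b ≠ 0) (h : ordAt p b ≤ ordAt p a) :
    ∃ s ∉ p.1.asIdeal, b ∣ s * a := by
  obtain ⟨m, hm, hm'⟩ := coe_ordAt (p := p) ha
  obtain ⟨n, hn, hn'⟩ := coe_ordAt (p := p) hb
  rw [hm, hn, Nat.cast_le] at h
  obtain ⟨z, hz⟩ := IsDiscreteValuationRing.addVal_le_iff_dvd.1
    (hn'.trans_le ((Nat.cast_le.2 h).trans_eq hm'.symm))
  obtain ⟨⟨w, s⟩, hs⟩ := IsLocalization.surj p.1.asIdeal.primeCompl z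
  refine ⟨s, s.2, w, IsLocalization.injective (Localization.AtPrime p.1.asIdeal)
    p.1.asIdeal.primeCompl_le_nonZeroDivisors ?_⟩
  rw [map_mul, map_mul, hz, ← hs]; ring

theorem exists_mul_eq_of_ordAt_eq {a b : R} (ha : a ≠ 0) (hb : b ≠ 0)
    (h : ordAt p a = ordAt p b) :
    ∃ s t : R, s ∉ p.1.asIdeal ∧ t ∉ p.1.asIdeal ∧ s * a = t * b := by
  obtain ⟨m, hm, hm'⟩ := coe_ordAt (p := p) ha
  obtain ⟨n, hn, hn'⟩ := coe_ordAt (p := p) hb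
  rw [hm, hn, Nat.cast_inj] at h
  subst h
  obtain ⟨v, hv⟩ := (IsDiscreteValuationRing.addVal_eq_iff_associated _ _).1 (hm'.trans hn'.symm)
  obtain ⟨⟨w, s⟩, hs⟩ := IsLocalization.surj p.1.asIdeal.primeCompl
    (v : Localization.AtPrime p.1.asIdeal)
  refine ⟨w, s, ?_, s.2, IsLocalization.injective (Localization.AtPrime p.1.asIdeal)
    p.1.asIdeal.primeCompl_le_nonZeroDivisors ?_⟩
  · refine (IsLocalization.AtPrime.isUnit_to_map_iff (Localization.AtPrime p.1.asIdeal)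
      p.1.asIdeal w).1 ?_
    rw [← hs]
    exact v.isUnit.mul (IsLocalization.map_units _ s)
  · rw [map_mul, map_mul, ← hv, ← hs]; ring

theorem ordAt_mul {a b : R} (ha : a ≠ 0) (hb : b ≠ 0) :
    ordAt p (a * b) = ordAt p a + ordAt p b := by
  rw [ordAt, ordAt, ordAt, map_mul, Ring.ord_mul _
    (mem_nonZeroDivisors_of_ne_zero (algebraMap_atPrime_ne_zero hb)),
    ENat.toNat_add (ord_atPrime_ne_top ha) (ord_atPrime_ne_top hb), Nat.cast_add]

omit [IsDomain R] [IsNoetherianRing R] [IsIntegrallyClosed R] in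
theorem ordAt_eq_zero {a : R} (ha : a ∉ p.1.asIdeal) : ordAt p a = 0 := by
  rw [ordAt, Ring.ord_of_isUnit ((IsLocalization.AtPrime.isUnit_to_map_iff
    (Localization.AtPrime p.1.asIdeal) p.1.asIdeal a).2 ha)]
  rfl

theorem ordAt_pow {a : R} (ha : a ≠ 0) (n : ℕ) : ordAt p (a ^ n) = n * ordAt p a := by
  induction n with
  | zero =>
    rw [pow_zero, ordAt_eq_zero fun h => p.1.2.ne_top ((Ideal.eq_top_iff_one _).2 h)]
    simp
  | succ n ih =>
    rw [pow_succ, ordAt_mul (pow_ne_zero n ha) ha, ih]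
    push_cast
    ring

omit [IsIntegrallyClosed R] in
/-- The primes of height one which contain `b` are minimal over `b`. -/
theorem finite_ordAt_ne_zero {b : R} (hb : b ≠ 0) :
    {p : PrimeDivisor R | ordAt p b ≠ 0}.Finite := by
  have hinj : Function.Injective fun p : PrimeDivisor R => p.1.asIdeal := fun p q h =>
    Subtype.ext (PrimeSpectrum.ext h)
  refine ((Ideal.finite_minimalPrimes_of_isNoetherianRing R (Ideal.span {b})).preimage
    hinj.injOn).subset fun p hp => ?_
  have hbp : b ∈ p.1.asIdeal := not_imp_comm.1 ordAt_eq_zero hp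
  refine ⟨⟨p.1.2, (Ideal.span_singleton_le_iff_mem _).2 hbp⟩, fun q ⟨hq, hbq⟩ hqp => ?_⟩
  rcases eq_bot_or_eq_of_height_eq_one p.2 hqp with rfl | rfl
  · exact absurd ((Ideal.span_singleton_le_iff_mem _).1 hbq) hb
  · exact le_rfl

/-- On a `ℚ`-factorial local scheme the polar divisor of the rational function `a / b` has a
positive multiple that is the divisor of a rational function `c / d`. The primes of height one at
which `a / b` is regular and `c / d` is a unit are separated from those at which `b / a` is regular
and `(c / d) (a / b) ^ n` is a unit. -/
theorem exists_multiple_of_polarDivisor (hR : IsQFactorialRing R) {a b : R} (ha : a ≠ 0)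
    (hb : b ≠ 0) : ∃ (n : ℕ) (c d : R), 0 < n ∧ c ≠ 0 ∧ d ≠ 0 ∧
      ∀ p : Ideal R, p.IsPrime → p.height = 1 →
        ((∃ s ∉ p, b ∣ s * a) ∧ ∃ s t, s ∉ p ∧ t ∉ p ∧ s * c = t * d) ∨
        ((∃ s ∉ p, a ∣ s * b) ∧ ∃ s t, s ∉ p ∧ t ∉ p ∧ s * (c * a ^ n) = t * (d * b ^ n)) := by
  obtain ⟨n, hn, c, d, hc, hd, h⟩ := hR (Finsupp.ofSupportFinite
    (fun p => max 0 (ordAt p b - ordAt p a))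
    (((finite_ordAt_ne_zero ha).union (finite_ordAt_ne_zero hb)).subset fun p hp => by
      by_contra! hcon
      rw [Set.mem_union, Set.mem_ofPred, Set.mem_ofPred, not_or, not_not, not_not] at hcon
      exact hp (by simp [hcon.1, hcon.2])))
  refine ⟨n, c, d, hn, hc, hd, fun p hp hht => ?_⟩
  have hv : (n : ℤ) * max 0 (ordAt ⟨⟨p, hp⟩, hht⟩ b - ordAt ⟨⟨p, hp⟩, hht⟩ a) =
    ordAt ⟨⟨p, hp⟩, hht⟩ c - ordAt ⟨⟨p, hp⟩, hht⟩ d := by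
    rw [← h, Finsupp.smul_apply, nsmul_eq_mul]; rfl
  rcases le_total (ordAt ⟨⟨p, hp⟩, hht⟩ b) (ordAt ⟨⟨p, hp⟩, hht⟩ a) with hle | hle
  · rw [max_eq_left (by lia), mul_zero] at hv
    exact Or.inl ⟨exists_dvd_of_ordAt_le ha hb hle,
      exists_mul_eq_of_ordAt_eq (p := ⟨⟨p, hp⟩, hht⟩) hc hd (by lia)⟩
  · rw [max_eq_right (by lia)] at hv
    refine Or.inr ⟨exists_dvd_of_ordAt_le hb ha hle,
      exists_mul_eq_of_ordAt_eq (p := ⟨⟨p, hp⟩, hht⟩) (mul_ne_zero hc (pow_ne_zero n ha))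
        (mul_ne_zero hd (pow_ne_zero n hb)) ?_⟩
    rw [ordAt_mul hc (pow_ne_zero n ha), ordAt_mul hd (pow_ne_zero n hb), ordAt_pow ha,
      ordAt_pow hb]
    linarith

end OrdAt

end NormalDomain

end

/-! ### Points of codimension one -/

section

open IsLocalRing

section Points

variable {X : Scheme.{u}}

/-- The point of `X` specializing to `x` that corresponds to a prime ideal of the local ring. -/
def pointOfPrime (x : X) (p : PrimeSpectrum (X.presheaf.stalk x)) : X := X.fromSpecStalk x p

theorem isEmbedding_pointOfPrime (x : X) : Topology.IsEmbedding (pointOfPrime x) :=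
  (X.fromSpecStalk x).isEmbedding

theorem pointOfPrime_comap_maximalIdeal {x y : X} (h : y ⤳ x) :
    pointOfPrime x (PrimeSpectrum.comap (X.presheaf.stalkSpecializes h).hom
      (closedPoint (X.presheaf.stalk y))) = y :=
  (congrArg (fun f => f (closedPoint (X.presheaf.stalk y)))
    (Scheme.SpecMap_stalkSpecializes_fromSpecStalk h)).trans (Scheme.fromSpecStalk_closedPoint)

theorem isUnit_stalkSpecializes_iff {x y : X} (h : y ⤳ x) {p : PrimeSpectrum (X.presheaf.stalk x)}
    (hp : pointOfPrime x p = y) (s : X.presheaf.stalk x) :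
    IsUnit (X.presheaf.stalkSpecializes h s) ↔ s ∉ p.asIdeal := by
  rw [← (isEmbedding_pointOfPrime x).injective ((pointOfPrime_comap_maximalIdeal h).trans hp.symm),
    PrimeSpectrum.comap_asIdeal, Ideal.mem_comap]
  exact notMem_maximalIdeal.symm

theorem exists_pointOfPrime_eq {x y : X} (h : y ⤳ x) : ∃ p, pointOfPrime x p = y :=
  ⟨_, pointOfPrime_comap_maximalIdeal h⟩

theorem pointOfPrime_specializes {x : X} (p : PrimeSpectrum (X.presheaf.stalk x)) :
    pointOfPrime x p ⤳ x := by
  have : pointOfPrime x p ∈ Set.range (X.fromSpecStalk x) := ⟨p, rfl⟩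
  rwa [Scheme.range_fromSpecStalk] at this

theorem pointOfPrime_specializes_iff {x : X} {p q : PrimeSpectrum (X.presheaf.stalk x)} :
    pointOfPrime x p ⤳ pointOfPrime x q ↔ p ≤ q := by
  rw [(isEmbedding_pointOfPrime x).isInducing.specializes_iff, PrimeSpectrum.le_iff_specializes]

/-- The points of codimension one, i.e. the generic points of the prime divisors. -/
def IsCodimOne (y : X) : Prop :=
  y ∉ genericPoints X ∧ ∀ z, z ⤳ y → z = y ∨ z ∈ genericPoints X

theorem stalkSpecializes_stalkSpecializes {x y z : X} (h : y ⤳ x) (h' : z ⤳ y)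
    (s : X.presheaf.stalk x) : X.presheaf.stalkSpecializes h' (X.presheaf.stalkSpecializes h s) =
      X.presheaf.stalkSpecializes (h'.trans h) s :=
  congrArg (fun f => f s) (X.presheaf.stalkSpecializes_comp h' h)

variable [∀ x : X, IsDomain (X.presheaf.stalk x)]

theorem pointOfPrime_mem_genericPoints_iff {x : X} {p : PrimeSpectrum (X.presheaf.stalk x)} :
    pointOfPrime x p ∈ genericPoints X ↔ p = ⊥ := by
  constructor
  · intro h
    have h1 : pointOfPrime x ⊥ ⤳ pointOfPrime x p := pointOfPrime_specializes_iff.2 bot_le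
    exact (isEmbedding_pointOfPrime x).injective
      (eq_of_specializes_genericPoints ⟨_, h⟩ h1).symm
  · rintro rfl
    obtain ⟨η, hη⟩ := exists_genericPoints_specializes (pointOfPrime x ⊥)
    obtain ⟨q, hq⟩ := exists_pointOfPrime_eq (hη.trans (pointOfPrime_specializes ⊥))
    rw [← hq, pointOfPrime_specializes_iff, le_bot_iff] at hη
    rw [← hη, hq]
    exact η.2

variable [IsLocallyNoetherian X]

/-- The points of codimension one specializing to `x` are the primes of height one of the local ring
at `x`. -/
theorem isCodimOne_pointOfPrime_iff {x : X} {p : PrimeSpectrum (X.presheaf.stalk x)} :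
    IsCodimOne (pointOfPrime x p) ↔ p.asIdeal.height = 1 := by
  rw [IsCodimOne, pointOfPrime_mem_genericPoints_iff]
  constructor
  · rintro ⟨h1, h2⟩
    refine height_eq_one_of_forall_le (fun h0 => h1 (PrimeSpectrum.ext h0)) fun q hq hqp => ?_
    rcases h2 (pointOfPrime x ⟨q, hq⟩) (pointOfPrime_specializes_iff.2 hqp) with h | h
    · exact Or.inr (congrArg PrimeSpectrum.asIdeal ((isEmbedding_pointOfPrime x).injective h))
    · exact Or.inl (congrArg PrimeSpectrum.asIdeal (pointOfPrime_mem_genericPoints_iff.1 h))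
  · intro h
    refine ⟨?_, fun z hz => ?_⟩
    · rintro rfl
      rw [PrimeSpectrum.asIdeal_bot, Ideal.height_bot] at h
      exact zero_ne_one h
    · obtain ⟨q, rfl⟩ := exists_pointOfPrime_eq (hz.trans (pointOfPrime_specializes p))
      rw [pointOfPrime_specializes_iff] at hz
      rw [pointOfPrime_mem_genericPoints_iff]
      rcases eq_bot_or_eq_of_height_eq_one h hz with h0 | h0
      · exact Or.inr (PrimeSpectrum.ext h0)
      · exact Or.inl (congrArg _ (PrimeSpectrum.ext h0))

end Points

section Fractions

variable {k : Type u} [Field k] {U : SchemeOver k}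
variable [IsLocallyNoetherian U.left] [∀ x : U.left, IsDomain (U.left.presheaf.stalk x)]
variable {x y : U.left} {η : genericPoints U.left} {ψ : RatFun U} (hη : (η : U.left) ⤳ y)
  (h : y ⤳ x) {a b : U.left.presheaf.stalk x} (hb : b ≠ 0)
  (hab : ψ η * U.left.presheaf.stalkSpecializes (hη.trans h) b =
    U.left.presheaf.stalkSpecializes (hη.trans h) a)

include hη hb hab

/-- If `ψ = a / b` and `s a = t b` with `s` invertible at `y` and inverse `r`, then `ψ = t r` at
`y`. -/
theorem eq_stalkSpecializes_of_mul_eq {s t : U.left.presheaf.stalk x} (hst : s * a = t * b)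
    {r : U.left.presheaf.stalk y} (hr : U.left.presheaf.stalkSpecializes h s * r = 1) :
    toRatFunAt U y (U.left.presheaf.stalkSpecializes h t * r) = ratGerm U y ψ := by
  rw [toRatFunAt_eq_iff hη]
  set σ := (U.left.presheaf.stalkSpecializes hη).hom with hσ
  set τ := (U.left.presheaf.stalkSpecializes (hη.trans h)).hom with hτ
  have hc (z) : σ (U.left.presheaf.stalkSpecializes h z) = τ z :=
    stalkSpecializes_stalkSpecializes h hη z
  have hb0 : τ b ≠ 0 := fun h0 => hb (stalkSpecializes_injective _ (h0.trans (map_zero τ).symm))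
  have hr' := congrArg σ hr
  rw [map_mul, hc, map_one] at hr'
  have hst' := congrArg τ hst
  rw [map_mul, map_mul] at hst'
  change ψ η * τ b = τ a at hab
  change σ _ = _
  rw [map_mul, hc]
  refine mul_right_cancel₀ hb0 ?_
  linear_combination (- σ r) * hst' - (τ s * σ r) * hab + (ψ η * τ b) * hr'

theorem regAt_of_dvd {s : U.left.presheaf.stalk x}
    (hs : IsUnit (U.left.presheaf.stalkSpecializes h s)) (hd : b ∣ s * a) : RegAt U y ψ := by
  obtain ⟨t, ht⟩ := hd
  obtain ⟨r, hr⟩ := hs.exists_right_inv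
  exact ⟨_, eq_stalkSpecializes_of_mul_eq hη h hb hab (ht.trans (mul_comm _ _)) hr⟩

theorem unitAt_of_mul_eq {s t : U.left.presheaf.stalk x}
    (hs : IsUnit (U.left.presheaf.stalkSpecializes h s))
    (ht : IsUnit (U.left.presheaf.stalkSpecializes h t)) (hst : s * a = t * b) :
    UnitAt U y ψ := by
  obtain ⟨r, hr⟩ := hs.exists_right_inv
  exact ⟨_, ht.mul (IsUnit.of_mul_eq_one _ ((mul_comm _ _).trans hr)),
    eq_stalkSpecializes_of_mul_eq hη h hb hab hst hr⟩

omit hb in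
theorem RegAt.exists_dvd (hreg : RegAt U y ψ) :
    ∃ s, IsUnit (U.left.presheaf.stalkSpecializes h s) ∧ b ∣ s * a := by
  obtain ⟨z, hz⟩ := hreg
  rw [toRatFunAt_eq_iff hη] at hz
  obtain ⟨w, s, hs, hw⟩ := exists_mul_stalkSpecializes_eq_of_specializes h z
  refine ⟨s, hs, w, stalkSpecializes_injective (hη.trans h) ?_⟩
  set σ := (U.left.presheaf.stalkSpecializes hη).hom with hσ
  set τ := (U.left.presheaf.stalkSpecializes (hη.trans h)).hom with hτ
  have hc (z) : σ (U.left.presheaf.stalkSpecializes h z) = τ z :=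
    stalkSpecializes_stalkSpecializes h hη z
  have hw' := congrArg σ hw
  rw [map_mul, hc, hc] at hw'
  change σ z = ψ η at hz
  change ψ η * τ b = τ a at hab
  change τ _ = τ _
  rw [map_mul, map_mul]
  linear_combination (-τ s) * hab + (τ b * τ s) * (-hz) + τ b * hw'

end Fractions

end

/-! ### Locally `ℚ`-factorial schemes -/

section

section CodimOne

variable {k : Type u} [Field k] {U : SchemeOver k}
variable [IsLocallyNoetherian U.left] [∀ x : U.left, IsDomain (U.left.presheaf.stalk x)]

theorem specializes_genericPoints_of_specializes {x y : U.left} {η : genericPoints U.left}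
    (hη : (η : U.left) ⤳ x) (h : y ⤳ x) : (η : U.left) ⤳ y := by
  obtain ⟨η', hη'⟩ := exists_genericPoints_specializes y
  rwa [genericPoints_unique hη (hη'.trans h)]

/-- A rational function on a normal scheme which is regular in codimension one is regular. -/
theorem regAt_of_forall_isCodimOne {x : U.left} [IsIntegrallyClosed (U.left.presheaf.stalk x)]
    {ψ : RatFun U} (h : ∀ y, IsCodimOne y → y ⤳ x → RegAt U y ψ) : RegAt U x ψ := by
  obtain ⟨η, hη⟩ := exists_genericPoints_specializes x
  obtain ⟨a, b, hb, hab⟩ := exists_mul_stalkSpecializes_eq hη (ψ η)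
  obtain ⟨c, rfl⟩ := dvd_of_forall_height_eq_one (a := a) hb fun p hp hht => by
    have hyx := pointOfPrime_specializes ⟨p, hp⟩
    obtain ⟨s, hs, hd⟩ := RegAt.exists_dvd (specializes_genericPoints_of_specializes hη hyx) hyx hab
      (h _ (isCodimOne_pointOfPrime_iff.2 hht) hyx)
    exact ⟨s, (isUnit_stalkSpecializes_iff hyx rfl s).1 hs, hd⟩
  refine regAt_of_dvd hη (specializes_refl x) hb hab (s := 1) ?_ ⟨c, one_mul _⟩
  rw [show U.left.presheaf.stalkSpecializes (specializes_refl x) 1 = 1 from map_one _]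
  exact isUnit_one

theorem unitAt_of_forall_isCodimOne {x : U.left} [IsIntegrallyClosed (U.left.presheaf.stalk x)]
    {f : (RatFun U)ˣ} (h : ∀ y, IsCodimOne y → y ⤳ x → UnitAt U y (f : RatFun U)) :
    UnitAt U x (f : RatFun U) :=
  UnitAt.of_regAt_inv (regAt_of_forall_isCodimOne fun y hy hyx => (h y hy hyx).regAt)
    (regAt_of_forall_isCodimOne fun y hy hyx => (h y hy hyx).inv.regAt)

end CodimOne

section Polar

variable {k : Type u} [Field k] {U : SchemeOver k}

/-- At `y` the function `f` is an equation of `N` times the polar divisor of `φ`, in the case that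
`φ` or `φ⁻¹` is regular at `y`. -/
def IsPolarEqnAt (φ : (RatFun U)ˣ) (N : ℕ) (f : (RatFun U)ˣ) (y : U.left) : Prop :=
  (RegAt U y (φ : RatFun U) ∧ UnitAt U y (f : RatFun U)) ∨
  (RegAt U y ((φ⁻¹ : (RatFun U)ˣ) : RatFun U) ∧ UnitAt U y ((f * φ ^ N : (RatFun U)ˣ) : RatFun U))

/-- The function `f` is an equation of `N` times the polar divisor of `φ` at all points of
codimension one specializing to `x`. -/
def IsPolarEqn (φ : (RatFun U)ˣ) (N : ℕ) (f : (RatFun U)ˣ) (x : U.left) : Prop :=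
  ∀ y, IsCodimOne y → y ⤳ x → IsPolarEqnAt φ N f y

variable {φ f g : (RatFun U)ˣ} {N : ℕ} {x y : U.left}

theorem IsPolarEqnAt.pow (h : IsPolarEqnAt φ N f y) (M : ℕ) :
    IsPolarEqnAt φ (N * M) (f ^ M) y := by
  refine h.imp (fun h => ⟨h.1, ?_⟩) fun h => ⟨h.1, ?_⟩
  · rw [Units.val_pow_eq_pow_val]; exact h.2.pow M
  · rw [pow_mul, ← mul_pow, Units.val_pow_eq_pow_val]; exact h.2.pow M

/-- Equations of multiples of the polar divisor can be replaced by powers, to pass to a common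
multiple. -/
theorem IsPolarEqn.pow (h : IsPolarEqn φ N f x) (M : ℕ) : IsPolarEqn φ (N * M) (f ^ M) x :=
  fun y hy hyx => (h y hy hyx).pow M

/-- The polar divisor is effective. -/
theorem IsPolarEqnAt.regAt (h : IsPolarEqnAt φ N f y) : RegAt U y (f : RatFun U) := by
  rcases h with h | h
  · exact h.2.regAt
  · have := h.2.regAt.mul (h.1.pow N)
    rwa [← Units.val_pow_eq_pow_val, ← Units.val_mul, mul_assoc, ← mul_pow, mul_inv_cancel,
      one_pow, mul_one] at this

/-- The function `φ` is a section of positive multiples of its polar divisor. -/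
theorem IsPolarEqnAt.regAt_mul (h : IsPolarEqnAt φ N f y) (hN : 0 < N) :
    RegAt U y ((φ * f : (RatFun U)ˣ) : RatFun U) := by
  rcases h with h | h
  · rw [Units.val_mul]; exact h.1.mul h.2.regAt
  · have := h.2.regAt.mul (h.1.pow (N - 1))
    obtain ⟨M, rfl⟩ := Nat.exists_eq_add_of_lt hN
    rwa [← Units.val_pow_eq_pow_val, ← Units.val_mul, zero_add, Nat.add_sub_cancel, pow_succ',
      inv_pow, mul_assoc, mul_assoc, mul_inv_cancel, mul_one, mul_comm] at this

variable [IsLocallyNoetherian U.left] [∀ x : U.left, IsDomain (U.left.presheaf.stalk x)]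

/-- Two equations of the same multiple of the polar divisor differ by a unit; so they define a
Cartier divisor. -/
theorem IsPolarEqnAt.unitAt (hf : IsPolarEqnAt φ N f y) (hg : IsPolarEqnAt φ N g y) :
    UnitAt U y ((f⁻¹ * g : (RatFun U)ˣ) : RatFun U) := by
  have hmul {p q : (RatFun U)ˣ} (hp : UnitAt U y (p : RatFun U)) (hq : UnitAt U y (q : RatFun U)) :
      UnitAt U y ((p⁻¹ * q : (RatFun U)ˣ) : RatFun U) := by
    rw [Units.val_mul]; exact hp.inv.mul hq
  have hpow (h : RegAt U y (φ : RatFun U)) (h' : RegAt U y ((φ⁻¹ : (RatFun U)ˣ) : RatFun U)) :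
      UnitAt U y ((φ ^ N : (RatFun U)ˣ) : RatFun U) := by
    rw [Units.val_pow_eq_pow_val]; exact (UnitAt.of_regAt_inv h h').pow N
  rcases hf with hf | hf <;> rcases hg with hg | hg
  · exact hmul hf.2 hg.2
  · convert hmul (hpow hf.1 hg.1) (hmul hf.2 hg.2) using 2
    rw [mul_comm g, mul_left_comm, inv_mul_cancel_left]
  · convert hmul hf.2 ((Units.val_mul g (φ ^ N)).symm ▸ hg.2.mul (hpow hg.1 hf.1)) using 2
    rw [mul_inv, mul_mul_mul_comm, inv_mul_cancel, mul_one]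
  · convert hmul hf.2 hg.2 using 2
    rw [mul_inv, mul_mul_mul_comm, inv_mul_cancel, mul_one]

/-- Only finitely many points of codimension one lie in the complement of the open set where `f`
and `φ` are units, so that being a polar equation is an open condition. -/
theorem IsPolarEqn.eventually [CompactSpace U.left] (h : IsPolarEqn φ N f x) :
    ∃ V : U.left.Opens, x ∈ V ∧ ∀ z ∈ V, IsPolarEqn φ N f z := by
  have : IsNoetherian U.left := {}
  have hopen : IsOpen {y | UnitAt U y (f : RatFun U) ∧ UnitAt U y (φ : RatFun U)} := by
    refine isOpen_iff_forall_mem_open.2 fun y hy => ?_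
    obtain ⟨V, hyV, hV⟩ := hy.1.eventually
    obtain ⟨V', hyV', hV'⟩ := hy.2.eventually
    exact ⟨V ⊓ V', fun z hz => ⟨hV z hz.1, hV' z hz.2⟩, (V ⊓ V').2, hyV, hyV'⟩
  obtain ⟨S, hSfin, hSclosed, hSirr, hS⟩ :=
    TopologicalSpace.NoetherianSpace.exists_finite_set_isClosed_irreducible hopen.isClosed_compl
  let B : Set U.left := {y | IsCodimOne y ∧ ¬ IsPolarEqnAt φ N f y}
  have hBfin : B.Finite := by
    have hinj : Function.Injective fun y : U.left => closure {y} := fun y z hyz =>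
      (inseparable_iff_closure_eq.2 hyz).eq
    refine (hSfin.preimage hinj.injOn).subset fun y hy => ?_
    have hyS : y ∈ ⋃₀ S := hS ▸ fun hy' => hy.2 (Or.inl ⟨hy'.2.regAt, hy'.1⟩)
    obtain ⟨t, ht, hyt⟩ := hyS
    obtain ⟨w, hw⟩ := QuasiSober.sober (hSirr t ht) (hSclosed t ht)
    have hwy : w ⤳ y := by rw [specializes_iff_mem_closure, hw.def]; exact hyt
    rcases hy.1.2 w hwy with rfl | hw'
    · exact (show closure {w} ∈ S from hw.def.symm ▸ ht)
    · have hwS : w ∈ ⋃₀ S := ⟨t, ht, hw.mem⟩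
      rw [← hS] at hwS
      exact absurd ⟨unitAt_generic ⟨w, hw'⟩ f, unitAt_generic ⟨w, hw'⟩ φ⟩ hwS
  refine ⟨⟨(⋃ y ∈ B, closure {y})ᶜ,
    (hBfin.isClosed_biUnion fun y _ => isClosed_closure).isOpen_compl⟩, fun hx => ?_,
    fun z hz y hy hyz => ?_⟩
  · obtain ⟨y, hyB, hxy⟩ := Set.mem_iUnion₂.1 hx
    exact hyB.2 (h y hyB.1 (specializes_iff_mem_closure.2 hxy))
  · by_contra hcon
    exact hz (Set.mem_iUnion₂.2 ⟨y, ⟨hy, hcon⟩, specializes_iff_mem_closure.1 hyz⟩)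

open Classical in
/-- The rational function which takes the value `v` at `η` and `1` at the other generic points. -/
def unitOfValue (η : genericPoints U.left) {v : U.left.presheaf.stalk (η : U.left)} (hv : v ≠ 0) :
    (RatFun U)ˣ :=
  IsUnit.unit (a := (Function.update (fun _ => 1) η v : RatFun U)) <|
    isUnit_ratFun_iff.2 fun η' => by
      rcases eq_or_ne η' η with rfl | h
      · exact (Function.update_self _ _ _).trans_ne hv
      · exact (Function.update_of_ne h _ _).trans_ne one_ne_zero

omit [IsLocallyNoetherian U.left] in
open Classical in
theorem unitOfValue_apply (η : genericPoints U.left) {v : U.left.presheaf.stalk (η : U.left)}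
    (hv : v ≠ 0) : (unitOfValue η hv : RatFun U) η = v := by
  exact (congrFun (IsUnit.unit_spec _) η).trans (Function.update_self _ _ _)

/-- At a `ℚ`-factorial local ring, some positive multiple of the polar divisor of `φ` has an
equation. -/
theorem exists_isPolarEqn (φ : (RatFun U)ˣ) {x : U.left}
    [IsIntegrallyClosed (U.left.presheaf.stalk x)]
    (hx : IsQFactorialRing (U.left.presheaf.stalk x)) :
    ∃ N f, 0 < N ∧ IsPolarEqn φ N f x := by
  obtain ⟨η, hη⟩ := exists_genericPoints_specializes x
  have hK := isField_stalk_genericPoints η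
  obtain ⟨τ, hτ⟩ : ∃ τ : U.left.presheaf.stalk x →+* U.left.presheaf.stalk (η : U.left),
    τ = (U.left.presheaf.stalkSpecializes hη).hom := ⟨_, rfl⟩
  have hτ0 {z} (hz : z ≠ 0) : τ z ≠ 0 := fun h0 =>
    hz (stalkSpecializes_injective hη ((hτ ▸ h0).trans (map_zero _).symm))
  obtain ⟨a, b, hb, hab⟩ := exists_mul_stalkSpecializes_eq hη ((φ : RatFun U) η)
  replace hab : (φ : RatFun U) η * τ b = τ a := hτ ▸ hab
  have hφ0 := isUnit_ratFun_iff.1 φ.isUnit η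
  have ha : a ≠ 0 := fun h0 => by
    rw [h0, map_zero] at hab
    exact mul_ne_zero hφ0 (hτ0 hb) hab
  have hinv : ((φ⁻¹ : (RatFun U)ˣ) : RatFun U) η * (φ : RatFun U) η = 1 :=
    congrFun (Units.inv_mul φ) η
  obtain ⟨N, c, d, hN, hc, hd, h⟩ := exists_multiple_of_polarDivisor hx ha hb
  obtain ⟨d', hd'⟩ := hK.mul_inv_cancel (hτ0 hd)
  have hd0 : d' ≠ 0 := right_ne_zero_of_mul (hd'.trans_ne one_ne_zero)
  refine ⟨N, unitOfValue η (mul_ne_zero (hτ0 hc) hd0), hN, fun y hy hyx => ?_⟩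
  have hf := unitOfValue_apply η (mul_ne_zero (hτ0 hc) hd0)
  generalize unitOfValue η (mul_ne_zero (hτ0 hc) hd0) = f at hf ⊢
  have hηy := specializes_genericPoints_of_specializes hη hyx
  obtain ⟨p, hp⟩ := exists_pointOfPrime_eq hyx
  have hu (s) := isUnit_stalkSpecializes_iff hyx hp s
  have hfd : (f : RatFun U) η * τ d = τ c := by rw [hf]; linear_combination τ c * hd'
  have h1 : ((φ⁻¹ : (RatFun U)ˣ) : RatFun U) η * τ a = τ b := by
    linear_combination τ b * hinv - ((φ⁻¹ : (RatFun U)ˣ) : RatFun U) η * hab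
  have h2 : ((f * φ ^ N : (RatFun U)ˣ) : RatFun U) η * τ (d * b ^ N) = τ (c * a ^ N) := by
    have h3 : ((f * φ ^ N : (RatFun U)ˣ) : RatFun U) η =
      (f : RatFun U) η * ((φ : RatFun U) η) ^ N := rfl
    rw [h3, map_mul, map_mul, map_pow, map_pow, ← hfd, ← hab]
    ring
  subst hτ
  refine (h p.asIdeal p.2 (isCodimOne_pointOfPrime_iff.1 (hp ▸ hy))).imp ?_ ?_
  · rintro ⟨⟨s, hs, hd1⟩, s', t', hs', ht', e⟩
    exact ⟨regAt_of_dvd hηy hyx hb hab ((hu s).2 hs) hd1,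
      unitAt_of_mul_eq hηy hyx hd hfd ((hu s').2 hs') ((hu t').2 ht') e⟩
  · rintro ⟨⟨s, hs, hd1⟩, s', t', hs', ht', e⟩
    exact ⟨regAt_of_dvd hηy hyx ha h1 ((hu s).2 hs) hd1,
      unitAt_of_mul_eq hηy hyx (mul_ne_zero hd (pow_ne_zero N hb)) h2 ((hu s').2 hs')
        ((hu t').2 ht') e⟩

/-- On a compact locally `ℚ`-factorial scheme some multiple of the polar divisor of a rational
function `φ` is an effective Cartier divisor, whose sections contain `φ`. -/
theorem exists_cartierDivisor_of_isQFactorialRing [CompactSpace U.left]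
    (hint : ∀ x : U.left, IsIntegrallyClosed (U.left.presheaf.stalk x))
    (hQ : ∀ x : U.left, IsQFactorialRing (U.left.presheaf.stalk x)) (φ : (RatFun U)ˣ) :
    ∃ D : CartierDivisor U, (1 : RatFun U) ∈ globalSections D ∧
      (φ : RatFun U) ∈ globalSections D := by
  have hloc (x : U.left) : ∃ (V : U.left.Opens) (N : ℕ) (f : (RatFun U)ˣ), x ∈ V ∧ 0 < N ∧
      ∀ z ∈ V, IsPolarEqn φ N f z := by
    obtain ⟨N, f, hN, h⟩ := exists_isPolarEqn φ (hQ x)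
    obtain ⟨V, hx, hV⟩ := h.eventually
    exact ⟨V, N, f, hx, hN, hV⟩
  choose V N f hxV hN hV using hloc
  obtain ⟨t, ht⟩ := isCompact_univ.elim_finite_subcover (fun x => (V x : Set U.left))
    (fun x => (V x).2) fun x _ => Set.mem_iUnion.2 ⟨x, hxV x⟩
  have hcov (x : U.left) : ∃ i ∈ t, x ∈ V i := by
    simpa using ht (Set.mem_univ x)
  choose i hit hxi using hcov
  -- passing to a common multiple `M` of the local multiplicities makes the equations comparable
  set M := ∏ j ∈ t, N j with hMdef
  have hM : 0 < M := Finset.prod_pos fun j _ => hN j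
  have hpolar {x z : U.left} (hz : z ∈ V (i x)) :
      IsPolarEqn φ M (f (i x) ^ (M / N (i x))) z := by
    have := (hV (i x) z hz).pow (M / N (i x))
    rwa [Nat.mul_div_cancel' (Finset.dvd_prod_of_mem N (hit x))] at this
  refine ⟨ofEquations (fun x => f (i x) ^ (M / N (i x))) fun x => ⟨V (i x), hxi x, fun y hy =>
    have := hint y
    unitAt_of_forall_isCodimOne fun z hz hzy =>
      (hpolar (hxi y) z hz hzy).unitAt (hpolar hy z hz hzy)⟩, ?_, ?_⟩
  · refine mem_globalSections_of_regAt fun x => ⟨_, isEqn_ofEquations _ _ x, ?_⟩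
    have := hint x
    rw [one_mul]
    exact regAt_of_forall_isCodimOne fun z hz hzx => (hpolar (hxi x) z hz hzx).regAt
  · refine mem_globalSections_of_regAt fun x => ⟨_, isEqn_ofEquations _ _ x, ?_⟩
    have := hint x
    rw [← Units.val_mul]
    exact regAt_of_forall_isCodimOne fun z hz hzx => (hpolar (hxi x) z hz hzx).regAt_mul hM

/-- For each generic point and each of finitely many generators of the function field, take an
effective Cartier divisor which has a rational function with this value as a section, and add them
all up. -/
theorem exists_algAmple_of_isQFactorialRing [CompactSpace U.left] [LocallyOfFiniteType U.hom]
    (hint : ∀ x : U.left, IsIntegrallyClosed (U.left.presheaf.stalk x))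
    (hQ : ∀ x : U.left, IsQFactorialRing (U.left.presheaf.stalk x)) :
    ∃ D : CartierDivisor U, AlgAmple D := by
  have : IsNoetherian U.left := {}
  have : Finite (genericPoints U.left) :=
    (genericPoints.finite (finite_irreducibleComponents_of_isNoetherian (X := U.left))).to_subtype
  choose A hA hgen using fun η : genericPoints U.left =>
    exists_finite_isFieldGenerated (U := U) (η : U.left)
  have (η : genericPoints U.left) : Finite (A η) := (hA η).to_subtype
  have hsec (j : Σ η, A η) : ∃ (D : CartierDivisor U) (s : RatFun U),
      (1 : RatFun U) ∈ globalSections D ∧ s ∈ globalSections D ∧ s j.1 = j.2 := by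
    rcases eq_or_ne (j.2 : U.left.presheaf.stalk (j.1 : U.left)) 0 with h0 | h0
    · exact ⟨0, 0, one_mem_globalSections_zero, zero_mem _, h0.symm⟩
    · obtain ⟨D, h1, hφ⟩ := exists_cartierDivisor_of_isQFactorialRing hint hQ (unitOfValue j.1 h0)
      exact ⟨D, _, h1, hφ, unitOfValue_apply _ _⟩
  choose D s h1 hs hval using hsec
  have := Fintype.ofFinite (Σ η, A η)
  refine ⟨∑ j, D j, algAmple_of_algGenerates (one_mem_globalSections_sum _ fun j _ => h1 j)
    (fun j => ⟨s j, ?_⟩) fun η => ?_⟩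
  · simpa only [one_nsmul] using
      globalSections_nsmul_le_sum _ (fun i _ => h1 i) (Finset.mem_univ j) 1
        (by rw [one_nsmul]; exact hs j)
  · have hη := isField_stalk_genericPoints η
    refine algGenerates_of_fractions_of_isField hη fun z => ?_
    obtain ⟨p, q, hp, hq, h⟩ := hgen η z
    have hle : Set.range (constStalk U (η : U.left)) ∪ A η ⊆
        Set.range (constStalk U (η : U.left)) ∪ Set.range fun j => s j η :=
      Set.union_subset_union_right _ fun a ha => ⟨⟨η, a, ha⟩, hval ⟨η, a, ha⟩⟩
    exact ⟨p, q, Subring.closure_mono hle hp, Subring.closure_mono hle hq, h⟩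

end Polar

end

/-! ### Finiteness properties of varieties -/

section

variable {k : Type u} [Field k] {U : SchemeOver k}

theorem IsVariety.isLocallyNoetherian (hU : IsVariety U) : IsLocallyNoetherian U.left :=
  have := hU.locallyOfFiniteType
  LocallyOfFiniteType.isLocallyNoetherian U.hom

theorem IsVariety.compactSpace (hU : IsVariety U) : CompactSpace U.left :=
  have := hU.quasiCompact
  QuasiCompact.compactSpace_of_compactSpace U.hom

end

end BigDivisors

end

theorem proposition1 (k : Type u) [Field k] [IsAlgClosed k]
    (U : BigDivisors.SchemeOver k) (hU : BigDivisors.IsVariety U)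
    (hnormal : BigDivisors.IsNormal U.left)
    (h : BigDivisors.IsQuasiProjective U ∨
      BigDivisors.IsProductOfVarietiesWithBigDivisors U ∨
      BigDivisors.IsLocallyQFactorial U.left) :
    BigDivisors.HasBigDivisor U := by
  have := hU.locallyOfFiniteType
  have := hU.isLocallyNoetherian
  have := hU.compactSpace
  have (x : U.left) : IsDomain (U.left.presheaf.stalk x) := (hnormal x).1
  suffices h : ∃ D : BigDivisors.CartierDivisor U, BigDivisors.AlgAmple D by
    obtain ⟨D, hD⟩ := h
    exact ⟨D, hD.isBig⟩
  rcases h with ⟨n, i, hi⟩ | ⟨n, X, p, ⟨hlim⟩, hX⟩ | hQ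
  · exact BigDivisors.exists_algAmple_of_locallyQuasiFinite i
  · have (i : Fin n) (x : (X i).left) : IsDomain ((X i).left.presheaf.stalk x) :=
      ((hX i).2.1 x).1
    refine BigDivisors.exists_algAmple_of_product hlim fun i => ?_
    have := (hX i).1.isLocallyNoetherian
    obtain ⟨D, hD⟩ := (hX i).2.2
    exact hD.exists_algAmple
  · exact BigDivisors.exists_algAmple_of_isQFactorialRing (fun x => (hnormal x).2) hQ
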